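/- Let $R$ be a unital associative ring and let $S$ be an $R$-bimodule that is flat as a left $R$-module. A complex is a $\mathbb{Z}$-graded chain complex of right $R$-modules. A complex of projective modules is finite if the direct sum of its terms is finitely generated, and h-finite if it is chain homotopy equivalent to a finite one. A homology equivalence is a chain map that induces isomorphisms on homology. A $\mathscr{D}_0$-complex $C_*$ consists of complexes $C_i$ ($i\in\mathbb{N}$) of projective right $R$-modules with chain maps $\lambda_i\colon C_i\to C_{i+1}$ ($i\ge 0$) and $\alpha_i\colon C_i\to C_{i-1}\otimes_R S$ ($i\ge 1$) such that $\alpha_{i+1}\lambda_i=(\lambda_{i-1}\otimes 1)\,\alpha_i$ for $i\ge 1$; morphisms are families of chain maps that commute with all $\lambda_i$ and $\alpha_i$. It is reduced if all $\alpha_i$ are surjective, and acyclic if all $C_i$ are acyclic. For $n\ge 0$, let $\mathcal{A}_n$ be the class of the $\mathscr{D}_0$-complexes $B_*$ such that $B_0=0$, each $B_i$ is h-finite, each $\lambda_i$ is injective in each degree with projective cokernel, $\lambda_i$ is a homology equivalence for all $i\ge n$, and $B_n$ is contractible. Let $\mathcal{A}=\bigcup_n\mathcal{A}_n$. Call a class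 of $\mathscr{D}_0$-complexes exact if it contains all acyclic $\mathscr{D}_0$-complexes that are finite at each vertex and if, whenever two terms of a short exact sequence of $\mathscr{D}_0$-complexes belong to it, so does the third. Let $\tilde{\mathcal{A}}$ be the smallest exact class that contains $\mathcal{A}$ and is stable under arbitrary direct sums. A $\mathscr{D}_0$-complex $C_*$ is $\mathcal{A}_n$-local if every morphism $Y_*\to C_*$ with $Y_*\in\mathcal{A}_n$ factors through an acyclic $\mathscr{D}_0$-complex. Proposition 5. Let $n\ge 0$ and let $C_*$ be a reduced $\mathscr{D}_0$-complex in $\tilde{\mathcal{A}}$. The following are equivalent: (i) $C_*$ is $\mathcal{A}_n$-local; (ii) for every $m$ with $1\le m<n$, the map $\lambda_m$ induces a homology equivalence $\operatorname{Ker}(\alpha_m)\to\operatorname{Ker}(\alpha_{m+1})$; (iii) for every $m$ with $1\le m<n$, the commutative square with top $\lambda_m\colon C_m\to C_{m+1}$, bottom $\lambda_{m-1}\otimes 1\colon C_{m-1}\otimes_R S\to C_m\otimes_R S$ and vertical maps $\alpha_m,\alpha_{m+1}$ is both a homotopy pullback and a homotopy pushout. -/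

import Mathlib

open CategoryTheory CategoryTheory.Limits
open scoped TensorProduct DirectSum MulOpposite

universe u

noncomputable section

/-! ## The tensor product `M ⊗_R S` over a noncommutative ring

Right `R`-modules are modules over `Rᵐᵒᵖ`; an `R`-bimodule `S` carries commuting actions of `R`
(on the left) and of `Rᵐᵒᵖ` (on the right). -/

section Tensor

variable (R S : Type u) [Ring R] [AddCommGroup S] [Module R S] [Module Rᵐᵒᵖ S]
  [SMulCommClass R Rᵐᵒᵖ S]

/-- The relations `m ⊗ r s = m r ⊗ s`. The factors are written in the order `s ⊗ m`, so that the
right action of `R` on `S` is the one that Mathlib puts on the tensor product over `ℤ`. -/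
def balancedRel (M : Type u) [AddCommGroup M] [Module Rᵐᵒᵖ M] : Submodule Rᵐᵒᵖ (S ⊗[ℤ] M) :=
  Submodule.span Rᵐᵒᵖ
    {x | ∃ (s : S) (r : R) (m : M), x = (r • s) ⊗ₜ[ℤ] m - s ⊗ₜ[ℤ] (MulOpposite.op r • m)}

/-- The right `R`-module `M ⊗_R S`, for a right `R`-module `M` and an `R`-bimodule `S`; the right
action comes from the one on `S`. -/
abbrev BalancedTensor (M : Type u) [AddCommGroup M] [Module Rᵐᵒᵖ M] : Type u :=
  (S ⊗[ℤ] M) ⧸ balancedRel R S M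

/-- The map `f ⊗ 1 : M ⊗_R S → N ⊗_R S`. -/
def balancedMap {M N : Type u} [AddCommGroup M] [Module Rᵐᵒᵖ M] [AddCommGroup N] [Module Rᵐᵒᵖ N]
    (f : M →ₗ[Rᵐᵒᵖ] N) : BalancedTensor R S M →ₗ[Rᵐᵒᵖ] BalancedTensor R S N :=
  Submodule.mapQ (balancedRel R S M) (balancedRel R S N)
    (TensorProduct.AlgebraTensorModule.lTensor Rᵐᵒᵖ S f.toAddMonoidHom.toIntLinearMap) (by
      unfold balancedRel
      rw [Submodule.span_le]
      rintro x ⟨s, r, m, rfl⟩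
      refine Submodule.subset_span ⟨s, r, f m, ?_⟩
      simp)

variable {R S} in
lemma BalancedTensor.hom_ext {M N : Type u} [AddCommGroup M] [Module Rᵐᵒᵖ M]
    [AddCommGroup N] [Module Rᵐᵒᵖ N] {f g : BalancedTensor R S M →ₗ[Rᵐᵒᵖ] N}
    (h : ∀ (s : S) (m : M), f ((balancedRel R S M).mkQ (s ⊗ₜ[ℤ] m)) =
      g ((balancedRel R S M).mkQ (s ⊗ₜ[ℤ] m))) : f = g := by
  apply Submodule.linearMap_qext
  refine LinearMap.ext fun x => ?_
  change f ((balancedRel R S M).mkQ x) = g ((balancedRel R S M).mkQ x)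
  induction x using TensorProduct.induction_on with
  | zero => simp
  | tmul s m => exact h s m
  | add x y hx hy => rw [map_add, map_add, map_add, hx, hy]

/-- The functor `- ⊗_R S` on right `R`-modules. -/
def tensorBimod : ModuleCat.{u} Rᵐᵒᵖ ⥤ ModuleCat.{u} Rᵐᵒᵖ where
  obj M := ModuleCat.of Rᵐᵒᵖ (BalancedTensor R S M)
  map f := ModuleCat.ofHom (balancedMap R S f.hom)
  map_id M := by
    apply ModuleCat.hom_ext
    exact BalancedTensor.hom_ext fun s m => rfl
  map_comp f g := by
    apply ModuleCat.hom_ext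
    exact BalancedTensor.hom_ext fun s m => rfl

instance : (tensorBimod R S).Additive where
  map_add {M N f g} := by
    apply ModuleCat.hom_ext
    refine BalancedTensor.hom_ext fun s m => ?_
    change (balancedRel R S N).mkQ (s ⊗ₜ[ℤ] (f.hom m + g.hom m)) =
      (balancedRel R S N).mkQ (s ⊗ₜ[ℤ] f.hom m) + (balancedRel R S N).mkQ (s ⊗ₜ[ℤ] g.hom m)
    rw [TensorProduct.tmul_add, map_add]

/-- `S` is flat as a left `R`-module: `- ⊗_R S` preserves injections of right `R`-modules. -/
def IsLeftFlat : Prop :=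
  ∀ ⦃M N : ModuleCat.{u} Rᵐᵒᵖ⦄ (f : M ⟶ N), Function.Injective f →
    Function.Injective ((tensorBimod R S).map f)

/-- The functor `- ⊗_R S` on `ℤ`-graded chain complexes of right `R`-modules. -/
abbrev tensorComplex :
    ChainComplex (ModuleCat.{u} Rᵐᵒᵖ) ℤ ⥤ ChainComplex (ModuleCat.{u} Rᵐᵒᵖ) ℤ :=
  (tensorBimod R S).mapHomologicalComplex (ComplexShape.down ℤ)

end Tensor

/-! ## Complexes of right modules -/

section Complexes

variable {R : Type u} [Ring R]

/-- Each term is a projective right module. -/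
def IsProjectiveComplex (X : ChainComplex (ModuleCat.{u} Rᵐᵒᵖ) ℤ) : Prop :=
  ∀ k, Module.Projective Rᵐᵒᵖ (X.X k)

/-- Finite complex of projective right modules: `⨁ X_k` is finitely generated. -/
def IsFiniteComplex (X : ChainComplex (ModuleCat.{u} Rᵐᵒᵖ) ℤ) : Prop :=
  IsProjectiveComplex X ∧ Module.Finite Rᵐᵒᵖ (⨁ k : ℤ, X.X k)

/-- Homotopy equivalent to a finite complex. -/
def IsHFinite (X : ChainComplex (ModuleCat.{u} Rᵐᵒᵖ) ℤ) : Prop :=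
  ∃ F : ChainComplex (ModuleCat.{u} Rᵐᵒᵖ) ℤ, IsFiniteComplex F ∧ Nonempty (HomotopyEquiv F X)

/-- The identity is null-homotopic. -/
def IsContractibleComplex (X : ChainComplex (ModuleCat.{u} Rᵐᵒᵖ) ℤ) : Prop :=
  Nonempty (Homotopy (𝟙 X) 0)

/-- Cofibration between complexes of projectives: injective in each degree, with projective
cokernel. -/
def IsCofib {X Y : ChainComplex (ModuleCat.{u} Rᵐᵒᵖ) ℤ} (f : X ⟶ Y) : Prop :=
  ∀ k, Function.Injective (f.f k) ∧
    Module.Projective Rᵐᵒᵖ (Y.X k ⧸ LinearMap.range (f.f k).hom)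

/-- The commutative square with top `f`, left side `g`, right side `h` and bottom `k` is a homotopy
pullback: after replacing `h` by a surjection (through a homology equivalence), the map to the
pullback is a homology equivalence. -/
def IsHomotopyPullback {A B C D : ChainComplex (ModuleCat.{u} Rᵐᵒᵖ) ℤ}
    (f : A ⟶ B) (g : A ⟶ C) (h : B ⟶ D) (k : C ⟶ D) (w : f ≫ h = g ≫ k) : Prop :=
  ∃ (B' : ChainComplex (ModuleCat.{u} Rᵐᵒᵖ) ℤ) (j : B ⟶ B') (p : B' ⟶ D) (hj : j ≫ p = h),
    QuasiIso j ∧ Epi p ∧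
      QuasiIso (pullback.lift (f := p) (g := k) (f ≫ j) g (by rw [Category.assoc, hj, w]))

/-- The commutative square with top `f`, left side `g`, right side `h` and bottom `k` is a homotopy
pushout: after replacing `f` by an injection (through a homology equivalence), the map from the
pushout is a homology equivalence. -/
def IsHomotopyPushout {A B C D : ChainComplex (ModuleCat.{u} Rᵐᵒᵖ) ℤ}
    (f : A ⟶ B) (g : A ⟶ C) (h : B ⟶ D) (k : C ⟶ D) (w : f ≫ h = g ≫ k) : Prop :=
  ∃ (B' : ChainComplex (ModuleCat.{u} Rᵐᵒᵖ) ℤ) (i : A ⟶ B') (q : B' ⟶ B) (hi : i ≫ q = f),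
    Mono i ∧ QuasiIso q ∧
      QuasiIso (pushout.desc (f := i) (g := g) (q ≫ h) k (by rw [← Category.assoc, hi, w]))

end Complexes

/-! ## `𝒟₀`-complexes -/

section DZero

variable (R S : Type u) [Ring R] [AddCommGroup S] [Module R S] [Module Rᵐᵒᵖ S]
  [SMulCommClass R Rᵐᵒᵖ S]

/-- A `𝒟₀`-complex: complexes `C_i` of projective right `R`-modules for `i ∈ ℕ`, with chain maps
`λ_i : C_i → C_{i+1}` and `α_{i+1} : C_{i+1} → C_i ⊗_R S` such that the two composites
`C_{i+1} → C_{i+1} ⊗_R S` agree. Beware of the index: `alp i` is `α_{i+1}`. -/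
structure DZeroComplex where
  X : ℕ → ChainComplex (ModuleCat.{u} Rᵐᵒᵖ) ℤ
  projective : ∀ i, IsProjectiveComplex (X i)
  lam : ∀ i, X i ⟶ X (i + 1)
  alp : ∀ i, X (i + 1) ⟶ (tensorComplex R S).obj (X i)
  comm : ∀ i, lam (i + 1) ≫ alp (i + 1) = alp i ≫ (tensorComplex R S).map (lam i)

namespace DZeroComplex

variable {R S}

/-- Morphisms: families of chain maps that commute with all `λ` and `α`. -/
@[ext]
structure Hom (C D : DZeroComplex R S) where
  f : ∀ i, C.X i ⟶ D.X i
  comm_lam : ∀ i, C.lam i ≫ f (i + 1) = f i ≫ D.lam i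
  comm_alp : ∀ i, C.alp i ≫ (tensorComplex R S).map (f i) = f (i + 1) ≫ D.alp i

instance : Category (DZeroComplex R S) where
  Hom := Hom
  id C :=
    { f := fun i => 𝟙 (C.X i)
      comm_lam := fun i => by rw [Category.comp_id, Category.id_comp]
      comm_alp := fun i => by
        rw [CategoryTheory.Functor.map_id, Category.comp_id, Category.id_comp] }
  comp {C D E} φ ψ :=
    { f := fun i => φ.f i ≫ ψ.f i
      comm_lam := fun i => by
        rw [← Category.assoc, φ.comm_lam, Category.assoc, ψ.comm_lam, Category.assoc]
      comm_alp := fun i => by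
        rw [CategoryTheory.Functor.map_comp, ← Category.assoc, φ.comm_alp, Category.assoc,
          ψ.comm_alp, Category.assoc] }
  id_comp φ := Hom.ext (funext fun i => Category.id_comp (φ.f i))
  comp_id φ := Hom.ext (funext fun i => Category.comp_id (φ.f i))
  assoc φ ψ χ := Hom.ext (funext fun i => Category.assoc (φ.f i) (ψ.f i) (χ.f i))

/-- All `α` are surjective. -/
def IsReduced (C : DZeroComplex R S) : Prop :=
  ∀ i k, Function.Surjective ((C.alp i).f k)

/-- Acyclic at each vertex. -/
def IsAcyclic (C : DZeroComplex R S) : Prop :=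
  ∀ i, (C.X i).Acyclic

/-- `0 → A → B → C → 0` is exact at each vertex and in each degree. -/
def IsShortExact {A B C : DZeroComplex R S} (φ : A ⟶ B) (ψ : B ⟶ C) : Prop :=
  ∀ i k, Function.Injective ((φ.f i).f k) ∧
    Function.Exact ((φ.f i).f k) ((ψ.f i).f k) ∧
    Function.Surjective ((ψ.f i).f k)

open Classical in
/-- The morphisms `ι_t : A_t → B` exhibit `B` as the direct sum of the `A_t`. -/
def IsDirectSum {T : Type u} (A : T → DZeroComplex R S) (B : DZeroComplex R S)
    (ι : ∀ t, A t ⟶ B) : Prop :=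
  ∀ i k, Function.Bijective
    (DirectSum.toModule Rᵐᵒᵖ T ((B.X i).X k) (fun t => (((ι t).f i).f k).hom))

/-- Exact class: it contains the acyclic `𝒟₀`-complexes that are finite at each vertex, and if two
terms of a short exact sequence are in it, then so is the third. -/
structure IsExactClass (P : DZeroComplex R S → Prop) : Prop where
  finite_acyclic : ∀ C : DZeroComplex R S, (∀ i, IsFiniteComplex (C.X i)) → C.IsAcyclic → P C
  left : ∀ {A B C : DZeroComplex R S} (φ : A ⟶ B) (ψ : B ⟶ C), IsShortExact φ ψ →
    P B → P C → P A
  middle : ∀ {A B C : DZeroComplex R S} (φ : A ⟶ B) (ψ : B ⟶ C), IsShortExact φ ψ →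
    P A → P C → P B
  right : ∀ {A B C : DZeroComplex R S} (φ : A ⟶ B) (ψ : B ⟶ C), IsShortExact φ ψ →
    P A → P B → P C

/-- Stable under arbitrary direct sums. -/
def IsSumStable (P : DZeroComplex R S → Prop) : Prop :=
  ∀ ⦃T : Type u⦄ (A : T → DZeroComplex R S) (B : DZeroComplex R S) (ι : ∀ t, A t ⟶ B),
    IsDirectSum A B ι → (∀ t, P (A t)) → P B

/-- The completion of a class: the smallest exact class that contains it and is stable under
direct sums. -/
def Completion (P : DZeroComplex R S → Prop) (C : DZeroComplex R S) : Prop :=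
  ∀ Q : DZeroComplex R S → Prop, IsExactClass Q → IsSumStable Q → (∀ Y, P Y → Q Y) → Q C

/-- `C` is `P`-local: each morphism to `C` from a member of `P` factors through an acyclic
`𝒟₀`-complex. -/
def IsLocal (P : DZeroComplex R S → Prop) (C : DZeroComplex R S) : Prop :=
  ∀ Y : DZeroComplex R S, P Y → ∀ φ : Y ⟶ C,
    ∃ (E : DZeroComplex R S) (a : Y ⟶ E) (b : E ⟶ C), E.IsAcyclic ∧ a ≫ b = φ

/-- The class `𝓑_n`. -/
structure ClassB (n : ℕ) (C : DZeroComplex R S) : Prop where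
  zero : IsZero (C.X 0)
  hfinite : ∀ i, IsHFinite (C.X i)
  cofib : ∀ i, IsCofib (C.lam i)
  quasiIso : ∀ i, n ≤ i → QuasiIso (C.lam i)

/-- The class `𝓐_n` of the members of `𝓑_n` whose `n`-th complex is contractible. -/
def ClassA (n : ℕ) (C : DZeroComplex R S) : Prop :=
  ClassB n C ∧ IsContractibleComplex (C.X n)

/-- The class `𝓐`, the union of the `𝓐_n`. -/
def ClassAUnion (C : DZeroComplex R S) : Prop :=
  ∃ n, ClassA n C

/-- The map `Ker(α_m) → Ker(α_{m+1})` induced by `λ_m`, for `m = i + 1`. -/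
def kerMap (C : DZeroComplex R S) (i : ℕ) : kernel (C.alp i) ⟶ kernel (C.alp (i + 1)) :=
  kernel.map (C.alp i) (C.alp (i + 1)) (C.lam (i + 1)) ((tensorComplex R S).map (C.lam i))
    (C.comm i).symm

/-- For `m = i + 1`, the square with top `λ_m : C_m → C_{m+1}`, bottom
`λ_{m-1} ⊗ 1 : C_{m-1} ⊗ S → C_m ⊗ S` and vertical maps `α_m`, `α_{m+1}` is both a homotopy
pullback and a homotopy pushout. -/
def IsExactSquare (C : DZeroComplex R S) (i : ℕ) : Prop :=
  IsHomotopyPullback (C.lam (i + 1)) (C.alp i) (C.alp (i + 1))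
      ((tensorComplex R S).map (C.lam i)) (C.comm i) ∧
    IsHomotopyPushout (C.lam (i + 1)) (C.alp i) (C.alp (i + 1))
      ((tensorComplex R S).map (C.lam i)) (C.comm i)

end DZeroComplex

end DZero

end

/-! Everything is reduced to elements: a map is a homology equivalence exactly when each cycle of
its cone bounds (`quasiIso_iff_coneExact`), and `KerCone` is this condition for the map `Ker(α_m) →
Ker(α_{m+1})`.

From local to equivalent kernels: a cycle `(x, z)` of the cone of `Ker(α_m) → Ker(α_{m+1})` defines
a morphism to `C` from a member of `𝓐_n` with `α = 0`, built from the cone of the identity of `R`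
(`exists_hom_test`, `classA_test`). If the morphism factors through an acyclic `E`, the cycle bounds
in `E`; since `E ⊗ S` is acyclic by flatness and the `α` of `C` are surjective, the image of the
bounding chain can be corrected until it lies in the kernels (`kerCone_of_lift`).

From equivalent kernels to local: a null-homotopy of `φ : Y → C` that commutes with all `λ` and `α`
is a lift of `φ` to the acyclic path complex of `C` (`exists_factorization`). Extending it from
`Y_i` to `Y_{i+1}`, with prescribed image under `α`, is a relative lifting problem into
`Ker(α_{i+1})` (`exists_nullHomotopy_ext_lift`), which may be obstructed for `i < n`. With the
indices reversed, so that `D_p = C_{n-p}`, the remedy is to factor `φ` through a tower `Y = W_0 →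
W_1 → ⋯` over `D`: the term of `W_{j+1}` at `p` is the fibre of `V_p → V_0`, where `V_p = D_p
×_{D_{p+1} ⊗ S} (W_{j,p+1} ⊗ S)`. The map `Y → W_1` exists because `Y_n` is contractible. In these
fibres the contributions of the kernels of `α` cancel, by the hypothesis on kernels
(`step_exactAt`). So only the `W_{j,p+1} ⊗ S` count, and every `n` steps the range of exactness
grows downwards by one degree (`exists_iter_exactAbove`). A finite model of `Y` is bounded below,
hence maps from `Y` to a late stage are null-homotopic, also relatively, and the homotopies can be
built compatibly (`exists_homotopy`). Above `n` the terms of `Y` are contractible and nothing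
obstructs the extension (`IsHomotopyUpTo.exists_succ`).

The squares: their vertical maps are surjective, so being a homotopy pullback or a homotopy pushout
is a comparison of the strict kernels of these maps. -/

noncomputable section

/-! ## Exactness of the tensor product -/

section TensorExact

variable (R S : Type u) [Ring R] [AddCommGroup S] [Module R S] [Module Rᵐᵒᵖ S]
  [SMulCommClass R Rᵐᵒᵖ S]

/-- The action of `- ⊗_R S` on linear maps between objects of `ModuleCat`. -/
def tensorMap {M N : ModuleCat.{u} Rᵐᵒᵖ} (f : M →ₗ[Rᵐᵒᵖ] N) :
    (tensorBimod R S).obj M →ₗ[Rᵐᵒᵖ] (tensorBimod R S).obj N :=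
  ((tensorBimod R S).map (ModuleCat.ofHom f)).hom

variable {R S}

lemma tensorMap_comp {L M N : ModuleCat.{u} Rᵐᵒᵖ} (f : L →ₗ[Rᵐᵒᵖ] M) (g : M →ₗ[Rᵐᵒᵖ] N) :
    tensorMap R S (g ∘ₗ f) = tensorMap R S g ∘ₗ tensorMap R S f := by
  unfold tensorMap
  rw [ModuleCat.ofHom_comp, Functor.map_comp, ModuleCat.hom_comp]

lemma tensorMap_id (M : ModuleCat.{u} Rᵐᵒᵖ) :
    tensorMap R S (LinearMap.id : M →ₗ[Rᵐᵒᵖ] M) = LinearMap.id := by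
  unfold tensorMap
  exact congrArg ModuleCat.Hom.hom ((tensorBimod R S).map_id M)

lemma tensorMap_add {M N : ModuleCat.{u} Rᵐᵒᵖ} (f g : M →ₗ[Rᵐᵒᵖ] N) :
    tensorMap R S (f + g) = tensorMap R S f + tensorMap R S g := by
  unfold tensorMap
  rw [ModuleCat.ofHom_add, Functor.map_add, ModuleCat.hom_add]

lemma tensorMap_zero (M N : ModuleCat.{u} Rᵐᵒᵖ) :
    tensorMap R S (0 : M →ₗ[Rᵐᵒᵖ] N) = 0 := by
  have := tensorMap_add (R := R) (S := S) (0 : M →ₗ[Rᵐᵒᵖ] N) 0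
  rw [add_zero] at this
  exact left_eq_add.mp this

lemma tensorMap_neg {M N : ModuleCat.{u} Rᵐᵒᵖ} (f : M →ₗ[Rᵐᵒᵖ] N) :
    tensorMap R S (-f) = -tensorMap R S f := by
  have := tensorMap_add (R := R) (S := S) (-f) f
  rw [neg_add_cancel, tensorMap_zero] at this
  exact eq_neg_of_add_eq_zero_left this.symm

lemma tensorMap_tensorMap {L M N : ModuleCat.{u} Rᵐᵒᵖ} (f : L →ₗ[Rᵐᵒᵖ] M) (g : M →ₗ[Rᵐᵒᵖ] N)
    (x : (tensorBimod R S).obj L) :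
    tensorMap R S g (tensorMap R S f x) = tensorMap R S (g ∘ₗ f) x := by
  rw [tensorMap_comp]; rfl

lemma tensorMap_comm {L M M' N : ModuleCat.{u} Rᵐᵒᵖ} {f : L →ₗ[Rᵐᵒᵖ] M} {g : M →ₗ[Rᵐᵒᵖ] N}
    {f' : L →ₗ[Rᵐᵒᵖ] M'} {g' : M' →ₗ[Rᵐᵒᵖ] N} (h : ∀ x, g (f x) = g' (f' x))
    (x : (tensorBimod R S).obj L) :
    tensorMap R S g (tensorMap R S f x) = tensorMap R S g' (tensorMap R S f' x) := by
  rw [tensorMap_tensorMap, tensorMap_tensorMap]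
  congr 2
  exact LinearMap.ext h

lemma tensorMap_injective (hS : IsLeftFlat R S) {M N : ModuleCat.{u} Rᵐᵒᵖ} {f : M →ₗ[Rᵐᵒᵖ] N}
    (hf : Function.Injective f) : Function.Injective (tensorMap R S f) :=
  hS (ModuleCat.ofHom f) hf

/-- The tensor product over `ℤ` is right exact, and each balancing relation over `N` lifts to one
over `M` because `g` is surjective. An element with image zero is therefore first changed by a
relation, so that it vanishes already over `ℤ`. -/
lemma tensorMap_exact_of_surjective {L M N : ModuleCat.{u} Rᵐᵒᵖ} {f : L →ₗ[Rᵐᵒᵖ] M}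
    {g : M →ₗ[Rᵐᵒᵖ] N} (h : Function.Exact f g) (hg : Function.Surjective g) :
    Function.Exact (tensorMap R S f) (tensorMap R S g) := by
  refine fun y => ⟨fun hy => ?_, ?_⟩
  · obtain ⟨y, rfl⟩ := (balancedRel R S M).mkQ_surjective y
    let G : S ⊗[ℤ] M →ₗ[Rᵐᵒᵖ] S ⊗[ℤ] N :=
      TensorProduct.AlgebraTensorModule.lTensor Rᵐᵒᵖ S g.toAddMonoidHom.toIntLinearMap
    have hy' : G y ∈ balancedRel R S N := by
      rw [← Submodule.ker_mkQ (balancedRel R S N)]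
      exact hy
    have hmap : balancedRel R S N ≤ (balancedRel R S M).map G := by
      unfold balancedRel
      rw [Submodule.span_le]
      rintro x ⟨s, r, n, rfl⟩
      obtain ⟨m, rfl⟩ := hg n
      refine ⟨_, Submodule.subset_span ⟨s, r, m, rfl⟩, ?_⟩
      simp [G]
    obtain ⟨y', hy'm, hyy'⟩ := hmap hy'
    have hex := lTensor_exact (R := ℤ) (f := f.toAddMonoidHom.toIntLinearMap)
      (g := g.toAddMonoidHom.toIntLinearMap) S h hg
    obtain ⟨z, hz⟩ := (hex (y - y')).1 (by
      have : G (y - y') = 0 := by rw [map_sub, hyy', sub_self]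
      exact this)
    refine ⟨(balancedRel R S L).mkQ z, ?_⟩
    have h1 : (balancedRel R S M).mkQ (y - y') = (balancedRel R S M).mkQ y := by
      rw [map_sub, sub_eq_self]
      exact (Submodule.Quotient.mk_eq_zero _).2 hy'm
    refine Eq.trans ?_ h1
    rw [← hz]
    rfl
  · rintro ⟨x, rfl⟩
    rw [tensorMap_tensorMap, h.linearMap_comp_eq_zero, tensorMap_zero]
    rfl

/-- Factor `g` through its image: the surjective part is handled by right exactness, and flatness
keeps the inclusion of the image injective. -/
lemma tensorMap_exact (hS : IsLeftFlat R S) {L M N : ModuleCat.{u} Rᵐᵒᵖ} {f : L →ₗ[Rᵐᵒᵖ] M}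
    {g : M →ₗ[Rᵐᵒᵖ] N} (h : Function.Exact f g) :
    Function.Exact (tensorMap R S f) (tensorMap R S g) := by
  let N' : ModuleCat.{u} Rᵐᵒᵖ := ModuleCat.of Rᵐᵒᵖ (LinearMap.range g)
  let g' : M →ₗ[Rᵐᵒᵖ] N' := g.rangeRestrict
  let j : N' →ₗ[Rᵐᵒᵖ] N := (LinearMap.range g).subtype
  have hj := tensorMap_injective hS (f := j) Subtype.val_injective
  have hg' : Function.Exact f g' := fun y =>
    ⟨fun hy => (h y).1 (congrArg Subtype.val hy), fun hy => Subtype.ext ((h y).2 hy)⟩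
  intro y
  rw [← tensorMap_exact_of_surjective hg' g.surjective_rangeRestrict y]
  have e : tensorMap R S g y = tensorMap R S j (tensorMap R S g' y) := by
    rw [tensorMap_tensorMap]; rfl
  rw [e, map_eq_zero_iff _ hj]

end TensorExact

/-! ## Complexes with explicit consecutive differentials -/

/-- A family over `ℤ` from its values at the `k + 1`. -/
def ofSucc {P : ℤ → Type*} (f : ∀ k, P (k + 1)) (k : ℤ) : P k := sub_add_cancel k 1 ▸ f (k - 1)

/-- `ModComplex` writes differentials as `X (k + 1) → X k`. A family whose value in a degree
involves the differential out of that degree is thus defined at `k + 1` and extended by `ofSucc`;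
this is its only computation rule. -/
lemma ofSucc_succ {P : ℤ → Type*} (f : ∀ k, P (k + 1)) (k : ℤ) : ofSucc f (k + 1) = f k := by
  have : ∀ j (h : j + 1 = k + 1), (h ▸ f j : P (k + 1)) = f k := by
    intro j h
    obtain rfl : j = k := by omega
    rfl
  exact this _ _

section ModComplex

variable (R : Type u) [Ring R]

/-- A `ℤ`-graded chain complex of right `R`-modules, given by its consecutive differentials. -/
structure ModComplex where
  X : ℤ → ModuleCat.{u} Rᵐᵒᵖ
  d : ∀ k, X (k + 1) →ₗ[Rᵐᵒᵖ] X k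
  d_d : ∀ k x, d k (d (k + 1) x) = 0

variable {R}

namespace ModComplex

/-- Chain maps. -/
structure Hom (A B : ModComplex R) where
  f : ∀ k, A.X k →ₗ[Rᵐᵒᵖ] B.X k
  comm : ∀ k x, f k (A.d k x) = B.d k (f (k + 1) x)

/-- Graded maps of degree one. -/
abbrev DegOne (A B : ModComplex R) := ∀ k, A.X k →ₗ[Rᵐᵒᵖ] B.X (k + 1)

/-- The identity. -/
@[simps] def Hom.id (A : ModComplex R) : Hom A A := ⟨fun _ => LinearMap.id, fun _ _ => rfl⟩

/-- The composite `g ∘ f`. -/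
@[simps] def Hom.comp {A B C : ModComplex R} (g : Hom B C) (f : Hom A B) : Hom A C :=
  ⟨fun k => g.f k ∘ₗ f.f k, fun k x => by simp [f.comm, g.comm]⟩

/-- The zero complex. -/
abbrev zero : ModComplex R := ⟨fun _ => ModuleCat.of Rᵐᵒᵖ PUnit, fun _ => 0, fun _ _ => rfl⟩

/-- The zero map. -/
def Hom.zero (A B : ModComplex R) : Hom A B := ⟨fun _ => 0, fun _ _ => by simp⟩

/-- The complex with terms `X_{k+1}` and the same differentials. -/
abbrev shift (A : ModComplex R) : ModComplex R :=
  ⟨fun k => A.X (k + 1), fun k => A.d (k + 1), fun k => A.d_d (k + 1)⟩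

/-- Exactness in degree `k + 1`. -/
def ExactAt (A : ModComplex R) (k : ℤ) : Prop :=
  ∀ x : A.X (k + 1), A.d k x = 0 → ∃ y, A.d (k + 1) y = x

/-- Exactness in all degrees greater than `a`. -/
def ExactAbove (A : ModComplex R) (a : ℤ) : Prop := ∀ k, a ≤ k → A.ExactAt k

lemma ExactAbove.mono {A : ModComplex R} {a b : ℤ} (h : A.ExactAbove a) (hab : a ≤ b) :
    A.ExactAbove b := fun k hk => h k (hab.trans hk)

/-- The degree one map `h` is a homotopy from `f` to zero. -/
def IsNullHomotopy {A B : ModComplex R} (f : Hom A B) (h : DegOne A B) : Prop :=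
  ∀ k x, f.f (k + 1) x = B.d (k + 1) (h (k + 1) x) + h k (A.d k x)

/-- The kernel of a chain map. -/
abbrev ker {A B : ModComplex R} (f : Hom A B) : ModComplex R where
  X k := ModuleCat.of Rᵐᵒᵖ (LinearMap.ker (f.f k))
  d k := (A.d k ∘ₗ Submodule.subtype _).codRestrict _ fun x => by
    change f.f k (A.d k x.1) = 0
    rw [f.comm, show f.f (k + 1) x.1 = 0 from x.2, map_zero]
  d_d k x := Subtype.ext (A.d_d k x.1)

/-- `f` satisfies the elementwise form of acyclicity of its mapping cone. -/
def ConeExact {A B : ModComplex R} (f : Hom A B) : Prop :=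
  ∀ k (x : A.X (k + 1)) (z : B.X (k + 1 + 1)), A.d k x = 0 → f.f (k + 1) x = B.d (k + 1) z →
    ∃ (x' : A.X (k + 1 + 1)) (z' : B.X (k + 1 + 1 + 1)),
      A.d (k + 1) x' = x ∧ f.f (k + 1 + 1) x' - B.d (k + 1 + 1) z' = z

variable {S : Type u} [AddCommGroup S] [Module R S] [Module Rᵐᵒᵖ S] [SMulCommClass R Rᵐᵒᵖ S]

variable (S) in
/-- The tensor product with the bimodule `S`. -/
abbrev tensor (A : ModComplex R) : ModComplex R where
  X k := (tensorBimod R S).obj (A.X k)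
  d k := tensorMap R S (A.d k)
  d_d k x := by
    rw [tensorMap_tensorMap, show A.d k ∘ₗ A.d (k + 1) = 0 from LinearMap.ext (A.d_d k),
      tensorMap_zero]
    rfl

variable (S) in
/-- The tensor product with the bimodule `S`, on chain maps. -/
@[simps] def Hom.tensor {A B : ModComplex R} (f : Hom A B) : Hom (A.tensor S) (B.tensor S) where
  f k := tensorMap R S (f.f k)
  comm k x := tensorMap_comm (f.comm k) x

lemma ExactAt.tensor (hS : IsLeftFlat R S) {A : ModComplex R} {k : ℤ} (h : A.ExactAt k) :
    (A.tensor S).ExactAt k := by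
  have : Function.Exact (A.d (k + 1)) (A.d k) := fun x =>
    ⟨fun hx => h x hx, by rintro ⟨y, rfl⟩; exact A.d_d k y⟩
  exact fun x hx => (tensorMap_exact hS this x).1 hx

/-- Graded maps that commute with the differentials up to the sign `ε` are null-homotopic, up to
the same sign. -/
def NullsInto (A Z : ModComplex R) (ε : ℤ) : Prop :=
  ∀ f : ∀ k, A.X k →ₗ[Rᵐᵒᵖ] Z.X k, (∀ k x, f k (A.d k x) = ε • Z.d k (f (k + 1) x)) →
    ∃ h : DegOne A Z, ∀ k x, f (k + 1) x = Z.d (k + 1) (h (k + 1) x) + ε • h k (A.d k x)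

/-- Maps from `A` to complexes that are exact above degree `a` are null-homotopic, for both signs. -/
def NullAbove (A : ModComplex R) (a : ℤ) : Prop :=
  ∀ Z : ModComplex R, Z.ExactAbove a → NullsInto A Z 1 ∧ NullsInto A Z (-1)

/-- A contraction of `A`. -/
def IsContraction (A : ModComplex R) (σ : DegOne A A) : Prop :=
  IsNullHomotopy (Hom.id A) σ

lemma IsContraction.nullsInto {A : ModComplex R} {σ : DegOne A A} (hσ : A.IsContraction σ)
    (Z : ModComplex R) {ε : ℤ} (hε : ε * ε = 1) : NullsInto A Z ε := by
  intro f hf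
  refine ⟨fun k => ε • (f (k + 1) ∘ₗ σ k), fun k x => ?_⟩
  have h1 := congrArg (f (k + 1)) (hσ k x)
  rw [map_add, hf] at h1
  simp only [Hom.id_f, LinearMap.id_coe, id_eq] at h1
  rw [h1]
  simp only [LinearMap.smul_apply, LinearMap.comp_apply, map_zsmul, smul_smul, hε, one_smul]

lemma IsContraction.exactAt {A : ModComplex R} {σ : DegOne A A} (hσ : A.IsContraction σ)
    (k : ℤ) : A.ExactAt k := fun x hx => ⟨σ (k + 1) x, by
  have := hσ k x
  rw [hx, map_zero, add_zero] at this
  exact this.symm⟩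

/-- The null-homotopies of maps that vanish on a split subcomplex can be chosen to vanish there. -/
lemma exists_nullHomotopy_rel {A B Z : ModComplex R} (i : Hom A B)
    (r : ∀ k, B.X k →ₗ[Rᵐᵒᵖ] A.X k) (hr : ∀ k x, r k (i.f k x) = x)
    (hB : NullsInto B Z 1) (hA : NullsInto A Z.shift (-1)) (e : Hom B Z)
    (he : ∀ k x, e.f k (i.f k x) = 0) :
    ∃ h : DegOne B Z, IsNullHomotopy e h ∧ ∀ k x, h k (i.f k x) = 0 := by
  obtain ⟨h₀, hh₀⟩ := hB e.f fun k x => by rw [one_smul, e.comm]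
  -- Since `e` vanishes on `A`, the restriction of `h₀` to `A` anticommutes with the differentials.
  -- This is what the sign `-1` in `NullsInto` is for.
  obtain ⟨l, hl⟩ : ∃ l : ∀ k, A.X k →ₗ[Rᵐᵒᵖ] Z.X (k + 1 + 1), ∀ k x, h₀ (k + 1) (i.f (k + 1) x) =
      Z.d (k + 1 + 1) (l (k + 1) x) + (-1 : ℤ) • l k (A.d k x) :=
      hA (fun k => h₀ k ∘ₗ i.f k) fun k x => by
    have h1 := hh₀ k (i.f (k + 1) x)
    rw [he, one_smul, ← i.comm] at h1
    rw [neg_smul, one_smul, eq_neg_iff_add_eq_zero, add_comm]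
    exact h1.symm
  -- Extend `l` by the retraction, which need not be a chain map, and subtract the boundary `d (l r)
  -- - (l r) d`: this does not change `d h + h d`.
  let h : DegOne B Z := ofSucc (P := fun k => B.X k →ₗ[Rᵐᵒᵖ] Z.X (k + 1)) fun k =>
    h₀ (k + 1) - (Z.d (k + 1 + 1) ∘ₗ l (k + 1) ∘ₗ r (k + 1) - l k ∘ₗ r k ∘ₗ B.d k)
  have hh : ∀ k x, h (k + 1) x =
      h₀ (k + 1) x - (Z.d (k + 1 + 1) (l (k + 1) (r (k + 1) x)) - l k (r k (B.d k x))) := by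
    intro k x
    rw [show h (k + 1) = _ from ofSucc_succ _ k]
    rfl
  refine ⟨h, fun k x => ?_, fun k x => ?_⟩
  · obtain ⟨k, rfl⟩ : ∃ j, k = j + 1 := ⟨k - 1, by ring⟩
    rw [hh, hh, map_sub, map_sub, Z.d_d, hh₀, one_smul, B.d_d, map_zero, map_zero]
    abel
  · obtain ⟨k, rfl⟩ : ∃ j, k = j + 1 := ⟨k - 1, by ring⟩
    rw [hh, hr, ← i.comm, hr]
    rw [hl, neg_smul, one_smul, ← sub_eq_add_neg]
    exact sub_self _

/-- The relative homotopy extension and lifting property. -/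
lemma exists_nullHomotopy_ext_lift {A B M N : ModComplex R} (i : Hom A B)
    (r : ∀ k, B.X k →ₗ[Rᵐᵒᵖ] A.X k) (hr : ∀ k x, r k (i.f k x) = x)
    (hproj : ∀ k, Module.Projective Rᵐᵒᵖ (B.X k)) (β : Hom M N)
    (hβ : ∀ k, Function.Surjective (β.f k))
    (hB : NullsInto B (ker β) 1) (hA : NullsInto A (ker β).shift (-1)) (f : Hom B M)
    (G : DegOne B N) (hG : IsNullHomotopy (β.comp f) G) (H : DegOne A M)
    (hH : IsNullHomotopy (f.comp i) H) (hGH : ∀ k x, β.f (k + 1) (H k x) = G k (i.f k x)) :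
    ∃ h : DegOne B M, IsNullHomotopy f h ∧ (∀ k x, h k (i.f k x) = H k x) ∧
      ∀ k x, β.f (k + 1) (h k x) = G k x := by
  have hL : ∀ k, ∃ L : B.X k →ₗ[Rᵐᵒᵖ] M.X (k + 1),
      β.f (k + 1) ∘ₗ L = G k - β.f (k + 1) ∘ₗ H k ∘ₗ r k := fun k =>
    Module.projective_lifting_property _ _ (hβ (k + 1))
  choose L hL using hL
  have hL' : ∀ k x, β.f (k + 1) (L k x) = G k x - β.f (k + 1) (H k (r k x)) := fun k x =>
    LinearMap.congr_fun (hL k) x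
  -- `h₀` has the right restriction to `A` and the right image under `β`, but need not be a
  -- null-homotopy of `f`.
  let h₀ : DegOne B M := fun k => H k ∘ₗ r k + L k - L k ∘ₗ i.f k ∘ₗ r k
  have hh₀ : ∀ k x, h₀ k x = H k (r k x) + L k x - L k (i.f k (r k x)) := fun k x => rfl
  have hβ₀ : ∀ k x, β.f (k + 1) (h₀ k x) = G k x := fun k x => by
    rw [hh₀, map_sub, map_add, hL', hL', hr, hGH]
    abel
  have hi₀ : ∀ k x, h₀ k (i.f k x) = H k x := fun k x => by
    rw [hh₀, hr]
    abel
  -- The defect `f - d h₀ - h₀ d` is a chain map with values in `ker β` that vanishes on `A`. A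
  -- null-homotopy of it inside `ker β`, zero on `A`, repairs `h₀` without spoiling the two
  -- prescriptions.
  let e₀ : ∀ k, B.X k →ₗ[Rᵐᵒᵖ] M.X k :=
    ofSucc (P := fun k => B.X k →ₗ[Rᵐᵒᵖ] M.X k) fun k =>
      f.f (k + 1) - M.d (k + 1) ∘ₗ h₀ (k + 1) - h₀ k ∘ₗ B.d k
  have he₀ : ∀ k x, e₀ (k + 1) x =
      f.f (k + 1) x - M.d (k + 1) (h₀ (k + 1) x) - h₀ k (B.d k x) := by
    intro k x
    rw [show e₀ (k + 1) = _ from ofSucc_succ _ k]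
    rfl
  have hker : ∀ k x, β.f k (e₀ k x) = 0 := by
    intro k x
    obtain ⟨k, rfl⟩ : ∃ j, k = j + 1 := ⟨k - 1, by ring⟩
    rw [he₀, map_sub, map_sub, hβ₀, β.comm, hβ₀, sub_sub, sub_eq_zero]
    exact hG k x
  let e : Hom B (ker β) :=
    { f := fun k => (e₀ k).codRestrict _ (hker k)
      comm := fun k x => Subtype.ext <| by
        change e₀ k (B.d k x) = M.d k (e₀ (k + 1) x)
        obtain ⟨k, rfl⟩ : ∃ j, k = j + 1 := ⟨k - 1, by ring⟩
        rw [he₀, he₀, B.d_d, map_zero, sub_zero, map_sub, map_sub, M.d_d, sub_zero, f.comm] }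
  obtain ⟨h₁, hh₁, hi₁⟩ := exists_nullHomotopy_rel i r hr hB hA e fun k x => Subtype.ext <| by
    change e₀ k (i.f k x) = 0
    obtain ⟨k, rfl⟩ : ∃ j, k = j + 1 := ⟨k - 1, by ring⟩
    rw [he₀, hi₀, ← i.comm, hi₀, sub_sub, sub_eq_zero]
    exact hH k x
  refine ⟨fun k => h₀ k + Submodule.subtype _ ∘ₗ h₁ k, fun k x => ?_, fun k x => ?_, fun k x => ?_⟩
  · have h2 : e₀ (k + 1) x = M.d (k + 1) (h₁ (k + 1) x).1 + (h₁ k (B.d k x)).1 :=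
      congrArg Subtype.val (hh₁ k x)
    rw [he₀] at h2
    change f.f (k + 1) x = M.d (k + 1) (h₀ (k + 1) x + (h₁ (k + 1) x).1) +
      (h₀ k (B.d k x) + (h₁ k (B.d k x)).1)
    rw [map_add, add_add_add_comm, ← h2]
    abel
  · change h₀ k (i.f k x) + (h₁ k (i.f k x)).1 = _
    rw [hi₀, hi₁]
    exact add_zero _
  · change β.f (k + 1) (h₀ k x + (h₁ k x).1) = _
    rw [map_add, hβ₀, show β.f (k + 1) (h₁ k x).1 = 0 from (h₁ k x).2, add_zero]

end ModComplex

end ModComplex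

/-! ## Products, subcomplexes and mapping fibres -/

namespace ModComplex

section Constructions

variable {R : Type u} [Ring R]

/-- The product of two complexes. -/
abbrev prod (A B : ModComplex R) : ModComplex R where
  X k := ModuleCat.of Rᵐᵒᵖ (A.X k × B.X k)
  d k := (A.d k).prodMap (B.d k)
  d_d k x := Prod.ext (A.d_d k x.1) (B.d_d k x.2)

/-- The subcomplex given by a family of submodules. -/
abbrev sub (A : ModComplex R) (P : ∀ k, Submodule Rᵐᵒᵖ (A.X k))
    (hP : ∀ k x, x ∈ P (k + 1) → A.d k x ∈ P k) : ModComplex R where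
  X k := ModuleCat.of Rᵐᵒᵖ (P k)
  d k := (A.d k).restrict (hP k)
  d_d k x := Subtype.ext (A.d_d k x.1)

/-- The restriction of a chain map to subcomplexes. -/
def Hom.restrict {A B : ModComplex R} (f : Hom A B) {P : ∀ k, Submodule Rᵐᵒᵖ (A.X k)}
    {hP : ∀ k x, x ∈ P (k + 1) → A.d k x ∈ P k} {Q : ∀ k, Submodule Rᵐᵒᵖ (B.X k)}
    {hQ : ∀ k x, x ∈ Q (k + 1) → B.d k x ∈ Q k} (hf : ∀ k x, x ∈ P k → f.f k x ∈ Q k) :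
    Hom (A.sub P hP) (B.sub Q hQ) where
  f k := (f.f k).restrict (hf k)
  comm k x := Subtype.ext (f.comm k x.1)

/-- The mapping fibre of a chain map. -/
abbrev fibre {A B : ModComplex R} (e : Hom A B) : ModComplex R where
  X k := ModuleCat.of Rᵐᵒᵖ (A.X k × B.X (k + 1))
  d k := (A.d k ∘ₗ LinearMap.fst _ _ _).prod
    (e.f (k + 1) ∘ₗ LinearMap.fst _ _ _ - B.d (k + 1) ∘ₗ LinearMap.snd _ _ _)
  d_d k x := by
    refine Prod.ext (A.d_d k x.1) ?_
    change e.f (k + 1) (A.d (k + 1) x.1) -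
      B.d (k + 1) (e.f (k + 1 + 1) x.1 - B.d (k + 1 + 1) x.2) = 0
    rw [map_sub, e.comm, B.d_d, sub_zero, sub_self]

/-- The map of mapping fibres induced by a commutative square. -/
def Hom.fibre {A B A' B' : ModComplex R} {e : Hom A B} {e' : Hom A' B'} (f : Hom A A')
    (g : Hom B B') (h : ∀ k x, e'.f k (f.f k x) = g.f k (e.f k x)) :
    Hom (fibre e) (fibre e') where
  f k := (f.f k).prodMap (g.f (k + 1))
  comm k x := by
    refine Prod.ext (f.comm k x.1) ?_
    change g.f (k + 1) (e.f (k + 1) x.1 - B.d (k + 1) x.2) =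
      e'.f (k + 1) (f.f (k + 1) x.1) - B'.d (k + 1) (g.f (k + 1 + 1) x.2)
    rw [map_sub, g.comm, h]

/-- The product of two chain maps. -/
def Hom.prodMap {A B A' B' : ModComplex R} (f : Hom A A') (g : Hom B B') :
    Hom (prod A B) (prod A' B') where
  f k := (f.f k).prodMap (g.f k)
  comm k x := Prod.ext (f.comm k x.1) (g.comm k x.2)

end Constructions

end ModComplex

/-! ## Sequences of complexes, indexed downwards -/

section Diagram

variable (R : Type u) [Ring R]

/-- A sequence `⋯ → X_2 → X_1 → X_0` of complexes. -/
structure TowerDiagram where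
  X : ℕ → ModComplex R
  lam : ∀ p, (X (p + 1)).Hom (X p)

variable {R}

namespace TowerDiagram

open ModComplex

/-- Morphisms of sequences. -/
structure Hom (V W : TowerDiagram R) where
  f : ∀ p, (V.X p).Hom (W.X p)
  comm : ∀ p k x, (f p).f k ((V.lam p).f k x) = (W.lam p).f k ((f (p + 1)).f k x)

/-- The identity. -/
def Hom.id (V : TowerDiagram R) : Hom V V := ⟨fun _ => .id _, fun _ _ _ => rfl⟩

/-- The composite `g ∘ f`. -/
def Hom.comp {U V W : TowerDiagram R} (g : Hom V W) (f : Hom U V) : Hom U W :=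
  ⟨fun p => (g.f p).comp (f.f p), fun p k x => by simp [f.comm, g.comm]⟩

/-- The composite `X_p → X_0`. -/
def toZero (V : TowerDiagram R) : ∀ p, (V.X p).Hom (V.X 0)
  | 0 => .id _
  | p + 1 => (toZero V p).comp (V.lam p)

lemma toZero_lam (V : TowerDiagram R) (p : ℕ) (k : ℤ) (x : (V.X (p + 1)).X k) :
    (V.toZero p).f k ((V.lam p).f k x) = (V.toZero (p + 1)).f k x := rfl

lemma Hom.toZero {V W : TowerDiagram R} (t : Hom V W) (p : ℕ) (k : ℤ) (x : (V.X p).X k) :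
    (W.toZero p).f k ((t.f p).f k x) = (t.f 0).f k ((V.toZero p).f k x) := by
  induction p with
  | zero => rfl
  | succ p ih => rw [← toZero_lam, ← toZero_lam, ← t.comm, ih]

/-- The fibres of the maps `X_p → X_0` for `p < n`, and zero for `n ≤ p`. -/
abbrev fibres (V : TowerDiagram R) (n : ℕ) : TowerDiagram R where
  X p := (fibre (V.toZero p)).sub
    -- An infimum over a proposition: `⊥` if `n ≤ p`, and `⊤` otherwise. It truncates without a case
    -- distinction between types.
    (fun k => ⨅ _ : n ≤ p, ⊥) fun k x hx => by
      simp only [Submodule.mem_iInf, Submodule.mem_bot] at hx ⊢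
      intro h
      rw [hx h, map_zero]
  lam p := (ModComplex.Hom.fibre (e := V.toZero (p + 1)) (e' := V.toZero p) (V.lam p) (.id _)
      fun k x => rfl).restrict fun k x hx => by
      simp only [Submodule.mem_iInf, Submodule.mem_bot] at hx ⊢
      intro h
      rw [hx (h.trans (Nat.le_succ p)), map_zero]

/-- The map between the sequences of fibres. -/
def Hom.fibres {V W : TowerDiagram R} (t : Hom V W) (n : ℕ) :
    Hom (V.fibres n) (W.fibres n) where
  f p := (ModComplex.Hom.fibre (t.f p) (t.f 0) (t.toZero p)).restrict fun k x hx => by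
      simp only [Submodule.mem_iInf, Submodule.mem_bot] at hx ⊢
      intro h
      rw [hx h, map_zero]
  comm p k x := Subtype.ext (Prod.ext (t.comm p k x.1.1) rfl)

variable (S : Type u) [AddCommGroup S] [Module R S] [Module Rᵐᵒᵖ S] [SMulCommClass R Rᵐᵒᵖ S]

/-- The sequence of the `X_{p+1} ⊗ S`. -/
abbrev next (V : TowerDiagram R) : TowerDiagram R where
  X p := (V.X (p + 1)).tensor S
  lam p := (V.lam (p + 1)).tensor S

/-- The maps `X_{p+1} ⊗ S → Y_{p+1} ⊗ S`. -/
def Hom.next {V W : TowerDiagram R} (t : Hom V W) : Hom (V.next S) (W.next S) where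
  f p := (t.f (p + 1)).tensor S
  comm p k x := tensorMap_comm (t.comm (p + 1) k) x

end TowerDiagram

end Diagram

/-! ### Sequences over a truncated `𝒟₀`-complex and the functor `step` -/

section RevComplex

variable (R S : Type u) [Ring R] [AddCommGroup S] [Module R S] [Module Rᵐᵒᵖ S]
  [SMulCommClass R Rᵐᵒᵖ S]

/-- The first `n + 1` terms of a `𝒟₀`-complex, in the reverse order: `X_p` stands for
`C_{n-p}`. -/
structure RevComplex (n : ℕ) extends TowerDiagram R where
  alp : ∀ p, (X p).Hom ((X (p + 1)).tensor S)
  comm : ∀ p, p + 1 < n → ∀ k x, (alp p).f k ((lam p).f k x) =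
    tensorMap R S ((lam (p + 1)).f k) ((alp (p + 1)).f k x)

variable {R S} {n : ℕ}

namespace RevComplex

open ModComplex TowerDiagram

/-- A sequence over `D`. -/
structure SeqOver (D : RevComplex R S n) where
  W : TowerDiagram R
  g : W.Hom D.toTowerDiagram

/-- The maps of sequences over `D`. -/
structure SeqOver.Hom {D : RevComplex R S n} (W W' : SeqOver D) where
  t : W.W.Hom W'.W
  compat : ∀ p k x, (W'.g.f p).f k ((t.f p).f k x) = (W.g.f p).f k x

variable (D : RevComplex R S n)

/-- The submodules `D_p ×_{D_{p+1} ⊗ S} (W_{p+1} ⊗ S)` for `p < n`. -/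
def pullSub (W : SeqOver D) (p : ℕ) (k : ℤ) :
    Submodule Rᵐᵒᵖ (((D.X p).prod ((W.W.X (p + 1)).tensor S)).X k) :=
  LinearMap.ker ((D.alp p).f k ∘ₗ LinearMap.fst _ _ _ -
    tensorMap R S ((W.g.f (p + 1)).f k) ∘ₗ LinearMap.snd _ _ _) ⊓
      -- For `n ≤ p` the component in `D_p` is forced to vanish. The relation `comm` is available
      -- only for `p + 1 < n`, and this makes `λ` well defined on the pullbacks beyond that range.
      ⨅ _ : n ≤ p, LinearMap.ker (LinearMap.fst _ _ _)

variable {D}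

lemma mem_pullSub {W : SeqOver D} {p : ℕ} {k : ℤ}
    {x : ((D.X p).prod ((W.W.X (p + 1)).tensor S)).X k} :
    x ∈ pullSub D W p k ↔
      (D.alp p).f k x.1 = tensorMap R S ((W.g.f (p + 1)).f k) x.2 ∧ (n ≤ p → x.1 = 0) := by
  simp [pullSub, sub_eq_zero]

/-- The sequence of the `D_p ×_{D_{p+1} ⊗ S} (W_{p+1} ⊗ S)`. -/
abbrev pull (W : SeqOver D) : TowerDiagram R where
  X p := ((D.X p).prod ((W.W.X (p + 1)).tensor S)).sub (pullSub D W p) fun k x hx => by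
    rw [mem_pullSub] at hx ⊢
    refine ⟨?_, fun h => ?_⟩
    · change (D.alp p).f k ((D.X p).d k x.1) =
        ((W.g.f (p + 1)).tensor S).f k (((W.W.X (p + 1)).tensor S).d k x.2)
      rw [ModComplex.Hom.comm, ModComplex.Hom.comm, hx.1]
      rfl
    · change (D.X p).d k x.1 = 0
      rw [hx.2 h, map_zero]
  lam p := (Hom.prodMap (D.lam p) ((W.W.lam (p + 1)).tensor S)).restrict fun k x hx => by
    rw [mem_pullSub] at hx ⊢
    have e : tensorMap R S ((W.g.f (p + 1)).f k) (tensorMap R S ((W.W.lam (p + 1)).f k) x.2) =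
        tensorMap R S ((D.lam (p + 1)).f k) (tensorMap R S ((W.g.f (p + 1 + 1)).f k) x.2) :=
      tensorMap_comm (W.g.comm (p + 1) k) x.2
    refine ⟨?_, fun h => ?_⟩
    · change (D.alp p).f k ((D.lam p).f k x.1) = tensorMap R S ((W.g.f (p + 1)).f k)
        (tensorMap R S ((W.W.lam (p + 1)).f k) x.2)
      rw [e, ← hx.1]
      by_cases h : p + 1 < n
      · exact D.comm p h k x.1
      · rw [hx.2 (not_lt.1 h), map_zero, map_zero, map_zero, map_zero]
    · change (D.lam p).f k x.1 = 0
      rw [hx.2 (h.trans (Nat.le_succ p)), map_zero]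

/-- The functor on sequences over `D` that takes `W` to the fibres of the maps
`V_p → V_0`, for `V_p = D_p ×_{D_{p+1} ⊗ S} (W_{p+1} ⊗ S)`. -/
abbrev step (W : SeqOver D) : SeqOver D where
  W := (pull W).fibres n
  g :=
    { f := fun p =>
        { f := fun k => LinearMap.fst _ _ _ ∘ₗ Submodule.subtype (pullSub D W p k) ∘ₗ
            LinearMap.fst Rᵐᵒᵖ (pullSub D W p k) (pullSub D W 0 (k + 1)) ∘ₗ Submodule.subtype _
          comm := fun _ _ => rfl }
      comm := fun _ _ _ => rfl }

/-- The functor `step`, on maps. -/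
def stepMap {W W' : SeqOver D} (t : W.Hom W') : (step W).Hom (step W') where
  t := Hom.fibres (V := pull W) (W := pull W')
    { f := fun p => (Hom.prodMap (.id _) ((t.t.f (p + 1)).tensor S)).restrict fun k x hx => by
        rw [mem_pullSub] at hx ⊢
        refine ⟨?_, hx.2⟩
        refine hx.1.trans ?_
        change _ = tensorMap R S _ (tensorMap R S _ x.2)
        rw [tensorMap_tensorMap]
        congr 2
        exact LinearMap.ext fun y => (t.compat (p + 1) k y).symm
      comm := fun p k x => Subtype.ext <| Prod.ext rfl (tensorMap_comm (t.t.comm (p + 1) k) x.1.2) }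
    n
  compat _ _ _ := rfl

/-- The projection of `step W` to the `W_{p+1} ⊗ S`. -/
def stepProj (W : SeqOver D) : (step W).W.Hom (W.W.next S) where
  f p :=
    { f := fun k => LinearMap.snd _ _ _ ∘ₗ Submodule.subtype (pullSub D W p k) ∘ₗ
        LinearMap.fst Rᵐᵒᵖ (pullSub D W p k) (pullSub D W 0 (k + 1)) ∘ₗ Submodule.subtype _
      comm := fun _ _ => rfl }
  comm _ _ _ := rfl

lemma alp_g_step (W : SeqOver D) (p : ℕ) (k : ℤ) (x : ((step W).W.X p).X k) :
    (D.alp p).f k (((step W).g.f p).f k x) =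
      tensorMap R S ((W.g.f (p + 1)).f k) (((stepProj W).f p).f k x) := (mem_pullSub.1 x.1.1.2).1

end RevComplex

end RevComplex

/-! ### Exactness of `step` -/

section RevComplexExact

variable {R S : Type u} [Ring R] [AddCommGroup S] [Module R S] [Module Rᵐᵒᵖ S]
  [SMulCommClass R Rᵐᵒᵖ S] {n : ℕ}

namespace RevComplex

open ModComplex TowerDiagram

/-- All the `α` are surjective. -/
def IsReduced (D : RevComplex R S n) : Prop :=
  ∀ p, p < n → ∀ k, Function.Surjective ((D.alp p).f k)

/-- The maps `Ker(α) → Ker(α)` induced by `λ` have acyclic cones. -/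
def KerConeExact (D : RevComplex R S n) : Prop :=
  ∀ p, p + 1 < n → ∀ k (x : (D.X (p + 1)).X (k + 1)) (z : (D.X p).X (k + 1 + 1)),
    (D.alp (p + 1)).f _ x = 0 → (D.alp p).f _ z = 0 → (D.X (p + 1)).d _ x = 0 →
    (D.lam p).f _ x = (D.X p).d _ z →
    ∃ (x' : (D.X (p + 1)).X (k + 1 + 1)) (z' : (D.X p).X (k + 1 + 1 + 1)),
      (D.alp (p + 1)).f _ x' = 0 ∧ (D.alp p).f _ z' = 0 ∧ (D.X (p + 1)).d _ x' = x ∧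
      (D.lam p).f _ x' - (D.X p).d _ z' = z

variable {D : RevComplex R S n}

lemma alp_toZero (p : ℕ) (hp : p < n) (k : ℤ) (c : (D.X p).X k) :
    (D.alp 0).f k ((D.toZero p).f k c) =
      ((D.toTowerDiagram.next S).toZero p).f k ((D.alp p).f k c) := by
  induction p with
  | zero => rfl
  | succ p ih =>
    rw [← toZero_lam, ← toZero_lam, ih (by omega), D.comm p hp]
    rfl

/-- Equivalences compose: the bounding chain for `D_p → D_0` found by induction feeds the cone
condition for `λ`, and the two solutions are pasted. -/
lemma KerConeExact.toZero (h : D.KerConeExact) (p : ℕ) (hp : p < n) (k : ℤ)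
    (x : (D.X p).X (k + 1)) (z : (D.X 0).X (k + 1 + 1)) (hx : (D.alp p).f _ x = 0)
    (hz : (D.alp 0).f _ z = 0) (hdx : (D.X p).d _ x = 0)
    (hxz : (D.toZero p).f _ x = (D.X 0).d _ z) :
    ∃ (x' : (D.X p).X (k + 1 + 1)) (z' : (D.X 0).X (k + 1 + 1 + 1)),
      (D.alp p).f _ x' = 0 ∧ (D.alp 0).f _ z' = 0 ∧ (D.X p).d _ x' = x ∧
      (D.toZero p).f _ x' - (D.X 0).d _ z' = z := by
  induction p with
  | zero => exact ⟨z, 0, hz, map_zero _, hxz.symm, by rw [map_zero, sub_zero]; rfl⟩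
  | succ p ih =>
    obtain ⟨x₁, z₁, hx₁, hz₁, hdx₁, h₁⟩ := ih (by omega) ((D.lam p).f _ x)
      (by rw [D.comm p hp, hx, map_zero]) (by rw [← ModComplex.Hom.comm, hdx, map_zero]) hxz
    obtain ⟨x', x₂, hx', hx₂, hdx', h₂⟩ := h p hp k x x₁ hx hx₁ hdx hdx₁.symm
    refine ⟨x', z₁ + (D.toZero p).f _ x₂, hx', ?_, hdx', ?_⟩
    · rw [map_add, hz₁, alp_toZero p (by omega), hx₂, map_zero, add_zero]
    · have e := congrArg ((D.toZero p).f _) h₂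
      rw [map_sub] at e
      rw [← toZero_lam, map_add, ← ModComplex.Hom.comm, ← h₁, ← e]
      abel

lemma pull_toZero_fst {W : SeqOver D} (p : ℕ) (k : ℤ) (v : ((pull W).X p).X k) :
    (((pull W).toZero p).f k v).1.1 = (D.toZero p).f k v.1.1 := by
  induction p with
  | zero => rfl
  | succ p ih => rw [← toZero_lam, ih, ← toZero_lam]; rfl

lemma pull_toZero_snd {W : SeqOver D} (p : ℕ) (k : ℤ) (v : ((pull W).X p).X k) :
    (((pull W).toZero p).f k v).1.2 = ((W.W.next S).toZero p).f k v.1.2 := by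
  induction p with
  | zero => rfl
  | succ p ih => rw [← toZero_lam, ih, ← toZero_lam]; rfl

/-- An element of `step W` from its components. -/
def stepMk {W : SeqOver D} {p : ℕ} {k : ℤ} (hp : p < n) (c : (D.X p).X k)
    (w : (tensorBimod R S).obj ((W.W.X (p + 1)).X k)) (c' : (D.X 0).X (k + 1))
    (w' : (tensorBimod R S).obj ((W.W.X 1).X (k + 1)))
    (h : (D.alp p).f k c = tensorMap R S ((W.g.f (p + 1)).f k) w)
    (h' : (D.alp 0).f (k + 1) c' = tensorMap R S ((W.g.f 1).f (k + 1)) w') :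
    ((step W).W.X p).X k :=
  ⟨(⟨(c, w), mem_pullSub.2 ⟨h, fun h => by omega⟩⟩,
    ⟨(c', w'), mem_pullSub.2 ⟨h', fun h => by omega⟩⟩), by
      rw [Submodule.mem_iInf]
      intro h
      omega⟩

lemma step_ext {W : SeqOver D} {p : ℕ} {k : ℤ} {x y : ((step W).W.X p).X k}
    (h₁ : x.1.1.1.1 = y.1.1.1.1) (h₂ : x.1.1.1.2 = y.1.1.1.2)
    (h₃ : x.1.2.1.1 = y.1.2.1.1) (h₄ : x.1.2.1.2 = y.1.2.1.2) : x = y :=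
  Subtype.ext (Prod.ext (Subtype.ext (Prod.ext h₁ h₂)) (Subtype.ext (Prod.ext h₃ h₄)))

lemma step_eq_zero {W : SeqOver D} {p : ℕ} {k : ℤ} (hp : n ≤ p) (x : ((step W).W.X p).X k) :
    x = 0 := by
  have := x.2
  rw [Submodule.mem_iInf] at this
  exact Subtype.ext (this hp)

/-- For `p < n`, surjectivity of `α` makes `step W` at `p` an extension of the fibre of `W_{p+1} ⊗ S
→ W_1 ⊗ S` by the fibre of `Ker(α) → Ker(α)` from `p` to `0`. The latter is acyclic by `hK`. The
former needs `W_1 ⊗ S` to be exact only one degree higher than `W_{p+1} ⊗ S`; this difference is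
what the tower exploits. -/
lemma step_exactAt (hD : D.IsReduced) (hK : D.KerConeExact) {W : SeqOver D} {p : ℕ} {k : ℤ}
    (hp : p < n) (h₁ : ((W.W.X (p + 1)).tensor S).ExactAt k)
    (h₂ : ((W.W.X 1).tensor S).ExactAt (k + 1)) : ((step W).W.X p).ExactAt k := by
  intro x hx
  obtain ⟨⟨⟨⟨⟨c, w⟩, hcw⟩, ⟨⟨c', w'⟩, hcw'⟩⟩, hx'⟩, rfl⟩ : ∃ y, y = x := ⟨x, rfl⟩
  replace hcw := (mem_pullSub.1 hcw).1
  replace hcw' := (mem_pullSub.1 hcw').1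
  dsimp only at hcw hcw'
  have hx₁ : (D.X p).d k c = 0 := congrArg (fun x => x.1.1.1.1) hx
  have hx₂ : ((W.W.X (p + 1)).tensor S).d k w = 0 := congrArg (fun x => x.1.1.1.2) hx
  have hx₃ : (D.toZero p).f _ c - (D.X 0).d _ c' = 0 := by
    have := congrArg (fun x => x.1.2.1.1) hx
    rw [← pull_toZero_fst (W := W) p (k + 1) ⟨(c, w), _⟩]
    exact this
  have hx₄ : ((W.W.next S).toZero p).f _ w - ((W.W.X 1).tensor S).d _ w' = 0 := by
    have := congrArg (fun x => x.1.2.1.2) hx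
    rw [← pull_toZero_snd (W := W) p (k + 1) ⟨(c, w), _⟩]
    exact this
  obtain ⟨u, hu⟩ := h₁ w hx₂
  obtain ⟨u', hu'⟩ := h₂ (((W.W.next S).toZero p).f _ u - w') (by
    rw [map_sub, sub_eq_zero, ← sub_eq_zero.1 hx₄, ← hu]
    exact (((W.W.next S).toZero p).comm _ u).symm)
  -- `(u, u')` bounds the part in the `W ⊗ S`. Surjectivity of `α` completes it to a chain of `step
  -- W` with components `b`, `b'` in `D`.
  obtain ⟨b, hb⟩ := hD p hp _ (tensorMap R S ((W.g.f (p + 1)).f _) u)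
  obtain ⟨b', hb'⟩ := hD 0 (by omega) _ (tensorMap R S ((W.g.f 1).f _) u')
  have hgu := ((W.g.f (p + 1)).tensor S).comm _ u
  have hgu' : ((D.X 1).tensor S).d _ (tensorMap R S ((W.g.f 1).f _) u') =
      tensorMap R S ((W.g.f 1).f _) (((W.W.next S).toZero p).f _ u) -
        tensorMap R S ((W.g.f 1).f _) w' := by
    rw [← map_sub, ← hu']
    exact (((W.g.f 1).tensor S).comm _ u').symm
  have hegu : ((D.toTowerDiagram.next S).toZero p).f _ (tensorMap R S ((W.g.f (p + 1)).f _) u) =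
      tensorMap R S ((W.g.f 1).f _) (((W.W.next S).toZero p).f _ u) :=
    (W.g.next S).toZero p _ u
  -- Subtracting the boundary of this chain leaves a cycle whose components lie in the kernels of
  -- `α`.
  obtain ⟨y, y', hy, hy', hdy, h₃⟩ := hK.toZero p hp k (c - (D.X p).d _ b)
    (c' - ((D.toZero p).f _ b - (D.X 0).d _ b'))
    (by
      rw [map_sub, ModComplex.Hom.comm, hb, hcw, ← hu, sub_eq_zero]
      exact hgu)
    (by
      rw [map_sub, map_sub, alp_toZero p hp, ModComplex.Hom.comm, hb, hb', hcw', hegu]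
      erw [hgu']
      rw [sub_sub_cancel]
      exact sub_self _)
    (by rw [map_sub, hx₁, (D.X p).d_d, sub_zero])
    (by
      rw [map_sub, map_sub, map_sub, (D.X 0).d_d, sub_zero, ← sub_eq_zero.1 hx₃,
        ModComplex.Hom.comm])
  refine ⟨stepMk hp (b + y) u (b' + y') u' ?_ ?_, step_ext ?_ hu ?_ ?_⟩
  · rw [map_add, hb, hy, add_zero]
  · rw [map_add, hb', hy', add_zero]
  · change (D.X p).d _ (b + y) = c
    rw [map_add, hdy, add_sub_cancel]
  · change (((pull W).toZero p).f _ _).1.1 - (D.X 0).d _ (b' + y') = c'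
    rw [pull_toZero_fst]
    change (D.toZero p).f _ (b + y) - (D.X 0).d _ (b' + y') = c'
    rw [map_add, map_add, add_sub_add_comm, h₃, add_sub_cancel]
  · change (((pull W).toZero p).f _ _).1.2 - ((W.W.X 1).tensor S).d _ u' = w'
    rw [pull_toZero_snd, hu']
    exact sub_sub_cancel _ _

end RevComplex

end RevComplexExact

/-! ### The tower of the iterates of `step` under a morphism -/

section RevComplexTower

variable {R S : Type u} [Ring R] [AddCommGroup S] [Module R S] [Module Rᵐᵒᵖ S]
  [SMulCommClass R Rᵐᵒᵖ S] {n : ℕ}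

/-- The lift of a map of sequences to the sequence of fibres, given by a contraction. -/
def TowerDiagram.Hom.toFibres {V W : TowerDiagram R} (t : V.Hom W)
    {σ : ModComplex.DegOne (V.X 0) (V.X 0)} (hσ : (V.X 0).IsContraction σ)
    (hV : ∀ p, n ≤ p → ∀ k (x : (V.X p).X k), x = 0) : V.Hom (W.fibres n) where
  f p :=
    { f := fun k => (((t.f p).f k).prod ((t.f 0).f (k + 1) ∘ₗ σ k ∘ₗ (V.toZero p).f k)).codRestrict
        (⨅ _ : n ≤ p, ⊥) fun x => by
          rw [Submodule.mem_iInf]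
          intro h
          rw [hV p h k x, map_zero]
          exact Submodule.zero_mem _
      comm := fun k x => by
        refine Subtype.ext (Prod.ext ((t.f p).comm k x) ?_)
        change (t.f 0).f (k + 1) (σ k ((V.toZero p).f k ((V.X p).d k x))) =
          (W.toZero p).f (k + 1) ((t.f p).f (k + 1) x) -
            (W.X 0).d (k + 1) ((t.f 0).f _ (σ (k + 1) ((V.toZero p).f (k + 1) x)))
        have h := hσ k ((V.toZero p).f (k + 1) x)
        rw [(V.toZero p).comm, t.toZero, ← (t.f 0).comm, ← map_sub]
        exact congrArg _ (eq_sub_of_add_eq' h.symm) }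
  comm p k x := Subtype.ext (Prod.ext (t.comm p k x) rfl)

namespace RevComplex

open ModComplex TowerDiagram

/-- A morphism `Y → D`, with a contraction of `Y_0`, where `Y_p = 0` for `n ≤ p`. -/
structure ContractedHom (Y D : RevComplex R S n) where
  φ : Y.toTowerDiagram.Hom D.toTowerDiagram
  alp_φ : ∀ p k x, (D.alp p).f k ((φ.f p).f k x) =
    tensorMap R S ((φ.f (p + 1)).f k) ((Y.alp p).f k x)
  eq_zero : ∀ p, n ≤ p → ∀ k (x : (Y.X p).X k), x = 0
  σ : DegOne (Y.X 0) (Y.X 0)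
  isContraction : (Y.X 0).IsContraction σ

namespace ContractedHom

variable {Y D : RevComplex R S n} (c : ContractedHom Y D)

/-- The source of a morphism as a sequence over its target. -/
abbrev base : SeqOver D := ⟨Y.toTowerDiagram, c.φ⟩

/-- The map from `Y` to the sequence of the `D_p ×_{D_{p+1} ⊗ S} (Y_{p+1} ⊗ S)`. -/
def toPull : Y.toTowerDiagram.Hom (pull c.base) where
  f p :=
    { f := fun k => (((c.φ.f p).f k).prod ((Y.alp p).f k)).codRestrict (pullSub D c.base p k)
        fun x => mem_pullSub.2 ⟨c.alp_φ p k x, fun h => by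
          change (c.φ.f p).f k x = 0
          rw [c.eq_zero p h k x, map_zero]⟩
      comm := fun k x =>
        Subtype.ext (Prod.ext ((c.φ.f p).comm k x) ((Y.alp p).comm k x)) }
  comm p k x := by
    refine Subtype.ext (Prod.ext (c.φ.comm p k x) ?_)
    change (Y.alp p).f k ((Y.lam p).f k x) =
      tensorMap R S ((Y.lam (p + 1)).f k) ((Y.alp (p + 1)).f k x)
    by_cases hp : p + 1 < n
    · exact Y.comm p hp k x
    · rw [c.eq_zero (p + 1) (not_lt.1 hp) _ x]
      simp only [map_zero]

/-- The structure map `Y → step Y`. -/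
def coaction : c.base.Hom (step c.base) where
  t := c.toPull.toFibres c.isContraction c.eq_zero
  compat _ _ _ := rfl

/-- The iterates `W_j` of `step`. -/
def iter : ℕ → SeqOver D
  | 0 => c.base
  | j + 1 => step (iter j)

/-- The maps `W_j → W_{j+1}`. -/
def trans : ∀ j, (c.iter j).Hom (c.iter (j + 1))
  | 0 => c.coaction
  | j + 1 => stepMap (trans j)

/-- The maps `Y → W_j`. -/
def toIter : ∀ j, Y.toTowerDiagram.Hom (c.iter j).W
  | 0 => .id _
  | j + 1 => (c.trans j).t.comp (toIter j)

/-- The maps `W_{j+1} → W_j ⊗ S`. -/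
def proj (j : ℕ) : (c.iter (j + 1)).W.Hom ((c.iter j).W.next S) := stepProj (c.iter j)

/-- The composites `W_{j,p+1} → W_{j,p} → W_{j+1,p}`. -/
def diag (j p : ℕ) : ((c.iter j).W.X (p + 1)).Hom ((c.iter (j + 1)).W.X p) :=
  ((c.trans j).t.f p).comp ((c.iter j).W.lam p)

lemma g_toIter (j p : ℕ) (k : ℤ) (x : (Y.X p).X k) :
    ((c.iter j).g.f p).f k (((c.toIter j).f p).f k x) = (c.φ.f p).f k x := by
  induction j with
  | zero => rfl
  | succ j ih => exact ((c.trans j).compat p k _).trans ih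

lemma proj_trans (j p : ℕ) (k : ℤ) (x : ((c.iter (j + 1)).W.X p).X k) :
    ((c.proj (j + 1)).f p).f k (((c.trans (j + 1)).t.f p).f k x) =
      tensorMap R S (((c.trans j).t.f (p + 1)).f k) (((c.proj j).f p).f k x) := rfl

lemma proj_toIter (j p : ℕ) (k : ℤ) (x : (Y.X p).X k) :
    ((c.proj j).f p).f k (((c.toIter (j + 1)).f p).f k x) =
      tensorMap R S (((c.toIter j).f (p + 1)).f k) ((Y.alp p).f k x) := by
  induction j with
  | zero =>
    change (Y.alp p).f k x = tensorMap R S (M := (Y.X (p + 1)).X k) LinearMap.id ((Y.alp p).f k x)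
    rw [tensorMap_id]
    rfl
  | succ j ih =>
    change ((c.proj (j + 1)).f p).f k (((c.trans (j + 1)).t.f p).f k
      (((c.toIter (j + 1)).f p).f k x)) = tensorMap R S (((c.trans j).t.f (p + 1)).f k ∘ₗ
        ((c.toIter j).f (p + 1)).f k) ((Y.alp p).f k x)
    rw [proj_trans, ih, tensorMap_tensorMap]

/-- On a diagonal, where `j + p` is constant, `diag` and `proj` play the roles of `λ` and `α`; this
is the relation `α λ = (λ ⊗ 1) α` there. -/
lemma proj_diag (j p : ℕ) (k : ℤ) (x : ((c.iter (j + 1)).W.X (p + 1)).X k) :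
    ((c.proj (j + 1)).f p).f k ((c.diag (j + 1) p).f k x) =
      tensorMap R S ((c.diag j (p + 1)).f k) (((c.proj j).f (p + 1)).f k x) := by
  change ((c.proj (j + 1)).f p).f k (((c.trans (j + 1)).t.f p).f k
    (((c.iter (j + 1)).W.lam p).f k x)) = tensorMap R S (((c.trans j).t.f (p + 1)).f k ∘ₗ
        ((c.iter j).W.lam (p + 1)).f k) (((c.proj j).f (p + 1)).f k x)
  rw [proj_trans, (c.proj j).comm, tensorMap_comp]
  rfl

lemma diag_toIter (j p : ℕ) (k : ℤ) (x : (Y.X (p + 1)).X k) :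
    (c.diag j p).f k (((c.toIter j).f (p + 1)).f k x) =
      ((c.toIter (j + 1)).f p).f k ((Y.lam p).f k x) := by
  change ((c.trans j).t.f p).f k (((c.iter j).W.lam p).f k (((c.toIter j).f (p + 1)).f k x)) =
    ((c.trans j).t.f p).f k (((c.toIter j).f p).f k ((Y.lam p).f k x))
  rw [(c.toIter j).comm]

lemma g_diag (j p : ℕ) (k : ℤ) (x : ((c.iter j).W.X (p + 1)).X k) :
    ((c.iter (j + 1)).g.f p).f k ((c.diag j p).f k x) =
      (D.lam p).f k (((c.iter j).g.f (p + 1)).f k x) := by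
  change ((c.iter (j + 1)).g.f p).f k (((c.trans j).t.f p).f k (((c.iter j).W.lam p).f k x)) = _
  rw [(c.trans j).compat, (c.iter j).g.comm]

lemma alp_g (j p : ℕ) (k : ℤ) (x : ((c.iter (j + 1)).W.X p).X k) :
    (D.alp p).f k (((c.iter (j + 1)).g.f p).f k x) =
      tensorMap R S (((c.iter j).g.f (p + 1)).f k) (((c.proj j).f p).f k x) :=
  alp_g_step _ _ _ _

lemma iter_eq_zero (j p : ℕ) (hp : n ≤ p) (k : ℤ) (x : ((c.iter j).W.X p).X k) : x = 0 := by
  cases j with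
  | zero => exact c.eq_zero p hp k x
  | succ j => exact step_eq_zero hp x

lemma proj_surjective (hD : D.IsReduced) (j p : ℕ) (hp : p < n) (k : ℤ) :
    Function.Surjective (((c.proj j).f p).f k) := by
  intro w
  obtain ⟨b, hb⟩ := hD p hp k (tensorMap R S (((c.iter j).g.f (p + 1)).f k) w)
  exact ⟨stepMk hp b w 0 0 hb (by rw [map_zero, map_zero]), rfl⟩

/-- The terms with `n ≤ p` are zero, hence exact everywhere. Each further step carries the improved
bound from `p + 1` to `p`, while the term at `1`, used one degree higher, needs only the old bound.
After `m` steps the improvement has reached `n - m`. -/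
lemma iter_exactAbove_step (hS : IsLeftFlat R S) (hD : D.IsReduced) (hK : D.KerConeExact)
    {a : ℤ} {j : ℕ} (h : ∀ p, ((c.iter j).W.X p).ExactAbove a) (m p : ℕ) :
    ((c.iter (j + m)).W.X p).ExactAbove a ∧
      (n ≤ p + m → ((c.iter (j + m)).W.X p).ExactAbove (a - 1)) := by
  have hz : ∀ j p, n ≤ p → ∀ k, ((c.iter j).W.X p).ExactAt k := fun j p hp k x _ =>
    ⟨0, by rw [map_zero, c.iter_eq_zero j p hp _ x]⟩
  induction m generalizing p with
  | zero => exact ⟨h p, fun hp k _ => hz j p hp k⟩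
  | succ m ih =>
    by_cases hp : p < n
    · refine ⟨fun k hk => ?_, fun hpm k hk => ?_⟩
      · exact step_exactAt hD hK hp (((ih (p + 1)).1 k hk).tensor hS)
          (((ih 1).1 (k + 1) (by omega)).tensor hS)
      · exact step_exactAt hD hK hp (((ih (p + 1)).2 (by omega) k hk).tensor hS)
          (((ih 1).1 (k + 1) (by omega)).tensor hS)
    · exact ⟨fun k _ => hz _ p (not_lt.1 hp) k, fun _ k _ => hz _ p (not_lt.1 hp) k⟩

/-- Every `n` steps improve the bound by one at all `p`, and further steps do not lose it. -/
lemma exists_iter_exactAbove (hS : IsLeftFlat R S) (hD : D.IsReduced) (hK : D.KerConeExact)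
    {b : ℤ} (h : ∀ p, (Y.X p).ExactAbove b) (a : ℤ) :
    ∃ N, ∀ j, N ≤ j → ∀ p, ((c.iter j).W.X p).ExactAbove a := by
  have key : ∀ r : ℕ, ∃ N, ∀ p, ((c.iter N).W.X p).ExactAbove (b - r) := by
    intro r
    induction r with
    | zero => exact ⟨0, fun p => by rw [Nat.cast_zero, sub_zero]; exact h p⟩
    | succ r ih =>
      obtain ⟨N, hN⟩ := ih
      refine ⟨N + n, fun p => ?_⟩
      have := (c.iter_exactAbove_step hS hD hK hN n p).2 (by omega)
      push_cast
      rwa [← sub_sub]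
  obtain ⟨N, hN⟩ := key (b - a).toNat
  refine ⟨N, fun j hj p => ?_⟩
  obtain ⟨m, rfl⟩ := Nat.exists_eq_add_of_le hj
  exact ((c.iter_exactAbove_step hS hD hK hN m p).1).mono (by omega)

end ContractedHom

end RevComplex

end RevComplexTower

/-! ### Compatible null-homotopies on the reversed sequences -/

section NullHomotopyFamily

variable {R S : Type u} [Ring R] [AddCommGroup S] [Module R S] [Module Rᵐᵒᵖ S]
  [SMulCommClass R Rᵐᵒᵖ S] {n : ℕ}

open ModComplex

lemma ModComplex.ker_exactAt {A B : ModComplex R} {f : Hom A B} {k : ℤ}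
    (hf : Function.Surjective (f.f (k + 1 + 1 + 1)))
    (hA : A.ExactAt k) (hB : B.ExactAt (k + 1)) : (ker f).ExactAt k := by
  intro x hx
  obtain ⟨y, hy⟩ := hA x.1 (congrArg Subtype.val hx)
  obtain ⟨z, hz⟩ := hB (f.f _ y) (by rw [← f.comm, hy]; exact x.2)
  obtain ⟨w, rfl⟩ := hf z
  refine ⟨⟨y - A.d _ w, ?_⟩, Subtype.ext ?_⟩
  · rw [LinearMap.mem_ker, map_sub, f.comm, hz, sub_self]
  · change A.d _ (y - A.d _ w) = x.1
    rw [map_sub, A.d_d, sub_zero, hy]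

lemma ModComplex.ker_exactAbove {A B : ModComplex R} {f : Hom A B} {a : ℤ}
    (hf : ∀ k, Function.Surjective (f.f k))
    (hA : A.ExactAbove a) (hB : B.ExactAbove a) : (ker f).ExactAbove a := fun k hk =>
  ker_exactAt (hf _) (hA k hk) (hB (k + 1) (by omega))

lemma ModComplex.tensorMap_isNullHomotopy {A B : ModComplex R} {f : Hom A B} {h : DegOne A B}
    (hh : IsNullHomotopy f h) (k : ℤ) (y : (tensorBimod R S).obj (A.X (k + 1))) :
    tensorMap R S (f.f (k + 1)) y = tensorMap R S (B.d (k + 1)) (tensorMap R S (h (k + 1)) y) +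
      tensorMap R S (h k) (tensorMap R S (A.d k) y) := by
  rw [tensorMap_tensorMap, tensorMap_tensorMap, ← LinearMap.add_apply, ← tensorMap_add]
  congr 2
  exact LinearMap.ext fun x => hh k x

namespace RevComplex

namespace ContractedHom

variable {Y D : RevComplex R S n} (c : ContractedHom Y D)

/-- The homotopies `h_p` are compatible with the maps `λ` and `α` at the index `p`. -/
def CompatAt (H : ∀ q, DegOne (Y.X q) (D.X q)) (p : ℕ) : Prop :=
  (∀ k x, H p k ((Y.lam p).f k x) = (D.lam p).f (k + 1) (H (p + 1) k x)) ∧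
    ∀ k x, (D.alp p).f (k + 1) (H p k x) = tensorMap R S (H (p + 1) k) ((Y.alp p).f k x)

/-- The homotopy at `p` is prescribed on `Y_{p+1} ⊆ Y_p` by `λ` and modulo `ker (proj)` by `α`. Both
stages of the tower being exact above `a`, so is `ker (proj)`, and the relative lifting problem has
no obstruction. Passing from `p + 1` to `p` costs one stage of the tower. -/
lemma exists_homotopy_succ (hS : IsLeftFlat R S) (hD : D.IsReduced) {a : ℤ} {j p : ℕ}
    (hp : p < n) (hN : ((c.iter (j + 1)).W.X (p + 1)).ExactAbove a)
    (hN' : ((c.iter (j + 1 + 1)).W.X p).ExactAbove a)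
    (hproj : ∀ k, Module.Projective Rᵐᵒᵖ ((Y.X p).X k))
    (r : ∀ k, (Y.X p).X k →ₗ[Rᵐᵒᵖ] (Y.X (p + 1)).X k)
    (hr : ∀ k x, r k ((Y.lam p).f k x) = x) (hnull : ∀ p, (Y.X p).NullAbove a)
    (h : DegOne (Y.X (p + 1)) ((c.iter (j + 1)).W.X (p + 1)))
    (h' : DegOne (Y.X (p + 1 + 1)) ((c.iter j).W.X (p + 1 + 1)))
    (hh : IsNullHomotopy ((c.toIter (j + 1)).f (p + 1)) h)
    (hlam : ∀ k x, h k ((Y.lam (p + 1)).f k x) = (c.diag j (p + 1)).f (k + 1) (h' k x))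
    (hpr : ∀ k x, ((c.proj j).f (p + 1)).f (k + 1) (h k x) =
      tensorMap R S (h' k) ((Y.alp (p + 1)).f k x)) :
    ∃ h₁ : DegOne (Y.X p) ((c.iter (j + 1 + 1)).W.X p),
      IsNullHomotopy ((c.toIter (j + 1 + 1)).f p) h₁ ∧
      (∀ k x, h₁ k ((Y.lam p).f k x) = (c.diag (j + 1) p).f (k + 1) (h k x)) ∧
      (∀ k x, ((c.proj (j + 1)).f p).f (k + 1) (h₁ k x) =
        tensorMap R S (h k) ((Y.alp p).f k x)) := by
  have hsurj := fun k => c.proj_surjective hD (j + 1) p hp k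
  have hker : (ker ((c.proj (j + 1)).f p)).ExactAbove a :=
    ker_exactAbove hsurj hN' fun k hk => (hN k hk).tensor hS
  refine exists_nullHomotopy_ext_lift (Y.lam p) r hr hproj ((c.proj (j + 1)).f p) hsurj
    (hnull p _ hker).1 (hnull (p + 1) _ fun k hk => hker (k + 1) (by omega)).2
    ((c.toIter (j + 1 + 1)).f p) (fun k => tensorMap R S (h k) ∘ₗ (Y.alp p).f k) ?_
    (fun k => (c.diag (j + 1) p).f (k + 1) ∘ₗ h k) ?_ ?_
  · intro k x
    change ((c.proj (j + 1)).f p).f (k + 1) (((c.toIter (j + 1 + 1)).f p).f (k + 1) x) =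
      tensorMap R S (((c.iter (j + 1)).W.X (p + 1)).d (k + 1))
        (tensorMap R S (h (k + 1)) ((Y.alp p).f (k + 1) x)) +
      tensorMap R S (h k) ((Y.alp p).f k ((Y.X p).d k x))
    rw [proj_toIter, tensorMap_isNullHomotopy hh, (Y.alp p).comm]
  · intro k x
    change ((c.toIter (j + 1 + 1)).f p).f (k + 1) ((Y.lam p).f (k + 1) x) =
      ((c.iter (j + 1 + 1)).W.X p).d (k + 1) ((c.diag (j + 1) p).f _ (h (k + 1) x)) +
        (c.diag (j + 1) p).f _ (h k ((Y.X (p + 1)).d k x))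
    rw [← diag_toIter, hh k x, map_add, (c.diag (j + 1) p).comm]
  · intro k x
    change ((c.proj (j + 1)).f p).f (k + 1) ((c.diag (j + 1) p).f (k + 1) (h k x)) =
      tensorMap R S (h k) ((Y.alp p).f k ((Y.lam p).f k x))
    rw [proj_diag, hpr]
    -- The two prescriptions agree on `Y_{p+1}` by the relation between `λ` and `α`; beyond the
    -- range of that relation, `Y_{p+1}` is zero.
    by_cases hp' : p + 1 < n
    · rw [Y.comm p hp']
      exact (tensorMap_comm (fun x => hlam k x) _).symm
    · rw [c.eq_zero (p + 1) (not_lt.1 hp') _ x]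
      simp only [map_zero]

/-- Induction from `p = n`, where `Y` vanishes, down to `p = 0`. The pair `h'`, `h` records the last
two homotopies into the tower, which the next step needs; `H` collects their images in `D`, whose
compatibility no longer refers to the stage. -/
lemma exists_homotopy_stage (hS : IsLeftFlat R S) (hD : D.IsReduced) {a : ℤ} {N : ℕ}
    (hN : ∀ j, N ≤ j → ∀ p, ((c.iter j).W.X p).ExactAbove a)
    (hproj : ∀ p k, Module.Projective Rᵐᵒᵖ ((Y.X p).X k))
    (r : ∀ p k, (Y.X p).X k →ₗ[Rᵐᵒᵖ] (Y.X (p + 1)).X k)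
    (hr : ∀ p k x, r p k ((Y.lam p).f k x) = x) (hnull : ∀ p, (Y.X p).NullAbove a)
    (i : ℕ) : ∀ j, N + i = j → ∀ p, p + i = n → ∃ (h : DegOne (Y.X p) ((c.iter (j + 1)).W.X p))
      (h' : DegOne (Y.X (p + 1)) ((c.iter j).W.X (p + 1)))
      (H : ∀ q, DegOne (Y.X q) (D.X q)),
      IsNullHomotopy ((c.toIter (j + 1)).f p) h ∧
      (∀ k x, h k ((Y.lam p).f k x) = (c.diag j p).f (k + 1) (h' k x)) ∧
      (∀ k x, ((c.proj j).f p).f (k + 1) (h k x) =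
        tensorMap R S (h' k) ((Y.alp p).f k x)) ∧
      (∀ k x, H p k x = ((c.iter (j + 1)).g.f p).f (k + 1) (h k x)) ∧
      (∀ q, p ≤ q → IsNullHomotopy (c.φ.f q) (H q)) ∧ ∀ q, p ≤ q → CompatAt H q := by
  induction i with
  | zero =>
    intro j _ p hp
    have h0 : ∀ q, p ≤ q → ∀ k (x : (Y.X q).X k), x = 0 := fun q hq => c.eq_zero q (by omega)
    refine ⟨fun _ => 0, fun _ => 0, fun _ _ => 0, fun k x => ?_, fun k x => ?_, fun k x => ?_,
      fun k x => ?_, fun q hq k x => ?_, fun q hq => ⟨fun k x => ?_, fun k x => ?_⟩⟩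
    · simp [h0 p le_rfl _ x]
    · simp
    · rw [h0 p le_rfl _ x]
      simp only [map_zero]
    · simp
    · simp [h0 q hq _ x]
    · simp
    · rw [h0 q hq _ x]
      simp only [map_zero]
  | succ i ih =>
    intro j hj p hp
    obtain ⟨j, rfl⟩ : ∃ i, j = i + 1 := ⟨N + i, hj.symm⟩
    obtain ⟨h, h', H, hh, hlam, hproj', hg, hH, hcomp⟩ := ih j (by omega) (p + 1) (by omega)
    have hp' : p < n := by omega
    obtain ⟨h₁, hnull₁, hlam₁, hproj₁⟩ := c.exists_homotopy_succ hS hD hp' (hN _ (by omega) _)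
      (hN _ (by omega) _) (hproj p) (r p) (hr p) hnull h h' hh hlam hproj'
    -- The value of `H` at `p` is the new homotopy pushed forward to `D`; the values at `q > p` are
    -- kept.
    refine ⟨h₁, h, Function.update H p fun k => ((c.iter (j + 1 + 1)).g.f p).f (k + 1) ∘ₗ h₁ k,
      hnull₁, hlam₁, hproj₁, ?_, ?_, ?_⟩
    · intro k x
      rw [Function.update_self]
      rfl
    · intro q hq
      rcases hq.eq_or_lt with rfl | hq
      · rw [Function.update_self]
        intro k x
        rw [← c.g_toIter (j + 1 + 1) p, hnull₁ k x, map_add, ModComplex.Hom.comm]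
        rfl
      · rw [Function.update_of_ne hq.ne']
        exact hH q hq
    · intro q hq
      rcases hq.eq_or_lt with rfl | hq
      · unfold CompatAt
        rw [Function.update_self, Function.update_of_ne (by omega)]
        refine ⟨fun k x => ?_, fun k x => ?_⟩
        · change ((c.iter (j + 1 + 1)).g.f p).f (k + 1) (h₁ k ((Y.lam p).f k x)) = _
          rw [hlam₁, g_diag, hg]
        · change (D.alp p).f (k + 1) (((c.iter (j + 1 + 1)).g.f p).f (k + 1) (h₁ k x)) = _
          rw [alp_g, hproj₁, tensorMap_tensorMap]
          congr 2
          exact LinearMap.ext fun y => (hg k y).symm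
      · unfold CompatAt
        rw [Function.update_of_ne (by omega), Function.update_of_ne (by omega)]
        exact hcomp q hq

/-- A morphism from a contractible sequence to a reduced one with equivalent kernels is
null-homotopic. -/
theorem exists_homotopy (hS : IsLeftFlat R S) (hD : D.IsReduced) (hK : D.KerConeExact) {a b : ℤ}
    (hb : ∀ p, (Y.X p).ExactAbove b)
    (hproj : ∀ p k, Module.Projective Rᵐᵒᵖ ((Y.X p).X k))
    (r : ∀ p k, (Y.X p).X k →ₗ[Rᵐᵒᵖ] (Y.X (p + 1)).X k)
    (hr : ∀ p k x, r p k ((Y.lam p).f k x) = x) (hnull : ∀ p, (Y.X p).NullAbove a) :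
    ∃ H : ∀ q, DegOne (Y.X q) (D.X q), ∀ q, IsNullHomotopy (c.φ.f q) (H q) ∧ CompatAt H q := by
  obtain ⟨N, hN⟩ := c.exists_iter_exactAbove hS hD hK hb a
  obtain ⟨-, -, H, -, -, -, -, hH, hcomp⟩ :=
    c.exists_homotopy_stage hS hD hN hproj r hr hnull n _ rfl 0 (zero_add n)
  exact ⟨H, fun q => ⟨hH q (Nat.zero_le q), hcomp q (Nat.zero_le q)⟩⟩

end ContractedHom

end RevComplex

end NullHomotopyFamily

/-! ## Comparison with the chain complexes of Mathlib -/

namespace ModComplex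

section Comparison

variable {R : Type u} [Ring R]

/-- The consecutive differentials of a chain complex. -/
abbrev toMod (X : ChainComplex (ModuleCat.{u} Rᵐᵒᵖ) ℤ) : ModComplex R where
  X := X.X
  d k := (X.d (k + 1) k).hom
  d_d k x := by
    have h := X.d_comp_d (k + 1 + 1) (k + 1) k
    exact LinearMap.congr_fun (congrArg ModuleCat.Hom.hom h) x

/-- The linear maps underlying a chain map. -/
abbrev toModHom {X Y : ChainComplex (ModuleCat.{u} Rᵐᵒᵖ) ℤ} (f : X ⟶ Y) :
    Hom (toMod X) (toMod Y) where
  f k := (f.f k).hom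
  comm k x := (LinearMap.congr_fun (congrArg ModuleCat.Hom.hom (f.comm (k + 1) k)) x).symm

/-- The chain map with given underlying linear maps. -/
def homMk {X Y : ChainComplex (ModuleCat.{u} Rᵐᵒᵖ) ℤ} (f : Hom (toMod X) (toMod Y)) :
    X ⟶ Y where
  f k := ModuleCat.ofHom (f.f k)
  comm' i j h := by
    obtain rfl : j + 1 = i := h
    ext x
    exact (f.comm j x).symm

/-- The chain complex with given consecutive differentials. -/
abbrev ofMod (M : ModComplex R) : ChainComplex (ModuleCat.{u} Rᵐᵒᵖ) ℤ :=
  ChainComplex.of M.X (fun k => ModuleCat.ofHom (M.d k)) fun k => by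
    ext x
    exact M.d_d k x

lemma toMod_ofMod_d (M : ModComplex R) (k : ℤ) : (toMod (ofMod M)).d k = M.d k :=
  congrArg ModuleCat.Hom.hom (ChainComplex.of_d M.X (fun k => ModuleCat.ofHom (M.d k)) k)

lemma exactAt_iff_toMod_exactAt (X : ChainComplex (ModuleCat.{u} Rᵐᵒᵖ) ℤ) (k : ℤ) :
    X.ExactAt (k + 1) ↔ (toMod X).ExactAt k := by
  rw [X.exactAt_iff' (k + 1 + 1) (k + 1) k (by simp) (by simp), ShortComplex.moduleCat_exact_iff]
  rfl

lemma acyclic_iff_toMod_exactAt (X : ChainComplex (ModuleCat.{u} Rᵐᵒᵖ) ℤ) :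
    X.Acyclic ↔ ∀ k, (toMod X).ExactAt k := by
  refine ⟨fun h k => (exactAt_iff_toMod_exactAt X k).1 (h _), fun h k => ?_⟩
  obtain ⟨k, rfl⟩ : ∃ j, k = j + 1 := ⟨k - 1, by ring⟩
  exact (exactAt_iff_toMod_exactAt X k).2 (h k)

/-- Elementwise solvability gives a lift after an epimorphism, the form used in the criteria up to
refinements: `A'` is the pullback of `f` and `g`. -/
lemma exists_epi_lift {A B N : ModuleCat.{u} Rᵐᵒᵖ} (f : A ⟶ N) (g : B ⟶ N)
    (h : ∀ a, ∃ b, g.hom b = f.hom a) :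
    ∃ (A' : ModuleCat.{u} Rᵐᵒᵖ) (π : A' ⟶ A) (_ : Epi π) (w : A' ⟶ B), π ≫ f = w ≫ g := by
  let P : Submodule Rᵐᵒᵖ (A × B) :=
    LinearMap.eqLocus (f.hom ∘ₗ LinearMap.fst _ _ _) (g.hom ∘ₗ LinearMap.snd _ _ _)
  refine ⟨.of Rᵐᵒᵖ P, ModuleCat.ofHom (LinearMap.fst _ _ _ ∘ₗ P.subtype), ?_,
    ModuleCat.ofHom (LinearMap.snd _ _ _ ∘ₗ P.subtype), ?_⟩
  · rw [ModuleCat.epi_iff_surjective]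
    intro a
    obtain ⟨b, hb⟩ := h a
    exact ⟨⟨(a, b), hb.symm⟩, rfl⟩
  · ext x
    exact x.2

/-- The criterion up to refinements, tested in one direction on maps out of `Rᵐᵒᵖ`, that is, on
elements. -/
lemma mono_homologyMap_iff {X Y : ChainComplex (ModuleCat.{u} Rᵐᵒᵖ) ℤ} (f : X ⟶ Y) (k : ℤ) :
    Mono (HomologicalComplex.homologyMap f (k + 1)) ↔
      ∀ (x : (toMod X).X (k + 1)) (z : (toMod Y).X (k + 1 + 1)), (toMod X).d k x = 0 →
        (toModHom f).f (k + 1) x = (toMod Y).d (k + 1) z → ∃ x', (toMod X).d (k + 1) x' = x := by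
  rw [HomologicalComplex.mono_homologyMap_iff_up_to_refinements f (k + 1 + 1) (k + 1) k
    (by simp) (by simp)]
  constructor
  · intro h x z hx hz
    obtain ⟨A, π, hπ, x₁, hx₁⟩ := h (ModuleCat.ofHom (LinearMap.toSpanSingleton Rᵐᵒᵖ (X.X _) x))
      (by ext; simpa using hx)
      (ModuleCat.ofHom (LinearMap.toSpanSingleton Rᵐᵒᵖ (Y.X _) z)) (by ext; simpa using hz)
    obtain ⟨a, ha⟩ := (ModuleCat.epi_iff_surjective π).1 hπ 1
    refine ⟨x₁ a, ?_⟩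
    have := LinearMap.congr_fun (congrArg ModuleCat.Hom.hom hx₁) a
    simp only [ModuleCat.hom_comp, LinearMap.comp_apply, ModuleCat.hom_ofHom,
      LinearMap.toSpanSingleton_apply] at this
    rw [ha, one_smul] at this
    exact this.symm
  · intro h A x₂ hx₂ y₁ hy
    exact exists_epi_lift _ _ fun a => h (x₂.hom a) (y₁.hom a)
      (LinearMap.congr_fun (congrArg ModuleCat.Hom.hom hx₂) a)
      (LinearMap.congr_fun (congrArg ModuleCat.Hom.hom hy) a)

lemma epi_homologyMap_iff {X Y : ChainComplex (ModuleCat.{u} Rᵐᵒᵖ) ℤ} (f : X ⟶ Y) (k : ℤ) :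
    Epi (HomologicalComplex.homologyMap f (k + 1)) ↔
      ∀ (z : (toMod Y).X (k + 1)), (toMod Y).d k z = 0 → ∃ x z', (toMod X).d k x = 0 ∧
        (toModHom f).f (k + 1) x + (toMod Y).d (k + 1) z' = z := by
  rw [HomologicalComplex.epi_homologyMap_iff_up_to_refinements f (k + 1 + 1) (k + 1) k
    (by simp) (by simp)]
  constructor
  · intro h z hz
    obtain ⟨A, π, hπ, x₂, hx₂, y₁, hy⟩ := h
      (ModuleCat.ofHom (LinearMap.toSpanSingleton Rᵐᵒᵖ (Y.X _) z)) (by ext; simpa using hz)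
    obtain ⟨a, ha⟩ := (ModuleCat.epi_iff_surjective π).1 hπ 1
    refine ⟨x₂ a, y₁ a, LinearMap.congr_fun (congrArg ModuleCat.Hom.hom hx₂) a, ?_⟩
    have := LinearMap.congr_fun (congrArg ModuleCat.Hom.hom hy) a
    simp only [ModuleCat.hom_comp, LinearMap.comp_apply, ModuleCat.hom_ofHom,
      LinearMap.toSpanSingleton_apply] at this
    rw [ha, one_smul] at this
    exact this.symm
  · intro h A y₂ hy₂
    obtain ⟨A', π, hπ, w, hw⟩ := exists_epi_lift y₂ (ModuleCat.ofHom (((f.f (k + 1)).hom ∘ₗ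
      (LinearMap.ker (X.d (k + 1) k).hom).subtype).coprod (Y.d (k + 1 + 1) (k + 1)).hom))
      fun a => by
        obtain ⟨x, z', hx, hz'⟩ := h (y₂.hom a)
          (LinearMap.congr_fun (congrArg ModuleCat.Hom.hom hy₂) a)
        exact ⟨(⟨x, hx⟩, z'), hz'⟩
    refine ⟨A', π, hπ, ModuleCat.ofHom (Submodule.subtype _ ∘ₗ LinearMap.fst _ _ _ ∘ₗ w.hom), ?_,
      ModuleCat.ofHom (LinearMap.snd _ _ _ ∘ₗ w.hom), ?_⟩
    · ext a
      exact (w.hom a).1.2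
    · rw [hw]
      ext a
      rfl

/-- The cone condition at `k` combines injectivity on homology in degree `k + 1` with surjectivity
in degree `k + 2`; the latter is the case `x = 0`. -/
lemma quasiIso_iff_coneExact {X Y : ChainComplex (ModuleCat.{u} Rᵐᵒᵖ) ℤ} (f : X ⟶ Y) :
    QuasiIso f ↔ ConeExact (toModHom f) := by
  have h1 : QuasiIso f ↔ ∀ k, Mono (HomologicalComplex.homologyMap f (k + 1)) ∧
      Epi (HomologicalComplex.homologyMap f (k + 1)) := by
    rw [quasiIso_iff]
    constructor
    · intro h k
      have := (quasiIsoAt_iff_isIso_homologyMap f (k + 1)).1 (h _)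
      exact ⟨inferInstance, inferInstance⟩
    · intro h k
      obtain ⟨k, rfl⟩ : ∃ j, k = j + 1 := ⟨k - 1, by ring⟩
      obtain ⟨h1, h2⟩ := h k
      rw [quasiIsoAt_iff_isIso_homologyMap]
      exact isIso_of_mono_of_epi _
  rw [h1]
  simp_rw [mono_homologyMap_iff, epi_homologyMap_iff]
  constructor
  · intro h k x z hx hz
    obtain ⟨x₀, rfl⟩ := (h k).1 x z hx hz
    obtain ⟨x₁, z', hx₁, hz'⟩ := (h (k + 1)).2 (z - (toModHom f).f _ x₀) (by
      rw [map_sub, ← hz, (toModHom f).comm, sub_self])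
    refine ⟨x₀ + x₁, -z', by rw [map_add, hx₁, add_zero], ?_⟩
    rw [map_add, map_neg, sub_neg_eq_add, add_assoc ((toModHom f).f _ _)]
    exact add_eq_of_eq_sub' hz'
  · intro h k
    refine ⟨fun x z hx hz => ?_, fun z hz => ?_⟩
    · obtain ⟨x', -, h1, -⟩ := h k x z hx hz
      exact ⟨x', h1⟩
    · obtain ⟨k, rfl⟩ : ∃ j, k = j + 1 := ⟨k - 1, by ring⟩
      obtain ⟨x', z', h1, h2⟩ := h k 0 z (map_zero _) (by rw [map_zero, hz])
      exact ⟨x', -z', h1, by rw [map_neg, ← sub_eq_add_neg, h2]⟩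

lemma homotopy_apply {X Y : ChainComplex (ModuleCat.{u} Rᵐᵒᵖ) ℤ} {f g : X ⟶ Y}
    (H : Homotopy f g) (k : ℤ) (x : X.X (k + 1)) :
    (toModHom f).f (k + 1) x = (toMod Y).d (k + 1) ((H.hom (k + 1) (k + 1 + 1)).hom x) +
      (H.hom k (k + 1)).hom ((toMod X).d k x) + (toModHom g).f (k + 1) x := by
  have h := H.comm (k + 1)
  rw [dNext_eq H.hom (show (ComplexShape.down ℤ).Rel (k + 1) k from rfl),
    prevD_eq H.hom (show (ComplexShape.down ℤ).Rel (k + 1 + 1) (k + 1) from rfl)] at h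
  have h1 := LinearMap.congr_fun (congrArg ModuleCat.Hom.hom h) x
  rw [add_comm ((toMod Y).d (k + 1) _)]
  exact h1

lemma homotopy_of_isNullHomotopy {X Y : ChainComplex (ModuleCat.{u} Rᵐᵒᵖ) ℤ} (f : X ⟶ Y)
    (h : DegOne (toMod X) (toMod Y)) (hf : IsNullHomotopy (toModHom f) h) :
    Nonempty (Homotopy f 0) := by
  let h' : ∀ i j, (ComplexShape.down ℤ).Rel j i → (X.X i ⟶ Y.X j) := fun i j hij =>
    ModuleCat.ofHom (h i) ≫ eqToHom (by rw [show i + 1 = j from hij])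
  have : f = Homotopy.nullHomotopicMap' h' := by
    ext k x
    obtain ⟨k, rfl⟩ : ∃ j, k = j + 1 := ⟨k - 1, by ring⟩
    rw [Homotopy.nullHomotopicMap'_f (show (ComplexShape.down ℤ).Rel (k + 1 + 1) (k + 1) from rfl)
      (show (ComplexShape.down ℤ).Rel (k + 1) k from rfl),
      add_comm (X.d (k + 1) k ≫ _)]
    simp only [h', eqToHom_refl, Category.comp_id]
    exact hf k x
  rw [this]
  exact ⟨Homotopy.nullHomotopy' h'⟩

/-- Bounded above and below. -/
def IsBounded (A : ModComplex R) : Prop :=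
  ∃ a b : ℤ, ∀ k, k ≤ a ∨ b < k → ∀ x : A.X k, x = 0

/-- Finitely many generators, each with finite support, involve only a finite set `N` of degrees,
and the submodule of the elements supported on `N` contains them all. -/
lemma isBounded_of_finite (A : ModComplex R) [Module.Finite Rᵐᵒᵖ (⨁ k : ℤ, A.X k)] :
    A.IsBounded := by
  classical
  obtain ⟨s, hs⟩ := (Module.finite_def (R := Rᵐᵒᵖ) (M := ⨁ k : ℤ, A.X k)).1 inferInstance
  let N : Finset ℤ := s.biUnion fun x => DFinsupp.support x
  obtain ⟨b, hb⟩ := N.bddAbove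
  obtain ⟨a, ha⟩ := N.bddBelow
  let P : Submodule Rᵐᵒᵖ (⨁ k : ℤ, A.X k) :=
    ⨅ (k : ℤ) (_ : k ∉ N), LinearMap.ker (DirectSum.component Rᵐᵒᵖ ℤ (fun k => A.X k) k)
  have hP : P = ⊤ := by
    rw [← top_le_iff, ← hs, Submodule.span_le]
    intro x hx
    simp only [P, SetLike.mem_coe, Submodule.mem_iInf, LinearMap.mem_ker]
    intro k hk
    by_contra h
    exact hk (Finset.mem_biUnion.2 ⟨x, hx, DFinsupp.mem_support_iff.2 h⟩)
  refine ⟨a - 1, b, fun k hk x => ?_⟩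
  have hkN : k ∉ N := fun h => by
    have := hb h
    have := ha h
    omega
  have h : DirectSum.lof Rᵐᵒᵖ ℤ (fun k => A.X k) k x ∈ P := hP ▸ Submodule.mem_top
  simp only [P, Submodule.mem_iInf, LinearMap.mem_ker] at h
  have := h k hkN
  rwa [DirectSum.component.lof_self] at this

/-- The comparison argument for projective resolutions: below `a` the source is zero, and above `a`
projectivity lifts through the exact target, one degree at a time. -/
lemma nullsInto_of_projective (A Z : ModComplex R) (a : ℤ)
    (hproj : ∀ k, Module.Projective Rᵐᵒᵖ (A.X k)) (ha : ∀ k ≤ a, ∀ x : A.X k, x = 0)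
    (hZ : Z.ExactAbove a) {ε : ℤ} (hε : ε * ε = 1) : NullsInto A Z ε := by
  intro f hf
  have hf' : ∀ k x, Z.d k (f (k + 1) x) = ε • f k (A.d k x) := fun k x => by
    rw [hf, smul_smul, hε, one_smul]
  -- The identity `d h d = f d` carried in the subtype says that the next map to be lifted, `f - ε h
  -- d`, takes values in cycles.
  have hstep : ∀ k, a ≤ k → ∀ h : {h : A.X k →ₗ[Rᵐᵒᵖ] Z.X (k + 1) //
      a ≤ k → ∀ x, Z.d k (h (A.d k x)) = f k (A.d k x)},
      ∃ h' : {h : A.X (k + 1) →ₗ[Rᵐᵒᵖ] Z.X (k + 1 + 1) //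
        a ≤ k + 1 → ∀ x, Z.d (k + 1) (h (A.d (k + 1) x)) = f (k + 1) (A.d (k + 1) x)},
      ∀ x, f (k + 1) x = Z.d (k + 1) (h'.1 x) + ε • h.1 (A.d k x) := by
    intro k hk h
    have hex : ∀ y : LinearMap.ker (Z.d k), ∃ z, (Z.d (k + 1)) z = y.1 := fun y => hZ k hk y.1 y.2
    obtain ⟨g, hg⟩ := Module.projective_lifting_property
      ((Z.d (k + 1)).codRestrict (LinearMap.ker (Z.d k)) (Z.d_d k))
      ((f (k + 1) - ε • h.1 ∘ₗ A.d k).codRestrict (LinearMap.ker (Z.d k)) fun x => by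
        change Z.d k (f (k + 1) x - ε • h.1 (A.d k x)) = 0
        rw [map_sub, map_zsmul, h.2 hk, hf', sub_self])
      fun y => (hex y).imp fun z hz => Subtype.ext hz
    have hg' : ∀ x, Z.d (k + 1) (g x) = f (k + 1) x - ε • h.1 (A.d k x) := fun x =>
      congrArg Subtype.val (LinearMap.congr_fun hg x)
    exact ⟨⟨g, fun _ x => by rw [hg', A.d_d, map_zero, smul_zero, sub_zero]⟩, fun x => by
      rw [hg', sub_add_cancel]⟩
  choose step hstep using hstep
  -- Zero is a correct value at `a`, where `A` vanishes, and an irrelevant one below `a`.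
  let H : ∀ k, {h : A.X k →ₗ[Rᵐᵒᵖ] Z.X (k + 1) //
      a ≤ k → ∀ x, Z.d k (h (A.d k x)) = f k (A.d k x)} := fun k =>
    Int.inductionOn' k a
      ⟨0, fun _ x => by rw [ha a le_rfl (A.d a x), map_zero, map_zero, map_zero]⟩ step
      fun k hk _ => ⟨0, fun h => absurd h (by omega)⟩
  refine ⟨fun k => (H k).1, fun k x => ?_⟩
  by_cases hk : a ≤ k
  · dsimp only
    rw [show H (k + 1) = step k hk (H k) from Int.inductionOn'_add_one hk]
    exact hstep k hk (H k) x
  · rw [ha (k + 1) (by omega) x]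
    simp only [map_zero, smul_zero, add_zero]

/-- `X` is a homotopy retract of `F`. -/
structure HomotopyRetract (X F : ModComplex R) where
  i : Hom F X
  r : Hom X F
  s : DegOne X X
  eq : ∀ k x, x = X.d (k + 1) (s (k + 1) x) + s k (X.d k x) + i.f (k + 1) (r.f (k + 1) x)

/-- Write `x` as `d s x + s d x + i r x`: the homotopy on `F` treats the last term, and `ε f s` the
first two. -/
lemma HomotopyRetract.nullsInto {X F : ModComplex R} (c : HomotopyRetract X F) {Z : ModComplex R}
    {ε : ℤ} (hε : ε * ε = 1) (hF : NullsInto F Z ε) : NullsInto X Z ε := by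
  intro f hf
  obtain ⟨h, hh⟩ := hF (fun k => f k ∘ₗ c.i.f k) fun k x => by
    rw [LinearMap.comp_apply, c.i.comm, hf]
    rfl
  refine ⟨fun k => h k ∘ₗ c.r.f k + ε • f (k + 1) ∘ₗ c.s k, fun k x => ?_⟩
  have h1 := congrArg (f (k + 1)) (c.eq k x)
  have h2 := hh k (c.r.f (k + 1) x)
  rw [map_add, map_add, hf] at h1
  rw [h1]
  change _ + f (k + 1) (c.i.f (k + 1) (c.r.f (k + 1) x)) = _
  rw [show f (k + 1) (c.i.f (k + 1) (c.r.f (k + 1) x)) = _ from h2]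
  simp only [LinearMap.add_apply, LinearMap.smul_apply, LinearMap.comp_apply, map_add, map_zsmul,
    smul_add, smul_smul, hε, one_smul, c.r.comm]
  abel

lemma HomotopyRetract.exactAt {X F : ModComplex R} (c : HomotopyRetract X F) {k : ℤ}
    (hF : F.ExactAt k) : X.ExactAt k := by
  intro x hx
  obtain ⟨y, hy⟩ := hF (c.r.f (k + 1) x) (by rw [← c.r.comm, hx, map_zero])
  refine ⟨c.s (k + 1) x + c.i.f (k + 1 + 1) y, ?_⟩
  conv_rhs => rw [c.eq k x]
  rw [map_add, hx, map_zero, add_zero, ← hy, c.i.comm]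

lemma nonempty_homotopyRetract {X F : ChainComplex (ModuleCat.{u} Rᵐᵒᵖ) ℤ}
    (e : HomotopyEquiv F X) : Nonempty (HomotopyRetract (toMod X) (toMod F)) :=
  ⟨⟨toModHom e.hom, toModHom e.inv, fun k => (e.homotopyInvHomId.symm.hom k (k + 1)).hom,
    fun k x => homotopy_apply e.homotopyInvHomId.symm k x⟩⟩

/-- `a` is a degree at and below which a finite model vanishes; smaller bounds serve as well, which
allows a common one for several complexes. -/
lemma exists_nullAbove_of_isHFinite {X : ChainComplex (ModuleCat.{u} Rᵐᵒᵖ) ℤ} (hX : IsHFinite X) :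
    ∃ a, ∀ a' ≤ a, (toMod X).NullAbove a' := by
  obtain ⟨F, ⟨hproj, hfin⟩, ⟨e⟩⟩ := hX
  obtain ⟨c⟩ := nonempty_homotopyRetract e
  obtain ⟨a, b, h⟩ := isBounded_of_finite (toMod F)
  have h0 : ∀ a' ≤ a, ∀ k ≤ a', ∀ x : (toMod F).X k, x = 0 := fun a' ha k hk =>
    h k (Or.inl (hk.trans ha))
  exact ⟨a, fun a' ha Z hZ =>
    ⟨c.nullsInto rfl (nullsInto_of_projective (toMod F) Z a' hproj (h0 a' ha) hZ rfl),
      c.nullsInto rfl (nullsInto_of_projective (toMod F) Z a' hproj (h0 a' ha) hZ rfl)⟩⟩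

lemma exists_exactAbove_of_isHFinite {X : ChainComplex (ModuleCat.{u} Rᵐᵒᵖ) ℤ}
    (hX : IsHFinite X) : ∃ b, (toMod X).ExactAbove b := by
  obtain ⟨F, ⟨hproj, hfin⟩, ⟨e⟩⟩ := hX
  obtain ⟨c⟩ := nonempty_homotopyRetract e
  obtain ⟨a, b, h⟩ := isBounded_of_finite (toMod F)
  exact ⟨b, fun k hk => c.exactAt fun x _ => ⟨0, by
    rw [map_zero, h (k + 1) (Or.inr (by omega)) x]⟩⟩

lemma exists_isContraction {X : ChainComplex (ModuleCat.{u} Rᵐᵒᵖ) ℤ}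
    (hX : IsContractibleComplex X) : ∃ σ, (toMod X).IsContraction σ := by
  obtain ⟨H⟩ := hX
  refine ⟨fun k => (H.hom k (k + 1)).hom, fun k x => ?_⟩
  have h := homotopy_apply H k x
  exact h.trans (add_zero _)

lemma exists_retraction_of_isCofib {X Y : ChainComplex (ModuleCat.{u} Rᵐᵒᵖ) ℤ} {f : X ⟶ Y}
    (hf : IsCofib f) (k : ℤ) :
    ∃ r : (toMod Y).X k →ₗ[Rᵐᵒᵖ] (toMod X).X k, ∀ x, r ((toModHom f).f k x) = x := by
  obtain ⟨hinj, hproj⟩ := hf k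
  obtain ⟨s, hs⟩ := Module.projective_lifting_property
    (LinearMap.range (f.f k).hom).mkQ LinearMap.id (Submodule.mkQ_surjective _)
  have hmem : ∀ y, (LinearMap.id - s ∘ₗ (LinearMap.range (f.f k).hom).mkQ : Y.X k →ₗ[Rᵐᵒᵖ] Y.X k) y
      ∈ LinearMap.range (f.f k).hom := fun y => by
    refine (Submodule.Quotient.mk_eq_zero _).1 ?_
    change (LinearMap.range (f.f k).hom).mkQ _ = 0
    have := LinearMap.congr_fun hs ((LinearMap.range (f.f k).hom).mkQ y)
    simp only [LinearMap.comp_apply, LinearMap.id_apply] at this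
    rw [LinearMap.sub_apply, map_sub, LinearMap.comp_apply, this]
    exact sub_self _
  refine ⟨(LinearEquiv.ofInjective (f.f k).hom hinj).symm.toLinearMap ∘ₗ
    (LinearMap.codRestrict _ _ hmem), fun x => ?_⟩
  change (LinearEquiv.ofInjective (f.f k).hom hinj).symm _ = x
  rw [LinearEquiv.symm_apply_eq]
  apply Subtype.ext
  change (f.f k).hom x - s ((LinearMap.range (f.f k).hom).mkQ ((f.f k).hom x)) = (f.f k).hom x
  rw [show (LinearMap.range (f.f k).hom).mkQ ((f.f k).hom x) = 0 from
    (Submodule.Quotient.mk_eq_zero _).2 (LinearMap.mem_range_self _ _), map_zero, sub_zero]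

end Comparison

end ModComplex

/-! ## `𝒟₀`-complexes with explicit differentials -/

section Explicit

open ModComplex

variable {R : Type u} [Ring R]

namespace ModComplex

lemma toMod_ofMod (M : ModComplex R) : toMod (ofMod M) = M := by
  obtain ⟨X, d, h⟩ := M
  unfold toMod
  congr 1
  funext k
  exact toMod_ofMod_d ⟨X, d, h⟩ k

/-- A chain map to a complex given by its consecutive differentials. -/
abbrev toOfMod {X : ChainComplex (ModuleCat.{u} Rᵐᵒᵖ) ℤ} {N : ModComplex R}
    (f : Hom (toMod X) N) : X ⟶ ofMod N :=
  homMk ⟨f.f, fun k x => by rw [toMod_ofMod_d]; exact f.comm k x⟩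

/-- A chain map from a complex given by its consecutive differentials. -/
abbrev fromOfMod {X : ChainComplex (ModuleCat.{u} Rᵐᵒᵖ) ℤ} {N : ModComplex R}
    (f : Hom N (toMod X)) : ofMod N ⟶ X :=
  homMk ⟨f.f, fun k x => by rw [toMod_ofMod_d]; exact f.comm k x⟩

/-- A chain map between complexes given by their consecutive differentials. -/
abbrev ofModMap {M N : ModComplex R} (f : Hom M N) : ofMod M ⟶ ofMod N :=
  homMk ⟨f.f, fun k x => by rw [toMod_ofMod_d, toMod_ofMod_d]; exact f.comm k x⟩

lemma acyclic_ofMod {M : ModComplex R} (h : ∀ k, M.ExactAt k) : (ofMod M).Acyclic := by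
  rw [acyclic_iff_toMod_exactAt, toMod_ofMod]
  exact h

end ModComplex

variable {S : Type u} [AddCommGroup S] [Module R S] [Module Rᵐᵒᵖ S] [SMulCommClass R Rᵐᵒᵖ S]

namespace DZeroComplex

/-- The map `λ_i` with its underlying linear maps. -/
abbrev lamHom (C : DZeroComplex R S) (i : ℕ) : (toMod (C.X i)).Hom (toMod (C.X (i + 1))) :=
  toModHom (C.lam i)

/-- The map `α_{i+1}` with its underlying linear maps. -/
abbrev alpHom (C : DZeroComplex R S) (i : ℕ) :
    (toMod (C.X (i + 1))).Hom ((toMod (C.X i)).tensor S) where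
  f k := ((C.alp i).f k).hom
  comm k x := (toModHom (C.alp i)).comm k x

lemma alpHom_lamHom (C : DZeroComplex R S) (i : ℕ) (k : ℤ) (x : (C.X (i + 1)).X k) :
    (C.alpHom (i + 1)).f k ((C.lamHom (i + 1)).f k x) =
      tensorMap R S ((C.lamHom i).f k) ((C.alpHom i).f k x) :=
  LinearMap.congr_fun (congrArg (fun f => (f.f k).hom) (C.comm i)) x

lemma Hom.lamHom_apply {Y C : DZeroComplex R S} (φ : Y ⟶ C) (i : ℕ) (k : ℤ) (x : (Y.X i).X k) :
    (toModHom (φ.f (i + 1))).f k ((Y.lamHom i).f k x) =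
      (C.lamHom i).f k ((toModHom (φ.f i)).f k x) :=
  LinearMap.congr_fun (congrArg (fun f => (f.f k).hom) (φ.comm_lam i)) x

lemma Hom.alpHom_apply {Y C : DZeroComplex R S} (φ : Y ⟶ C) (i : ℕ) (k : ℤ)
    (x : (Y.X (i + 1)).X k) :
    (C.alpHom i).f k ((toModHom (φ.f (i + 1))).f k x) =
      tensorMap R S ((toModHom (φ.f i)).f k) ((Y.alpHom i).f k x) :=
  (LinearMap.congr_fun (congrArg (fun f => (f.f k).hom) (φ.comm_alp i)) x).symm

/-- The `𝒟₀`-complex with given consecutive differentials. -/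
def ofModData (X : ℕ → ModComplex R)
    (hproj : ∀ i k, Module.Projective Rᵐᵒᵖ ((X i).X k))
    (lam : ∀ i, (X i).Hom (X (i + 1))) (alp : ∀ i, (X (i + 1)).Hom ((X i).tensor S))
    (comm : ∀ i k x, (alp (i + 1)).f k ((lam (i + 1)).f k x) =
      tensorMap R S ((lam i).f k) ((alp i).f k x)) : DZeroComplex R S where
  X i := ofMod (X i)
  projective := hproj
  lam i := ofModMap (lam i)
  alp i := homMk ⟨(alp i).f, fun k x => by
    rw [toMod_ofMod_d]
    refine ((alp i).comm k x).trans ?_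
    change _ = tensorMap R S ((toMod (ofMod (X i))).d k) _
    rw [toMod_ofMod_d]
    rfl⟩
  comm i := by
    ext k x
    exact comm i k x

end DZeroComplex

/-! ## The path `𝒟₀`-complex -/

namespace ModComplex

lemma fibre_id_exactAt (A : ModComplex R) (k : ℤ) : (fibre (Hom.id A)).ExactAt k := by
  rintro ⟨x, z⟩ hxz
  have h : x - A.d (k + 1) z = 0 := congrArg Prod.snd hxz
  refine ⟨(z, 0), Prod.ext (sub_eq_zero.1 h).symm ?_⟩
  change z - A.d (k + 1 + 1) 0 = z
  rw [map_zero, sub_zero]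

/-- The inclusion of the first summand of a mapping fibre. -/
abbrev fibreInl {A B : ModComplex R} (e : Hom A B) (k : ℤ) : A.X k →ₗ[Rᵐᵒᵖ] (fibre e).X k :=
  LinearMap.inl _ _ _

/-- The inclusion of the second summand of a mapping fibre. -/
abbrev fibreInr {A B : ModComplex R} (e : Hom A B) (k : ℤ) : B.X (k + 1) →ₗ[Rᵐᵒᵖ] (fibre e).X k :=
  LinearMap.inr _ _ _

/-- A chain map `A → B ⊗ S` induces one of path complexes. -/
def pathTensor {A B : ModComplex R} (f : Hom A (B.tensor S)) :
    Hom (fibre (.id A)) ((fibre (.id B)).tensor S) where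
  -- The tensor product of a product is not literally a product, so the two components enter through
  -- the tensored inclusions.
  f k := (tensorMap R S (fibreInl (.id B) k) ∘ₗ f.f k).coprod
    (tensorMap R S (fibreInr (.id B) k) ∘ₗ f.f (k + 1))
  comm k x := by
    obtain ⟨x, z⟩ := x
    change tensorMap R S (fibreInl (.id B) k) (f.f k (A.d k x)) +
      tensorMap R S (fibreInr (.id B) k) (f.f (k + 1) (x - A.d (k + 1) z)) =
      tensorMap R S ((fibre (.id B)).d k)
        (tensorMap R S (fibreInl (.id B) (k + 1)) (f.f (k + 1) x) +
          tensorMap R S (fibreInr (.id B) (k + 1)) (f.f (k + 1 + 1) z))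
    have h1 : (fibre (.id B)).d k ∘ₗ fibreInl (.id B) (k + 1) =
        fibreInl (.id B) k ∘ₗ B.d k + fibreInr (.id B) k :=
      LinearMap.ext fun y => Prod.ext (by simp) (by simp)
    have h2 : (fibre (.id B)).d k ∘ₗ fibreInr (.id B) (k + 1) =
        -(fibreInr (.id B) k ∘ₗ B.d (k + 1)) :=
      LinearMap.ext fun y => Prod.ext (by simp) (by simp)
    rw [map_add, tensorMap_tensorMap, tensorMap_tensorMap, h1, h2, tensorMap_add, tensorMap_neg,
      tensorMap_comp, tensorMap_comp, map_sub, map_sub, f.comm, f.comm]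
    simp only [LinearMap.add_apply, LinearMap.neg_apply, LinearMap.comp_apply]
    abel

end ModComplex

namespace DZeroComplex

/-- The contractible `𝒟₀`-complex of the pairs of a chain and a homotopy to zero. -/
def path (C : DZeroComplex R S) : DZeroComplex R S :=
  ofModData (fun i => fibre (.id (toMod (C.X i))))
    (fun i k => by
      have := C.projective i k
      have := C.projective i (k + 1)
      exact inferInstanceAs (Module.Projective Rᵐᵒᵖ ((C.X i).X k × (C.X i).X (k + 1))))
    (fun i => Hom.fibre (C.lamHom i) (C.lamHom i) fun _ _ => rfl)
    (fun i => pathTensor (C.alpHom i))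
    fun i k x => by
      obtain ⟨x, z⟩ := x
      change tensorMap R S (fibreInl (.id (toMod (C.X (i + 1)))) k)
          ((C.alpHom (i + 1)).f k ((C.lamHom (i + 1)).f k x)) +
        tensorMap R S (fibreInr (.id (toMod (C.X (i + 1)))) k)
          ((C.alpHom (i + 1)).f (k + 1) ((C.lamHom (i + 1)).f (k + 1) z)) =
        tensorMap R S _ (tensorMap R S (fibreInl (.id (toMod (C.X i))) k)
          ((C.alpHom i).f k x) + tensorMap R S (fibreInr (.id (toMod (C.X i))) k)
            ((C.alpHom i).f (k + 1) z))
      rw [alpHom_lamHom, alpHom_lamHom, map_add, tensorMap_tensorMap, tensorMap_tensorMap,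
        tensorMap_tensorMap, tensorMap_tensorMap]
      congr 3
      · exact LinearMap.ext fun y => Prod.ext rfl (map_zero ((C.lamHom i).f (k + 1))).symm
      · exact LinearMap.ext fun y => Prod.ext (map_zero ((C.lamHom i).f k)).symm rfl

lemma path_isAcyclic (C : DZeroComplex R S) : C.path.IsAcyclic := fun _ =>
  acyclic_ofMod (fibre_id_exactAt _)

/-- The projection from the path complex. -/
def pathFst (C : DZeroComplex R S) : C.path ⟶ C where
  f i := fromOfMod (X := C.X i) ⟨fun k => LinearMap.fst _ _ _, fun k x => rfl⟩
  comm_lam i := by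
    ext k x
    rfl
  comm_alp i := by
    ext k x
    obtain ⟨x, z⟩ := x
    change tensorMap R S (LinearMap.fst _ _ _ : (fibre (.id (toMod (C.X i)))).X k →ₗ[Rᵐᵒᵖ] _)
      (tensorMap R S (fibreInl (.id (toMod (C.X i))) k) ((C.alpHom i).f k x) +
        tensorMap R S (fibreInr (.id (toMod (C.X i))) k) ((C.alpHom i).f (k + 1) z)) =
      (C.alpHom i).f k x
    rw [map_add, tensorMap_tensorMap, tensorMap_tensorMap, LinearMap.fst_comp_inl,
      LinearMap.fst_comp_inr, tensorMap_id, tensorMap_zero]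
    exact add_zero _

/-- A null-homotopic morphism factors through an acyclic `𝒟₀`-complex. -/
lemma exists_factorization {Y C : DZeroComplex R S} (φ : Y ⟶ C)
    (h : ∀ i, DegOne (toMod (Y.X i)) (toMod (C.X i)))
    (hh : ∀ i, IsNullHomotopy (toModHom (φ.f i)) (h i))
    (hlam : ∀ i k x, h (i + 1) k ((Y.lamHom i).f k x) = (C.lamHom i).f (k + 1) (h i k x))
    (halp : ∀ i k x, (C.alpHom i).f (k + 1) (h (i + 1) k x) =
      tensorMap R S (h i k) ((Y.alpHom i).f k x)) :
    ∃ (E : DZeroComplex R S) (a : Y ⟶ E) (b : E ⟶ C), E.IsAcyclic ∧ a ≫ b = φ := by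
  -- The lift is `y ↦ (φ y, h y)`: the null-homotopy equation says that it is a chain map, and the
  -- compatibilities of `h` say that it commutes with `λ` and `α`.
  refine ⟨C.path, ⟨fun i => toOfMod (X := Y.X i)
    ⟨fun k => ((toModHom (φ.f i)).f k).prod (h i k), fun k x => ?_⟩, fun i => ?_, fun i => ?_⟩,
    C.pathFst, C.path_isAcyclic, ?_⟩
  · refine Prod.ext ((toModHom (φ.f i)).comm k x) ?_
    exact eq_sub_of_add_eq' (hh i k x).symm
  · ext k x
    exact Prod.ext (Hom.lamHom_apply φ i k x) (hlam i k x)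
  · ext k x
    change tensorMap R S (((toModHom (φ.f i)).f k).prod (h i k) :
        _ →ₗ[Rᵐᵒᵖ] (fibre (.id (toMod (C.X i)))).X k) ((Y.alpHom i).f k x) =
      tensorMap R S (fibreInl (.id (toMod (C.X i))) k)
        ((C.alpHom i).f k ((toModHom (φ.f (i + 1))).f k x)) +
      tensorMap R S (fibreInr (.id (toMod (C.X i))) k)
        ((C.alpHom i).f (k + 1) (h (i + 1) k x))
    rw [Hom.alpHom_apply, halp, tensorMap_tensorMap, tensorMap_tensorMap, ← LinearMap.add_apply,
      ← tensorMap_add]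
    congr 2
    exact LinearMap.ext fun y => Prod.ext (by simp) (by simp)
  · apply DZeroComplex.Hom.ext
    funext i
    ext k x
    rfl

end DZeroComplex

end Explicit

/-! ## Kernels of chain maps -/

section Kernels

variable {R : Type u} [Ring R]

namespace ModComplex

/-- For chain maps `p` and `q` from the source and the target of `f`, that are compatible with
maps from `f`, the elementwise form of the acyclicity of the cone of `Ker(p) → Ker(q)`. -/
def KerCone {A B P Q : ModComplex R} (f : Hom A B) (p : Hom A P) (q : Hom B Q) : Prop :=
  ∀ k (x : A.X (k + 1)) (z : B.X (k + 1 + 1)), p.f _ x = 0 → q.f _ z = 0 → A.d k x = 0 →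
    f.f _ x = B.d _ z → ∃ (x' : A.X (k + 1 + 1)) (z' : B.X (k + 1 + 1 + 1)),
      p.f _ x' = 0 ∧ q.f _ z' = 0 ∧ A.d _ x' = x ∧ f.f _ x' - B.d _ z' = z

lemma injective_of_mono {X Y : ChainComplex (ModuleCat.{u} Rᵐᵒᵖ) ℤ} (f : X ⟶ Y) [Mono f] (k : ℤ) :
    Function.Injective ((toModHom f).f k) :=
  (ModuleCat.mono_iff_injective (f.f k)).1 inferInstance

lemma surjective_of_epi {X Y : ChainComplex (ModuleCat.{u} Rᵐᵒᵖ) ℤ} (f : X ⟶ Y) [Epi f] (k : ℤ) :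
    Function.Surjective ((toModHom f).f k) :=
  (ModuleCat.epi_iff_surjective (f.f k)).1 inferInstance

lemma kernel_ι_apply {X Y : ChainComplex (ModuleCat.{u} Rᵐᵒᵖ) ℤ} (f : X ⟶ Y) (k : ℤ)
    (x : (kernel f).X k) : (toModHom f).f k ((toModHom (kernel.ι f)).f k x) = 0 :=
  LinearMap.congr_fun (congrArg (fun f => (f.f k).hom) (kernel.condition f)) x

/-- The explicit complex of kernels maps to the categorical kernel by its universal property. -/
lemma exists_kernel_ι_eq {X Y : ChainComplex (ModuleCat.{u} Rᵐᵒᵖ) ℤ} (f : X ⟶ Y) (k : ℤ)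
    (x : X.X k) (hx : (toModHom f).f k x = 0) :
    ∃ y : (kernel f).X k, (toModHom (kernel.ι f)).f k y = x := by
  let g : ofMod (ker (toModHom f)) ⟶ X :=
    fromOfMod ⟨fun k => Submodule.subtype _, fun k x => rfl⟩
  have hg : g ≫ f = 0 := by
    ext k y
    exact y.2
  refine ⟨(toModHom (kernel.lift f g hg)).f k ⟨x, hx⟩, ?_⟩
  exact LinearMap.congr_fun (congrArg (fun f => (f.f k).hom) (kernel.lift_ι f g hg)) ⟨x, hx⟩

lemma quasiIso_kernel_map_iff {A B P Q : ChainComplex (ModuleCat.{u} Rᵐᵒᵖ) ℤ} (p : A ⟶ P)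
    (q : B ⟶ Q) (f : A ⟶ B) (g : P ⟶ Q) (w : p ≫ g = f ≫ q) :
    QuasiIso (kernel.map p q f g w) ↔ KerCone (toModHom f) (toModHom p) (toModHom q) := by
  rw [quasiIso_iff_coneExact]
  have hι : ∀ k x, (toModHom (kernel.ι q)).f k ((toModHom (kernel.map p q f g w)).f k x) =
      (toModHom f).f k ((toModHom (kernel.ι p)).f k x) := fun k x =>
    LinearMap.congr_fun (congrArg (fun f => (f.f k).hom)
      (kernel.lift_ι q (kernel.ι p ≫ f) (by simp [← w]))) x
  have hp := injective_of_mono (kernel.ι p)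
  have hq := injective_of_mono (kernel.ι q)
  constructor
  · intro h k x z hx hz hdx hxz
    obtain ⟨x, rfl⟩ := exists_kernel_ι_eq p _ x hx
    obtain ⟨z, rfl⟩ := exists_kernel_ι_eq q _ z hz
    obtain ⟨x', z', h1, h2⟩ := h k x z
      (hp _ (by rw [(toModHom (kernel.ι p)).comm, hdx, map_zero]))
      (hq _ (by rw [hι, hxz, (toModHom (kernel.ι q)).comm]))
    refine ⟨_, _, kernel_ι_apply p _ x', kernel_ι_apply q _ z', ?_, ?_⟩
    · rw [← (toModHom (kernel.ι p)).comm, h1]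
    · rw [← hι, ← (toModHom (kernel.ι q)).comm, ← map_sub, h2]
  · intro h k x z hdx hxz
    obtain ⟨x', z', hx', hz', h1, h2⟩ := h k _ _ (kernel_ι_apply p _ x) (kernel_ι_apply q _ z)
      (by rw [← (toModHom (kernel.ι p)).comm, hdx, map_zero])
      (by rw [← hι, hxz, (toModHom (kernel.ι q)).comm])
    obtain ⟨x', rfl⟩ := exists_kernel_ι_eq p _ x' hx'
    obtain ⟨z', rfl⟩ := exists_kernel_ι_eq q _ z' hz'
    refine ⟨x', z', hp _ ?_, hq _ ?_⟩
    · rw [(toModHom (kernel.ι p)).comm, h1]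
    · rw [map_sub, hι, (toModHom (kernel.ι q)).comm, h2]

end ModComplex

end Kernels

/-! ## Reversal of the indexing -/

section Reversal

open ModComplex

variable {R : Type u} [Ring R] {S : Type u} [AddCommGroup S] [Module R S] [Module Rᵐᵒᵖ S]
  [SMulCommClass R Rᵐᵒᵖ S]

namespace DZeroComplex

lemma quasiIso_kerMap_iff (C : DZeroComplex R S) (i : ℕ) :
    QuasiIso (C.kerMap i) ↔ KerCone (C.lamHom (i + 1)) (C.alpHom i) (C.alpHom (i + 1)) :=
  quasiIso_kernel_map_iff _ _ _ _ (C.comm i).symm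

variable (C D : DZeroComplex R S)

/-- The complex `C_{n-p}`, and zero for `n < p`. -/
def revX : ℕ → ℕ → ModComplex R
  -- Recursion on both indices makes the maps at `n - p` typecheck without transport along
  -- equalities of natural numbers.
  | 0, n => toMod (C.X n)
  | _ + 1, 0 => .zero
  | p + 1, n + 1 => revX p n

/-- The map `λ_{n-p-1}`. -/
def revLam : ∀ p n, (C.revX (p + 1) n).Hom (C.revX p n)
  | 0, 0 => .zero _ _
  | 0, n + 1 => C.lamHom n
  | _ + 1, 0 => .zero _ _
  | p + 1, n + 1 => revLam p n

/-- The map `α_{n-p}`. -/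
def revAlp : ∀ p n, (C.revX p n).Hom ((C.revX (p + 1) n).tensor S)
  | 0, 0 => .zero _ _
  | 0, n + 1 => C.alpHom n
  | _ + 1, 0 => .zero _ _
  | p + 1, n + 1 => revAlp p n

lemma revAlp_revLam : ∀ p n, p + 1 < n → ∀ k x, (C.revAlp p n).f k ((C.revLam p n).f k x) =
    tensorMap R S ((C.revLam (p + 1) n).f k) ((C.revAlp (p + 1) n).f k x)
  | 0, n + 2, _ => C.alpHom_lamHom n
  | p + 1, n + 1, h => revAlp_revLam p n (by omega)

/-- The part of `C` up to `n`, indexed downwards. -/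
def rev (n : ℕ) : RevComplex R S n where
  X p := C.revX p n
  lam p := C.revLam p n
  alp p := C.revAlp p n
  comm p := C.revAlp_revLam p n

variable {C D}

lemma rev_isReduced (hC : C.IsReduced) (n : ℕ) : (C.rev n).IsReduced := by
  intro p
  change p < n → ∀ k, Function.Surjective ((C.revAlp p n).f k)
  induction p generalizing n with
  | zero =>
    cases n with
    | zero => exact fun h => absurd h (lt_irrefl _)
    | succ n => exact fun _ k => hC n k
  | succ p ih =>
    cases n with
    | zero => exact fun h => absurd h (by omega)
    | succ n => exact fun h => ih n (by omega)

lemma rev_kerConeExact (n : ℕ)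
    (hC : ∀ i, i + 1 < n → KerCone (C.lamHom (i + 1)) (C.alpHom i) (C.alpHom (i + 1))) :
    (C.rev n).KerConeExact := by
  intro p
  change p + 1 < n → KerCone (C.revLam p n) (C.revAlp (p + 1) n) (C.revAlp p n)
  induction p generalizing n with
  | zero =>
    rcases n with _ | _ | n
    · exact fun h => absurd h (by omega)
    · exact fun h => absurd h (by omega)
    · exact fun _ => hC n (by omega)
  | succ p ih =>
    cases n with
    | zero => exact fun h => absurd h (by omega)
    | succ n => exact fun h => ih n (fun i hi => hC i (by omega)) (by omega)

/-- A morphism, with the indexing reversed. -/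
def revMap (φ : C ⟶ D) : ∀ p n, (C.revX p n).Hom (D.revX p n)
  | 0, n => toModHom (φ.f n)
  | _ + 1, 0 => .zero _ _
  | p + 1, n + 1 => revMap φ p n

lemma revMap_revLam (φ : C ⟶ D) : ∀ p n k x, (revMap φ p n).f k ((C.revLam p n).f k x) =
    (D.revLam p n).f k ((revMap φ (p + 1) n).f k x)
  | 0, 0, _, _ => map_zero _
  | 0, n + 1, k, x => Hom.lamHom_apply φ n k x
  | _ + 1, 0, _, _ => rfl
  | p + 1, n + 1, k, x => revMap_revLam φ p n k x

lemma revAlp_revMap (φ : C ⟶ D) : ∀ p n k x, (D.revAlp p n).f k ((revMap φ p n).f k x) =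
    tensorMap R S ((revMap φ (p + 1) n).f k) ((C.revAlp p n).f k x)
  | 0, 0, _, _ => (map_zero (tensorMap R S _)).symm
  | 0, n + 1, k, x => Hom.alpHom_apply φ n k x
  | _ + 1, 0, _, _ => (map_zero (tensorMap R S _)).symm
  | p + 1, n + 1, k, x => revAlp_revMap φ p n k x

/-- The terms of the reversal have each property that holds for the `C_i` and for zero. -/
lemma revX_property {P : ModComplex R → Prop} (h : ∀ i, P (toMod (C.X i))) (h0 : P .zero) :
    ∀ p n, P (C.revX p n)
  | 0, n => h n
  | _ + 1, 0 => h0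
  | p + 1, n + 1 => revX_property h h0 p n

/-- A uniform bound exists because the terms are zero beyond `p = n`. -/
lemma exists_forall_revX {P : ℤ → ModComplex R → Prop} (hP : ∀ a b A, a ≤ b → P a A → P b A)
    (h : ∀ i, ∃ a, P a (toMod (C.X i))) (h0 : ∀ a, P a .zero) (n : ℕ) :
    ∃ a, ∀ p, P a (C.revX p n) := by
  induction n with
  | zero =>
    obtain ⟨a, ha⟩ := h 0
    refine ⟨a, fun p => ?_⟩
    cases p with
    | zero => exact ha
    | succ p => exact h0 a
  | succ n ih =>
    obtain ⟨a, ha⟩ := ih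
    obtain ⟨b, hb⟩ := h (n + 1)
    refine ⟨max a b, fun p => ?_⟩
    cases p with
    | zero => exact hP _ _ _ (le_max_right _ _) hb
    | succ p => exact hP _ _ _ (le_max_left _ _) (ha p)

lemma revX_eq_zero (h : ∀ k (x : (C.X 0).X k), x = 0) :
    ∀ p n, n ≤ p → ∀ k (x : (C.revX p n).X k), x = 0
  | 0, 0, _, k, x => h k x
  | _ + 1, 0, _, _, _ => rfl
  | p + 1, n + 1, hp, k, x => revX_eq_zero h p n (by omega) k x

lemma exists_revLam_retraction
    (h : ∀ i k, ∃ r : (toMod (C.X (i + 1))).X k →ₗ[Rᵐᵒᵖ] (toMod (C.X i)).X k,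
      ∀ x, r ((C.lamHom i).f k x) = x) :
    ∀ p n k, ∃ r : (C.revX p n).X k →ₗ[Rᵐᵒᵖ] (C.revX (p + 1) n).X k,
      ∀ x, r ((C.revLam p n).f k x) = x
  | 0, 0, _ => ⟨0, fun _ => rfl⟩
  | 0, n + 1, k => h n k
  | _ + 1, 0, _ => ⟨0, fun _ => rfl⟩
  | p + 1, n + 1, k => exists_revLam_retraction h p n k

/-- A family of null-homotopies of the reversal of `φ` that is compatible with `λ` and `α` is one
of the part of `φ` up to `n`. -/
lemma exists_homotopy_of_rev (φ : C ⟶ D) (n : ℕ) (H : ∀ p, DegOne (C.revX p n) (D.revX p n))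
    (hH : ∀ p, IsNullHomotopy (revMap φ p n) (H p))
    (hlam : ∀ p k x, H p k ((C.revLam p n).f k x) = (D.revLam p n).f (k + 1) (H (p + 1) k x))
    (halp : ∀ p k x, (D.revAlp p n).f (k + 1) (H p k x) =
      tensorMap R S (H (p + 1) k) ((C.revAlp p n).f k x)) :
    ∃ h : ∀ i, DegOne (toMod (C.X i)) (toMod (D.X i)), h n = H 0 ∧
      (∀ i ≤ n, IsNullHomotopy (toModHom (φ.f i)) (h i)) ∧
      (∀ i < n, ∀ k x, h (i + 1) k ((C.lamHom i).f k x) = (D.lamHom i).f (k + 1) (h i k x)) ∧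
      ∀ i < n, ∀ k x, (D.alpHom i).f (k + 1) (h (i + 1) k x) =
        tensorMap R S (h i k) ((C.alpHom i).f k x) := by
  induction n with
  | zero =>
    refine ⟨Function.update (fun _ _ => 0) 0 (H 0), Function.update_self _ _ _, fun i hi => ?_,
      fun i hi => absurd hi (by omega), fun i hi => absurd hi (by omega)⟩
    obtain rfl : i = 0 := by omega
    exact hH 0
  | succ n ih =>
    obtain ⟨h, h0, h1, h2, h3⟩ := ih (fun p => H (p + 1)) (fun p => hH (p + 1))
      (fun p => hlam (p + 1)) fun p => halp (p + 1)
    -- The clause `h n = H 0` of the induction hypothesis, applied to the shifted family, turns the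
    -- compatibility between `H 0` and `H 1` into one with `h n`.
    obtain ⟨H₀, e0, e1, e2, e3⟩ : ∃ H₀ : DegOne (toMod (C.X (n + 1))) (toMod (D.X (n + 1))),
        H₀ = H 0 ∧ IsNullHomotopy (toModHom (φ.f (n + 1))) H₀ ∧
        (∀ k x, H₀ k ((C.lamHom n).f k x) = (D.lamHom n).f (k + 1) (h n k x)) ∧
        ∀ k x, (D.alpHom n).f (k + 1) (H₀ k x) = tensorMap R S (h n k) ((C.alpHom n).f k x) :=
      ⟨H 0, rfl, hH 0, h0 ▸ hlam 0, h0 ▸ halp 0⟩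
    refine ⟨Function.update h (n + 1) H₀, (Function.update_self _ _ _).trans e0, fun i hi => ?_,
      fun i hi => ?_, fun i hi => ?_⟩
    · rcases hi.eq_or_lt with rfl | hi
      · rw [Function.update_self]
        exact e1
      · rw [Function.update_of_ne hi.ne]
        exact h1 i (by omega)
    · rw [Function.update_of_ne hi.ne]
      rcases (Nat.lt_succ_iff.1 hi).eq_or_lt with rfl | hi
      · rw [Function.update_self]
        exact e2
      · rw [Function.update_of_ne (by omega)]
        exact h2 i hi
    · rw [Function.update_of_ne hi.ne]
      rcases (Nat.lt_succ_iff.1 hi).eq_or_lt with rfl | hi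
      · rw [Function.update_self]
        exact e3
      · rw [Function.update_of_ne (by omega)]
        exact h3 i hi

end DZeroComplex

end Reversal

/-! ## Morphisms to complexes with equivalent kernels -/

section Factorization

open ModComplex

variable {R : Type u} [Ring R]

namespace ModComplex

lemma ConeExact.exactAt {A B : ModComplex R} {f : Hom A B} (hf : ConeExact f)
    (hA : ∀ k, A.ExactAt k) (k : ℤ) : B.ExactAt k := by
  obtain ⟨k, rfl⟩ : ∃ j, k = j + 1 := ⟨k - 1, by ring⟩
  intro z hz
  obtain ⟨x', z', hx', hz'⟩ := hf k 0 z (map_zero _) (by rw [map_zero, hz])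
  obtain ⟨x, rfl⟩ := hA _ x' hx'
  exact ⟨f.f _ x - z', by rw [map_sub, ← f.comm, hz']⟩

/-- Apply the null-homotopy property to the identity, whose target is exact in all degrees. -/
lemma NullAbove.exists_isContraction {A : ModComplex R} {a : ℤ} (h : A.NullAbove a)
    (hA : ∀ k, A.ExactAt k) : ∃ σ, A.IsContraction σ := by
  obtain ⟨σ, hσ⟩ := (h A fun k _ => hA k).1 (fun _ => LinearMap.id) fun k x => (one_smul _ _).symm
  exact ⟨σ, fun k x => (hσ k x).trans (by rw [one_smul])⟩

lemma nullAbove_zero (a : ℤ) : (zero : ModComplex R).NullAbove a := fun Z _ =>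
  ⟨fun f _ => ⟨fun _ => 0, fun k x => by
    simp [show x = 0 from rfl]⟩, fun f _ => ⟨fun _ => 0, fun k x => by
    simp [show x = 0 from rfl]⟩⟩

end ModComplex

variable {S : Type u} [AddCommGroup S] [Module R S] [Module Rᵐᵒᵖ S] [SMulCommClass R Rᵐᵒᵖ S]

namespace DZeroComplex

variable {Y C : DZeroComplex R S} {n : ℕ}

lemma ClassA.eq_zero (hY : ClassA n Y) (k : ℤ) (x : (Y.X 0).X k) : x = 0 := by
  have h : IsZero ((Y.X 0).X k) :=
    (HomologicalComplex.eval (ModuleCat.{u} Rᵐᵒᵖ) (ComplexShape.down ℤ) k).map_isZero hY.1.zero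
  have h1 : ModuleCat.Hom.hom (𝟙 ((Y.X 0).X k)) x = (0 : (Y.X 0).X k ⟶ (Y.X 0).X k).hom x := by
    rw [h.eq_of_src (𝟙 _) 0]
  exact h1

/-- Acyclicity spreads from the contractible `Y_n` along the homology equivalences `λ_i`, and an
acyclic h-finite complex is contractible. -/
lemma ClassA.exists_isContraction (hY : ClassA n Y) (i : ℕ) (hi : n ≤ i) :
    ∃ σ, (toMod (Y.X i)).IsContraction σ := by
  have hex : ∀ k, (toMod (Y.X i)).ExactAt k := by
    induction i, hi using Nat.le_induction with
    | base =>
      obtain ⟨σ, hσ⟩ := ModComplex.exists_isContraction hY.2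
      exact hσ.exactAt
    | succ i hi ih => exact ((quasiIso_iff_coneExact _).1 (hY.1.quasiIso i hi)).exactAt ih
  obtain ⟨a, ha⟩ := exists_nullAbove_of_isHFinite (hY.1.hfinite i)
  exact (ha a le_rfl).exists_isContraction hex

/-- A family of degree one maps is a compatible family of null-homotopies of `φ` up to `N`. -/
structure IsHomotopyUpTo (φ : Y ⟶ C) (h : ∀ i, DegOne (toMod (Y.X i)) (toMod (C.X i)))
    (N : ℕ) : Prop where
  null : ∀ i ≤ N, IsNullHomotopy (toModHom (φ.f i)) (h i)
  lam : ∀ i < N, ∀ k x, h (i + 1) k ((Y.lamHom i).f k x) = (C.lamHom i).f (k + 1) (h i k x)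
  alp : ∀ i < N, ∀ k x, (C.alpHom i).f (k + 1) (h (i + 1) k x) =
    tensorMap R S (h i k) ((Y.alpHom i).f k x)

/-- `exists_homotopy` in the original indexing; only finitely many terms are nonzero, which gives
the uniform bounds `a` and `b`. -/
lemma exists_isHomotopyUpTo (hS : IsLeftFlat R S) (hred : C.IsReduced)
    (hK : ∀ i, i + 1 < n → KerCone (C.lamHom (i + 1)) (C.alpHom i) (C.alpHom (i + 1)))
    (hY : ClassA n Y) (φ : Y ⟶ C) : ∃ h, IsHomotopyUpTo φ h n := by
  obtain ⟨σ, hσ⟩ := ModComplex.exists_isContraction hY.2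
  let c : RevComplex.ContractedHom (Y.rev n) (C.rev n) :=
    { φ := ⟨fun p => revMap φ p n, fun p => revMap_revLam φ p n⟩
      alp_φ := fun p => revAlp_revMap φ p n
      eq_zero := fun p hp => revX_eq_zero hY.eq_zero p n hp
      σ := σ
      isContraction := hσ }
  obtain ⟨b, hb⟩ := exists_forall_revX (C := Y) (P := fun b A => A.ExactAbove b)
    (fun a b A h hA => hA.mono h) (fun i => exists_exactAbove_of_isHFinite (hY.1.hfinite i))
    (fun a k _ x _ => ⟨0, rfl⟩) n
  -- `exists_forall_revX` takes maxima, so the lower bound is encoded by its negative.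
  obtain ⟨a, ha⟩ := exists_forall_revX (C := Y) (P := fun a A => ∀ a' ≤ -a, A.NullAbove a')
    (fun a b A h hA a' ha' => hA a' (by omega))
    (fun i => by
      obtain ⟨a, ha⟩ := exists_nullAbove_of_isHFinite (hY.1.hfinite i)
      exact ⟨-a, fun a' ha' => ha a' (by omega)⟩)
    (fun a a' _ => nullAbove_zero a') n
  choose r hr using exists_revLam_retraction (C := Y) fun i k =>
    exists_retraction_of_isCofib (hY.1.cofib i) k
  obtain ⟨H, hH⟩ := c.exists_homotopy hS (rev_isReduced hred n) (rev_kerConeExact n hK)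
    (a := -a) (b := b) hb
    (fun p => revX_property (P := fun A => ∀ k, Module.Projective Rᵐᵒᵖ (A.X k)) Y.projective
      (fun k => inferInstanceAs (Module.Projective Rᵐᵒᵖ PUnit.{u + 1})) p n)
    (fun p => r p n) (fun p => hr p n) fun p => ha p _ le_rfl
  obtain ⟨h, -, h1, h2, h3⟩ := exists_homotopy_of_rev φ n H (fun p => (hH p).1)
    (fun p => (hH p).2.1) fun p => (hH p).2.2
  exact ⟨h, h1, h2, h3⟩

/-- For `N ≥ n` both `Y_N` and `Y_{N+1}` are contractible, so the relative lifting problem is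
solvable whatever `Ker(α)` is. -/
lemma IsHomotopyUpTo.exists_succ (hred : C.IsReduced) (hY : ClassA n Y) (φ : Y ⟶ C) {N : ℕ}
    (hN : n ≤ N) {h : ∀ i, DegOne (toMod (Y.X i)) (toMod (C.X i))} (hh : IsHomotopyUpTo φ h N) :
    ∃ h', IsHomotopyUpTo φ h' (N + 1) ∧ ∀ i ≤ N, h' i = h i := by
  obtain ⟨σ, hσ⟩ := hY.exists_isContraction N hN
  obtain ⟨τ, hτ⟩ := hY.exists_isContraction (N + 1) (by omega)
  choose r hr using fun k => exists_retraction_of_isCofib (hY.1.cofib N) k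
  obtain ⟨l, hl, hlam, halp⟩ := exists_nullHomotopy_ext_lift (Y.lamHom N) r hr
    (Y.projective (N + 1)) (C.alpHom N) (hred N) (hτ.nullsInto _ rfl) (hσ.nullsInto _ rfl)
    (toModHom (φ.f (N + 1))) (fun k => tensorMap R S (h N k) ∘ₗ (Y.alpHom N).f k) (by
      intro k x
      change (C.alpHom N).f (k + 1) ((toModHom (φ.f (N + 1))).f (k + 1) x) =
        tensorMap R S ((toMod (C.X N)).d (k + 1))
          (tensorMap R S (h N (k + 1)) ((Y.alpHom N).f (k + 1) x)) +
        tensorMap R S (h N k) ((Y.alpHom N).f k ((toMod (Y.X (N + 1))).d k x))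
      rw [Hom.alpHom_apply, tensorMap_isNullHomotopy (hh.null N le_rfl),
        (Y.alpHom N).comm])
    (fun k => (C.lamHom N).f (k + 1) ∘ₗ h N k) (by
      intro k x
      change (toModHom (φ.f (N + 1))).f (k + 1) ((Y.lamHom N).f (k + 1) x) =
        (toMod (C.X (N + 1))).d (k + 1) ((C.lamHom N).f _ (h N (k + 1) x)) +
          (C.lamHom N).f _ (h N k ((toMod (Y.X N)).d k x))
      rw [Hom.lamHom_apply, hh.null N le_rfl k x, map_add, (C.lamHom N).comm]) (by
      intro k x
      change (C.alpHom N).f (k + 1) ((C.lamHom N).f (k + 1) (h N k x)) =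
        tensorMap R S (h N k) ((Y.alpHom N).f k ((Y.lamHom N).f k x))
      -- The prescriptions agree on `Y_N` by the relation between `λ` and `α`, which needs an `α`
      -- out of `Y_N`. For `N = 0` there is none, but `Y_0` is zero.
      cases N with
      | zero =>
        rw [hY.eq_zero k x, map_zero ((Y.lamHom 0).f k), map_zero ((Y.alpHom 0).f k),
          map_zero (h 0 k), map_zero ((C.lamHom 0).f _), map_zero ((C.alpHom 0).f _), map_zero]
      | succ i =>
        rw [alpHom_lamHom, alpHom_lamHom, hh.alp i (by omega), tensorMap_tensorMap,
          tensorMap_tensorMap]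
        congr 2
        exact LinearMap.ext fun y => (hh.lam i (by omega) k y).symm)
  refine ⟨Function.update h (N + 1) l, ⟨fun i hi => ?_, fun i hi => ?_, fun i hi => ?_⟩,
    fun i hi => Function.update_of_ne (by omega) _ _⟩
  · rcases hi.eq_or_lt with rfl | hi
    · rw [Function.update_self]
      exact hl
    · rw [Function.update_of_ne hi.ne]
      exact hh.null i (by omega)
  · rw [Function.update_of_ne hi.ne]
    rcases (Nat.lt_succ_iff.1 hi).eq_or_lt with rfl | hi
    · rw [Function.update_self]
      exact hlam
    · rw [Function.update_of_ne (by omega)]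
      exact hh.lam i hi
  · rw [Function.update_of_ne hi.ne]
    rcases (Nat.lt_succ_iff.1 hi).eq_or_lt with rfl | hi
    · rw [Function.update_self]
      exact halp
    · rw [Function.update_of_ne (by omega)]
      exact hh.alp i hi

/-- A homotopy up to `n` comes from the tower and is then extended index by index; the homotopies
obtained assemble into one on all of `Y`. -/
theorem isLocal_of_kerCone (hS : IsLeftFlat R S) (hred : C.IsReduced)
    (hK : ∀ i, i + 1 < n → KerCone (C.lamHom (i + 1)) (C.alpHom i) (C.alpHom (i + 1))) :
    IsLocal (ClassA n) C := by
  intro Y hY φ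
  obtain ⟨h₀, hh₀⟩ := exists_isHomotopyUpTo hS hred hK hY φ
  choose next hnext hagree using fun (j : ℕ) (h : {h // IsHomotopyUpTo φ h (n + j)}) =>
    h.2.exists_succ hred hY φ (Nat.le_add_right n j)
  let F : ∀ j, {h // IsHomotopyUpTo φ h (n + j)} := fun j =>
    Nat.rec ⟨h₀, hh₀⟩ (fun j h => ⟨next j h, hnext j h⟩) j
  -- Stage `j` reaches `n + j ≥ j`, and extension keeps earlier values, so reading the value at `i`
  -- from stage `i` is consistent.
  have hF : ∀ j, (F (j + 1)).1 j = (F j).1 j := fun j => hagree j (F j) j (by omega)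
  refine exists_factorization φ (fun i => (F i).1 i) (fun i => (F i).2.null i (by omega))
    (fun i k x => ?_) fun i k x => ?_
  · rw [← hF i]
    exact (F (i + 1)).2.lam i (by omega) k x
  · rw [← hF i]
    exact (F (i + 1)).2.alp i (by omega) k x

end DZeroComplex

end Factorization

/-! ## Free modules on propositions -/

section PropFree

variable (R : Type u) [Ring R]

/-- The free right module of rank one if `p` holds, and zero otherwise. -/
abbrev PropFree (p : Prop) : Type u := PLift p →₀ Rᵐᵒᵖ

namespace PropFree

variable {R} {p q : Prop} {M : Type*} [AddCommGroup M] [Module Rᵐᵒᵖ M]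

/-- The generator. -/
def gen (h : p) : PropFree R p :=
  Finsupp.single ⟨h⟩ 1

/-- The map that sends the generator to a given element. -/
def lift (e : p → M) : PropFree R p →ₗ[Rᵐᵒᵖ] M :=
  Finsupp.linearCombination Rᵐᵒᵖ fun a => e a.down

/-- The map induced by an implication. -/
def incl (h : p → q) : PropFree R p →ₗ[Rᵐᵒᵖ] PropFree R q := lift fun a => gen (h a)

lemma lift_gen (e : p → M) (h : p) : lift e (gen h : PropFree R p) = e h := by
  simp [lift, gen]

lemma incl_gen (f : p → q) (h : p) : incl f (gen h : PropFree R p) = gen (f h) := lift_gen _ _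

lemma hom_ext {f g : PropFree R p →ₗ[Rᵐᵒᵖ] M} (h : ∀ a : p, f (gen a) = g (gen a)) : f = g :=
  Finsupp.lhom_ext' fun a => LinearMap.ext_ring (h a.down)

lemma incl_incl {r : Prop} (f : p → q) (g : q → r) (x : PropFree R p) :
    incl g (incl f x) = incl (fun a => g (f a)) x :=
  LinearMap.congr_fun (hom_ext (f := (incl g ∘ₗ incl f : PropFree R p →ₗ[Rᵐᵒᵖ] _))
    (g := incl fun a => g (f a)) fun a => by
      rw [LinearMap.comp_apply, incl_gen, incl_gen, incl_gen]) x

lemma incl_self (f : p → p) (x : PropFree R p) : incl f x = x :=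
  LinearMap.congr_fun (hom_ext (f := incl f) (g := LinearMap.id) fun _ => incl_gen _ _) x

/-- If `p` holds then so does `q`, and both modules are free on one generator; otherwise the source
is zero. -/
lemma exists_retraction (f : p → q) :
    ∃ r : PropFree R q →ₗ[Rᵐᵒᵖ] PropFree R p, ∀ x, r (incl f x) = x := by
  by_cases hp : p
  · exact ⟨incl fun _ => hp, fun x => by rw [incl_incl, incl_self]⟩
  · exact ⟨0, fun x => LinearMap.congr_fun (hom_ext (f := 0) (g := LinearMap.id)
      fun a => absurd a hp) x⟩

lemma eq_zero (hp : ¬p) (x : PropFree R p) : x = 0 :=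
  LinearMap.congr_fun (hom_ext (f := LinearMap.id) (g := 0) fun a => absurd a hp) x

end PropFree

end PropFree

/-! ## The test objects of the class `𝓐_n` -/

section Test

open ModComplex

variable {R : Type u} [Ring R]

lemma isFiniteComplex_of_bounded {X : ChainComplex (ModuleCat.{u} Rᵐᵒᵖ) ℤ}
    (hproj : IsProjectiveComplex X) (hfin : ∀ k, Module.Finite Rᵐᵒᵖ (X.X k)) (s : Finset ℤ)
    (hs : ∀ k, k ∉ s → ∀ x : X.X k, x = 0) : IsFiniteComplex X := by
  classical
  refine ⟨hproj, ⟨?_⟩⟩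
  have h : (⊤ : Submodule Rᵐᵒᵖ (⨁ k : ℤ, X.X k)) =
      ⨆ k ∈ s, LinearMap.range (DirectSum.lof Rᵐᵒᵖ ℤ (fun k => X.X k) k) := by
    refine (eq_top_iff.2 fun x _ => ?_).symm
    induction x using DirectSum.induction_on with
    | zero => exact zero_mem _
    | of k x =>
      by_cases hk : k ∈ s
      · exact Submodule.mem_iSup_of_mem k (Submodule.mem_iSup_of_mem hk ⟨x, rfl⟩)
      · rw [hs k hk x, map_zero]
        exact zero_mem _
    | add x y hx hy => exact add_mem (hx trivial) (hy trivial)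
  rw [h]
  exact Submodule.fg_biSup s _ fun k _ => by
    have := hfin k
    exact Submodule.fg_range _

lemma isCofib_of_retraction {X Y : ChainComplex (ModuleCat.{u} Rᵐᵒᵖ) ℤ} (f : X ⟶ Y)
    (hY : IsProjectiveComplex Y)
    (h : ∀ k, ∃ r : Y.X k →ₗ[Rᵐᵒᵖ] X.X k, ∀ x, r ((f.f k).hom x) = x) : IsCofib f := by
  intro k
  obtain ⟨r, hr⟩ := h k
  have := hY k
  refine ⟨Function.LeftInverse.injective hr, Module.Projective.of_split
    ((LinearMap.range (f.f k).hom).liftQ (LinearMap.id - (f.f k).hom ∘ₗ r) ?_)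
    (LinearMap.range (f.f k).hom).mkQ ?_⟩
  · rintro _ ⟨x, rfl⟩
    change (f.f k).hom x - (f.f k).hom (r ((f.f k).hom x)) = 0
    rw [hr, sub_self]
  · apply Submodule.linearMap_qext
    ext y
    change (LinearMap.range (f.f k).hom).mkQ (y - (f.f k).hom (r y)) =
      (LinearMap.range (f.f k).hom).mkQ y
    rw [map_sub, sub_eq_self]
    exact (Submodule.Quotient.mk_eq_zero _).2 (LinearMap.mem_range_self _ _)

namespace ModComplex

lemma quasiIso_ofModMap {M N : ModComplex R} {f : Hom M N} (hf : ConeExact f) :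
    QuasiIso (ofModMap f) := by
  rw [quasiIso_iff_coneExact]
  intro j x z hx hz
  rw [toMod_ofMod_d] at hx hz ⊢
  rw [toMod_ofMod_d]
  exact hf j x z hx hz

lemma isContractibleComplex_ofMod {M : ModComplex R} {σ : DegOne M M} (hσ : M.IsContraction σ) :
    IsContractibleComplex (ofMod M) := by
  refine homotopy_of_isNullHomotopy _ σ fun j x => ?_
  rw [toMod_ofMod_d, toMod_ofMod_d]
  exact hσ j x

lemma coneExact_of_exactAt {A B : ModComplex R} (f : Hom A B) (hA : ∀ k, A.ExactAt k)
    (hB : ∀ k, B.ExactAt k) : ConeExact f := by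
  intro k x z hx hz
  obtain ⟨y, rfl⟩ := hA k x hx
  obtain ⟨w, hw⟩ := hB (k + 1) (z - f.f _ y) (by rw [map_sub, ← hz, f.comm, sub_self])
  exact ⟨y, -w, rfl, by rw [map_neg, hw, sub_neg_eq_add, add_sub_cancel]⟩

section Test

variable {k : ℤ} {m i : ℕ} {j : ℤ}

/-- The condition for a generator in the top degree of the test complex. -/
def TestTop (k : ℤ) (m i : ℕ) (j : ℤ) : Prop := m < i ∧ j = k + 1 + 1

/-- The condition for a generator in the bottom degree of the test complex. -/
def TestBot (k : ℤ) (m i : ℕ) (j : ℤ) : Prop := m ≤ i ∧ j = k + 1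

lemma TestTop.self (k : ℤ) (m : ℕ) : TestTop k m (m + 1) (k + 1 + 1) := ⟨m.lt_succ_self, rfl⟩

lemma TestBot.self (k : ℤ) (m : ℕ) : TestBot k m m (k + 1) := ⟨le_rfl, rfl⟩

lemma TestTop.bot (h : TestTop k m i (j + 1)) : TestBot k m i j :=
  ⟨h.1.le, add_right_cancel h.2⟩

lemma TestTop.succ (h : TestTop k m i j) : TestTop k m (i + 1) j := ⟨h.1.trans i.lt_succ_self, h.2⟩

lemma TestBot.succ (h : TestBot k m i j) : TestBot k m (i + 1) j := ⟨h.1.trans i.le_succ, h.2⟩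

lemma TestBot.top (hi : m < i) (h : TestBot k m i j) : TestTop k m i (j + 1) :=
  ⟨hi, congrArg (· + 1) h.2⟩

variable (R)

/-- The cone of the identity of `Rᵐᵒᵖ`, with top degree `k + 2`, for `m < i`, its part of degree
`k + 1` for `i = m`, and zero for `i < m`. -/
abbrev test (k : ℤ) (m i : ℕ) : ModComplex R where
  X j := ModuleCat.of Rᵐᵒᵖ (PropFree R (TestTop k m i j) × PropFree R (TestBot k m i j))
  d _ := LinearMap.prod 0 (PropFree.incl TestTop.bot ∘ₗ LinearMap.fst _ _ _)
  d_d _ _ := Prod.ext rfl (map_zero (PropFree.incl (R := R) (TestTop.bot (k := k) (i := i))))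

/-- The inclusions of the test complexes. -/
def testLam (k : ℤ) (m i : ℕ) : Hom (test R k m i) (test R k m (i + 1)) where
  f j := (PropFree.incl TestTop.succ).prodMap (PropFree.incl TestBot.succ)
  comm j x := by
    refine Prod.ext (map_zero (PropFree.incl (R := R) TestTop.succ)) ?_
    change PropFree.incl TestBot.succ (PropFree.incl TestTop.bot x.1) =
      PropFree.incl TestTop.bot (PropFree.incl TestTop.succ x.1)
    rw [PropFree.incl_incl, PropFree.incl_incl]

variable {R}

lemma testLam_retraction (k : ℤ) (m i : ℕ) (j : ℤ) :
    ∃ r : (test R k m (i + 1)).X j →ₗ[Rᵐᵒᵖ] (test R k m i).X j,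
      ∀ x, r ((testLam R k m i).f j x) = x := by
  obtain ⟨r, hr⟩ := PropFree.exists_retraction (R := R) (TestTop.succ (k := k) (m := m) (i := i)
    (j := j))
  obtain ⟨s, hs⟩ := PropFree.exists_retraction (R := R) (TestBot.succ (k := k) (m := m) (i := i)
    (j := j))
  exact ⟨r.prodMap s, fun x => Prod.ext (hr x.1) (hs x.2)⟩

lemma test_isContraction (k : ℤ) (hi : m < i) : ∃ σ, (test R k m i).IsContraction σ := by
  refine ⟨fun j => (PropFree.incl (R := R) (TestBot.top (j := j) hi) ∘ₗ LinearMap.snd _ _ _).prod 0,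
    fun j x => Prod.ext ?_ ?_⟩
  · change x.1 = 0 + PropFree.incl (TestBot.top hi) (PropFree.incl TestTop.bot x.1)
    rw [PropFree.incl_incl, PropFree.incl_self, zero_add]
  · change x.2 = PropFree.incl TestTop.bot (PropFree.incl (TestBot.top hi) x.2) + 0
    rw [PropFree.incl_incl, PropFree.incl_self, add_zero]

lemma testLam_coneExact (k : ℤ) (hi : m < i) : ConeExact (testLam R k m i) := by
  obtain ⟨σ, hσ⟩ := test_isContraction (R := R) k hi
  obtain ⟨τ, hτ⟩ := test_isContraction (R := R) k (hi.trans i.lt_succ_self)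
  exact coneExact_of_exactAt _ hσ.exactAt hτ.exactAt

lemma test_isFiniteComplex (k : ℤ) (m i : ℕ) : IsFiniteComplex (ofMod (test R k m i)) := by
  refine isFiniteComplex_of_bounded
    (fun j => inferInstanceAs (Module.Projective Rᵐᵒᵖ (PropFree R _ × PropFree R _)))
    (fun j => inferInstanceAs (Module.Finite Rᵐᵒᵖ (PropFree R _ × PropFree R _)))
    {k + 1 + 1, k + 1} fun j hj x => ?_
  simp only [Finset.mem_insert, Finset.mem_singleton, not_or] at hj
  exact Prod.ext (PropFree.eq_zero (fun h => hj.1 h.2) _) (PropFree.eq_zero (fun h => hj.2 h.2) _)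

end Test

end ModComplex

variable {S : Type u} [AddCommGroup S] [Module R S] [Module Rᵐᵒᵖ S] [SMulCommClass R Rᵐᵒᵖ S]

namespace DZeroComplex

variable (R S) in
/-- The `𝒟₀`-complex of the test complexes, with `α = 0`. -/
def test (k : ℤ) (m : ℕ) : DZeroComplex R S :=
  ofModData (fun i => ModComplex.test R k m i) (fun i => (test_isFiniteComplex k m i).1)
    (fun i => testLam R k m i) (fun _ => .zero _ _) fun _ _ _ => (map_zero (tensorMap R S _)).symm

/-- Positivity of `m` makes the term at `0` vanish; `m < n` makes all terms from `n` on cones of an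
identity, hence contractible. -/
lemma classA_test (k : ℤ) {m n : ℕ} (hm : 0 < m) (hmn : m < n) : ClassA n (test R S k m) where
  left :=
    { zero := by
        have h : ∀ j (x : (ModComplex.test R k m 0).X j), x = 0 := fun j x =>
          Prod.ext (PropFree.eq_zero (fun h => absurd h.1 (by omega)) _)
            (PropFree.eq_zero (fun h => absurd h.1 (by omega)) _)
        rw [IsZero.iff_id_eq_zero]
        ext j x
        exact h j x
      hfinite := fun i => ⟨_, test_isFiniteComplex k m i, ⟨.refl _⟩⟩
      cofib := fun i => isCofib_of_retraction _ (test_isFiniteComplex k m _).1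
        (testLam_retraction k m i)
      quasiIso := fun i hi =>
        quasiIso_ofModMap (testLam_coneExact k (hmn.trans_le hi)) }
  right := by
    obtain ⟨σ, hσ⟩ := test_isContraction (R := R) k hmn
    exact isContractibleComplex_ofMod hσ

variable (R S) in
/-- The generator of degree `k + 1` at `m`. -/
def testBotGen (k : ℤ) (m : ℕ) : ((test R S k m).X m).X (k + 1) :=
  (0, PropFree.gen (TestBot.self k m))

variable (R S) in
/-- The generator of degree `k + 2` at `m + 1`. -/
def testTopGen (k : ℤ) (m : ℕ) : ((test R S k m).X (m + 1)).X (k + 1 + 1) :=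
  (PropFree.gen (TestTop.self k m), 0)

lemma test_d_testBotGen (k : ℤ) (m : ℕ) :
    (toMod ((test R S k m).X m)).d k (testBotGen R S k m) = 0 := by
  change (toMod (ofMod (ModComplex.test R k m m))).d k _ = 0
  rw [toMod_ofMod_d]
  exact Prod.ext rfl (map_zero (PropFree.incl TestTop.bot))

lemma test_lam_testBotGen (k : ℤ) (m : ℕ) : ((test R S k m).lamHom m).f _ (testBotGen R S k m) =
    (toMod ((test R S k m).X (m + 1))).d _ (testTopGen R S k m) := by
  change _ = (toMod (ofMod (ModComplex.test R k m (m + 1)))).d _ _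
  rw [toMod_ofMod_d]
  refine Prod.ext (map_zero (PropFree.incl TestTop.succ)) ?_
  change PropFree.incl TestBot.succ (PropFree.gen (TestBot.self k m)) =
    PropFree.incl TestTop.bot (PropFree.gen (TestTop.self k m))
  rw [PropFree.incl_gen, PropFree.incl_gen]

/-- Iterate `λ` from `m` on. The default `0` below `m` is harmless, since test complexes have
generators only from `m` on. -/
lemma exists_lam_family (C : DZeroComplex R S) (m : ℕ) {k : ℤ} (x : (C.X m).X k) :
    ∃ e : ∀ i, (C.X i).X k, e m = x ∧ ∀ i, m ≤ i → e (i + 1) = (C.lamHom i).f k (e i) := by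
  refine ⟨fun i => if h : m ≤ i then
    Nat.leRec (motive := fun i _ => (C.X i).X k) x (fun i _ e => (C.lamHom i).f k e) h else 0,
    ?_, fun i hi => ?_⟩
  · dsimp only
    rw [dif_pos le_rfl, Nat.leRec_self]
  · dsimp only
    rw [dif_pos (by omega), dif_pos hi, Nat.leRec_succ]

/-- Morphisms from the test objects. -/
lemma exists_hom_test (C : DZeroComplex R S) {k : ℤ} {m : ℕ} (x : (C.X (m + 1)).X (k + 1))
    (z : (C.X (m + 1 + 1)).X (k + 1 + 1)) (hαx : (C.alpHom m).f _ x = 0)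
    (hαz : (C.alpHom (m + 1)).f _ z = 0) (hdx : (toMod (C.X (m + 1))).d _ x = 0)
    (hxz : (C.lamHom (m + 1)).f _ x = (toMod (C.X (m + 1 + 1))).d _ z) :
    ∃ φ : test R S k (m + 1) ⟶ C,
      (toModHom (φ.f (m + 1))).f (k + 1) (testBotGen R S k (m + 1)) = x ∧
      (toModHom (φ.f (m + 1 + 1))).f (k + 1 + 1) (testTopGen R S k (m + 1)) = z := by
  -- Commutation with `λ` forces the images of all generators: they are the iterated `λ`-images of
  -- `x` and `z`. The relations that hold for `x` and `z` propagate along `λ`.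
  obtain ⟨x', hx', hxs⟩ := C.exists_lam_family (m + 1) x
  obtain ⟨z', hz', hzs⟩ := C.exists_lam_family (m + 1 + 1) z
  have h1 : ∀ i, m + 1 ≤ i → (toMod (C.X i)).d _ (x' i) = 0 := by
    intro i hi
    induction i, hi using Nat.le_induction with
    | base => rw [hx', hdx]
    | succ i hi ih => rw [hxs i hi, ← (C.lamHom i).comm, ih, map_zero]
  have h2 : ∀ i, m + 1 + 1 ≤ i → (toMod (C.X i)).d _ (z' i) = x' i := by
    intro i hi
    induction i, hi using Nat.le_induction with
    | base => rw [hz', hxs _ le_rfl, hx', hxz]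
    | succ i hi ih => rw [hzs i hi, ← (C.lamHom i).comm, ih, hxs i (by omega)]
  have h3 : ∀ i, m ≤ i → (C.alpHom i).f _ (x' (i + 1)) = 0 := by
    intro i hi
    induction i, hi using Nat.le_induction with
    | base => rw [hx', hαx]
    | succ i hi ih => rw [hxs (i + 1) (by omega), alpHom_lamHom, ih, map_zero]
  have h4 : ∀ i, m + 1 ≤ i → (C.alpHom i).f _ (z' (i + 1)) = 0 := by
    intro i hi
    induction i, hi using Nat.le_induction with
    | base => rw [hz', hαz]
    | succ i hi ih => rw [hzs (i + 1) (by omega), alpHom_lamHom, ih, map_zero]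
  let tz : ∀ i j, TestTop k (m + 1) i j → (C.X i).X j := fun i j h => h.2.symm ▸ z' i
  let tx : ∀ i j, TestBot k (m + 1) i j → (C.X i).X j := fun i j h => h.2.symm ▸ x' i
  let f : ∀ i, ModComplex.Hom (ModComplex.test R k (m + 1) i) (toMod (C.X i)) := fun i =>
    { f := fun j => (PropFree.lift (R := R) (tz i j)).coprod (PropFree.lift (R := R) (tx i j))
      comm := fun j p => by
        have e1 : PropFree.lift (R := R) (tx i j) ∘ₗ PropFree.incl (R := R) TestTop.bot =
            (toMod (C.X i)).d j ∘ₗ PropFree.lift (R := R) (tz i (j + 1)) :=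
          PropFree.hom_ext fun a => by
            obtain rfl : j = k + 1 := add_right_cancel a.2
            rw [LinearMap.comp_apply, LinearMap.comp_apply, PropFree.incl_gen, PropFree.lift_gen,
              PropFree.lift_gen]
            exact (h2 i a.1).symm
        have e2 : (toMod (C.X i)).d j ∘ₗ PropFree.lift (R := R) (tx i (j + 1)) = 0 :=
          PropFree.hom_ext fun a => by
            obtain rfl : j = k := add_right_cancel a.2
            rw [LinearMap.comp_apply, PropFree.lift_gen]
            exact h1 i a.1
        change PropFree.lift (R := R) (tz i j) 0 +
            PropFree.lift (R := R) (tx i j) (PropFree.incl TestTop.bot p.1) =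
          (toMod (C.X i)).d j (PropFree.lift (R := R) (tz i (j + 1)) p.1 +
            PropFree.lift (R := R) (tx i (j + 1)) p.2)
        rw [map_zero, zero_add, map_add,
          show (toMod (C.X i)).d j (PropFree.lift (R := R) (tx i (j + 1)) p.2) = 0 from
            LinearMap.congr_fun e2 p.2, add_zero]
        exact LinearMap.congr_fun e1 p.1 }
  refine ⟨⟨fun i => fromOfMod (f i), fun i => ?_, fun i => ?_⟩, ?_, ?_⟩
  · have e1 : ∀ j, PropFree.lift (R := R) (tz (i + 1) j) ∘ₗ PropFree.incl (R := R) TestTop.succ =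
        (C.lamHom i).f j ∘ₗ PropFree.lift (R := R) (tz i j) := fun j => PropFree.hom_ext fun a => by
      obtain rfl : j = k + 1 + 1 := a.2
      rw [LinearMap.comp_apply, LinearMap.comp_apply, PropFree.incl_gen, PropFree.lift_gen,
        PropFree.lift_gen]
      exact hzs i a.1
    have e2 : ∀ j, PropFree.lift (R := R) (tx (i + 1) j) ∘ₗ PropFree.incl (R := R) TestBot.succ =
        (C.lamHom i).f j ∘ₗ PropFree.lift (R := R) (tx i j) := fun j => PropFree.hom_ext fun a => by
      obtain rfl : j = k + 1 := a.2
      rw [LinearMap.comp_apply, LinearMap.comp_apply, PropFree.incl_gen, PropFree.lift_gen,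
        PropFree.lift_gen]
      exact hxs i a.1
    ext j p
    change PropFree.lift (R := R) (tz (i + 1) j) (PropFree.incl TestTop.succ p.1) +
      PropFree.lift (R := R) (tx (i + 1) j) (PropFree.incl TestBot.succ p.2) =
      (C.lamHom i).f j (PropFree.lift (R := R) (tz i j) p.1 + PropFree.lift (R := R) (tx i j) p.2)
    rw [map_add]
    exact congrArg₂ (· + ·) (LinearMap.congr_fun (e1 j) p.1) (LinearMap.congr_fun (e2 j) p.2)
  · have e1 : ∀ j, (C.alpHom i).f j ∘ₗ PropFree.lift (R := R) (tz (i + 1) j) = 0 := fun j =>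
      PropFree.hom_ext fun a => by
        obtain rfl : j = k + 1 + 1 := a.2
        rw [LinearMap.comp_apply, PropFree.lift_gen]
        exact h4 i (Nat.lt_succ_iff.1 a.1)
    have e2 : ∀ j, (C.alpHom i).f j ∘ₗ PropFree.lift (R := R) (tx (i + 1) j) = 0 := fun j =>
      PropFree.hom_ext fun a => by
        obtain rfl : j = k + 1 := a.2
        rw [LinearMap.comp_apply, PropFree.lift_gen]
        exact h3 i (Nat.succ_le_succ_iff.1 a.1)
    ext j p
    change tensorMap R S ((f i).f j) 0 = (C.alpHom i).f j
      (PropFree.lift (R := R) (tz (i + 1) j) p.1 + PropFree.lift (R := R) (tx (i + 1) j) p.2)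
    rw [map_zero, map_add]
    refine (add_zero (0 : ((toMod (C.X i)).tensor S).X j)).symm.trans ?_
    exact congrArg₂ (· + ·) (LinearMap.congr_fun (e1 j) p.1).symm
      (LinearMap.congr_fun (e2 j) p.2).symm
  · change PropFree.lift (R := R) (tz _ _) 0 +
      PropFree.lift (R := R) (tx _ _) (PropFree.gen (TestBot.self k (m + 1))) = x
    rw [map_zero, zero_add, PropFree.lift_gen]
    exact hx'
  · change PropFree.lift (R := R) (tz _ _) (PropFree.gen (TestTop.self k (m + 1))) +
      PropFree.lift (R := R) (tx _ _) 0 = z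
    rw [map_zero, add_zero, PropFree.lift_gen]
    exact hz'

/-- Cycles of kernels of the `α` that lift to an acyclic `𝒟₀`-complex. -/
lemma kerCone_of_lift (hS : IsLeftFlat R S) {C E : DZeroComplex R S} (hred : C.IsReduced)
    (hE : E.IsAcyclic) (b : E ⟶ C) {m : ℕ} {k : ℤ} (x : (E.X (m + 1)).X (k + 1))
    (z : (E.X (m + 1 + 1)).X (k + 1 + 1)) (hαx : (E.alpHom m).f _ x = 0)
    (hαz : (E.alpHom (m + 1)).f _ z = 0) (hdx : (toMod (E.X (m + 1))).d _ x = 0)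
    (hxz : (E.lamHom (m + 1)).f _ x = (toMod (E.X (m + 1 + 1))).d _ z) :
    ∃ (x' : (C.X (m + 1)).X (k + 1 + 1)) (z' : (C.X (m + 1 + 1)).X (k + 1 + 1 + 1)),
      (C.alpHom m).f _ x' = 0 ∧ (C.alpHom (m + 1)).f _ z' = 0 ∧
      (toMod (C.X (m + 1))).d _ x' = (toModHom (b.f (m + 1))).f _ x ∧
      (C.lamHom (m + 1)).f _ x' - (toMod (C.X (m + 1 + 1))).d _ z' =
        (toModHom (b.f (m + 1 + 1))).f _ z := by
  have hE' := fun i => (acyclic_iff_toMod_exactAt (E.X i)).1 (hE i)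
  -- `u` bounds `x` in `E` but need not be killed by `α`. However, `α u` is a cycle of the acyclic
  -- `E_m ⊗ S`, so it bounds some `w`; lifting `w` through the surjective `α` of `C` gives the
  -- correction `c`.
  obtain ⟨u, rfl⟩ := hE' _ _ x hdx
  obtain ⟨w, hw⟩ := (hE' m _).tensor hS ((E.alpHom m).f _ u) (by
    rw [← hαx]
    exact ((E.alpHom m).comm _ u).symm)
  obtain ⟨c, hc⟩ := hred m _ (tensorMap R S ((toModHom (b.f m)).f _) w)
  replace hc : (C.alpHom m).f _ c = tensorMap R S ((toModHom (b.f m)).f _) w := hc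
  -- The same one level up: `y` bounds `z - λ u`, and `α y + (λ ⊗ 1) w` is a cycle, which gives the
  -- correction `c'`.
  obtain ⟨y, hy⟩ := hE' (m + 1 + 1) _ (z - (E.lamHom (m + 1)).f _ u) (by
    rw [map_sub, ← hxz, (E.lamHom (m + 1)).comm, sub_self])
  obtain ⟨v, hv⟩ := (hE' (m + 1) _).tensor hS
    ((E.alpHom (m + 1)).f _ y + tensorMap R S ((E.lamHom m).f _) w) (by
    have h1 := (E.alpHom (m + 1)).comm _ y
    rw [hy, map_sub, hαz, zero_sub, alpHom_lamHom, ← hw] at h1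
    rw [map_add]
    refine (congrArg₂ (· + ·) h1.symm ((E.lamHom m).tensor S |>.comm _ w).symm).trans ?_
    exact neg_add_cancel _)
  obtain ⟨c', hc'⟩ := hred (m + 1) _ (tensorMap R S ((toModHom (b.f (m + 1))).f _) v)
  replace hc' : (C.alpHom (m + 1)).f _ c' = tensorMap R S ((toModHom (b.f (m + 1))).f _) v := hc'
  have hTb := fun (i : ℕ) k w => (Hom.tensor S (toModHom (b.f i))).comm k w
  simp only [Hom.tensor_f] at hTb
  refine ⟨(toModHom (b.f (m + 1))).f _ u - (toMod (C.X (m + 1))).d _ c,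
    -((toModHom (b.f (m + 1 + 1))).f _ y + (C.lamHom (m + 1)).f _ c -
      (toMod (C.X (m + 1 + 1))).d _ c'), ?_, ?_, ?_, ?_⟩
  · rw [map_sub, Hom.alpHom_apply, (C.alpHom m).comm, hc, ← hw, hTb, sub_self]
  · rw [map_neg, map_sub, map_add, Hom.alpHom_apply, alpHom_lamHom, (C.alpHom (m + 1)).comm, hc,
      hc', ← hTb, hv, map_add, tensorMap_tensorMap, tensorMap_tensorMap,
      show (C.lamHom m).f _ ∘ₗ (toModHom (b.f m)).f _ =
        (toModHom (b.f (m + 1))).f _ ∘ₗ (E.lamHom m).f _ from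
        LinearMap.ext fun t => (Hom.lamHom_apply b m _ t).symm, sub_self, neg_zero]
  · rw [map_sub, (toMod (C.X (m + 1))).d_d, sub_zero, ← (toModHom (b.f (m + 1))).comm]
  · rw [map_sub, map_neg, map_sub, map_add, (toMod (C.X (m + 1 + 1))).d_d, sub_zero,
      ← Hom.lamHom_apply, ← (toModHom (b.f (m + 1 + 1))).comm, hy, map_sub,
      (C.lamHom (m + 1)).comm]
    abel

/-- The test object carries `α = 0`, so in the acyclic complex through which its morphism factors
the images of the generators are killed by `α`, as `kerCone_of_lift` requires. -/
theorem kerCone_of_isLocal (hS : IsLeftFlat R S) {C : DZeroComplex R S} (hred : C.IsReduced)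
    {n : ℕ} (hC : IsLocal (ClassA n) C) (m : ℕ) (hm : m + 1 < n) :
    KerCone (C.lamHom (m + 1)) (C.alpHom m) (C.alpHom (m + 1)) := by
  intro k x z hαx hαz hdx hxz
  obtain ⟨φ, rfl, rfl⟩ := C.exists_hom_test x z hαx hαz hdx hxz
  obtain ⟨E, a, b, hE, rfl⟩ := hC _ (classA_test k m.succ_pos hm) φ
  have hα : ∀ i j (y : ((test R S k (m + 1)).X (i + 1)).X j),
      (E.alpHom i).f j ((toModHom (a.f (i + 1))).f j y) = 0 := fun i j y => by
    rw [Hom.alpHom_apply]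
    exact map_zero (tensorMap R S _)
  refine kerCone_of_lift hS hred hE b ((toModHom (a.f (m + 1))).f _ (testBotGen R S k (m + 1)))
    ((toModHom (a.f (m + 1 + 1))).f _ (testTopGen R S k (m + 1))) (hα _ _ _) (hα _ _ _) ?_ ?_
  · rw [← (toModHom (a.f (m + 1))).comm, test_d_testBotGen, map_zero]
  · rw [← (toModHom (a.f (m + 1 + 1))).comm, ← Hom.lamHom_apply, test_lam_testBotGen]

end DZeroComplex

end Test

/-! ## Homotopy pullbacks and pushouts along surjections -/

section Squares

variable {R : Type u} [Ring R]

namespace ModComplex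

section Elementwise

variable {A B P Q : ModComplex R} {f : Hom A B} {p : Hom A P} {q : Hom B Q} {φ : Hom P Q}

lemma coneExact_id (A : ModComplex R) : ConeExact (Hom.id A) := fun _ _ z _ hz =>
  ⟨z, 0, hz.symm, by rw [map_zero, sub_zero]; rfl⟩

/-- Two out of three, chased in elements, for the short exact sequences `Ker p → A → P` and `Ker q →
B → Q`. -/
lemma ConeExact.kerCone (hf : ConeExact f) (hφ : ConeExact φ)
    (w : ∀ k x, q.f k (f.f k x) = φ.f k (p.f k x)) (hp : ∀ k, Function.Surjective (p.f k))
    (hq : ∀ k, Function.Surjective (q.f k)) : KerCone f p q := by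
  intro k x z hx hz hdx hxz
  obtain ⟨x₀, z₀, rfl, rfl⟩ := hf k x z hdx hxz
  obtain ⟨c, e, hc, he⟩ := hφ (k + 1) (p.f _ x₀) (q.f _ z₀) (by rw [← p.comm, hx]) (by
    rw [map_sub, sub_eq_zero] at hz
    rw [← w, hz, q.comm])
  obtain ⟨x₁, rfl⟩ := hp _ c
  obtain ⟨z₁, rfl⟩ := hq _ e
  refine ⟨x₀ - A.d _ x₁, z₀ - f.f _ x₁ + B.d _ z₁, ?_, ?_, ?_, ?_⟩
  · rw [map_sub, p.comm, hc, sub_self]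
  · rw [map_add, map_sub, ← he, w, q.comm]
    abel
  · rw [map_sub, A.d_d, sub_zero]
  · rw [map_sub, map_add, map_sub, B.d_d, f.comm]
    abel

lemma KerCone.coneExact (h : KerCone f p q) (hφ : ConeExact φ)
    (w : ∀ k x, q.f k (f.f k x) = φ.f k (p.f k x)) (hp : ∀ k, Function.Surjective (p.f k))
    (hq : ∀ k, Function.Surjective (q.f k)) : ConeExact f := by
  intro k x z hdx hxz
  obtain ⟨c, e, hc, he⟩ := hφ k (p.f _ x) (q.f _ z) (by rw [← p.comm, hdx, map_zero])
    (by rw [← w, hxz, q.comm])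
  obtain ⟨x₁, rfl⟩ := hp _ c
  obtain ⟨z₁, rfl⟩ := hq _ e
  obtain ⟨x', z', -, -, hx', hz'⟩ := h k (x - A.d _ x₁) (z - f.f _ x₁ + B.d _ z₁)
    (by rw [map_sub, p.comm, hc, sub_self])
    (by rw [map_add, map_sub, ← he, w, q.comm]; abel)
    (by rw [map_sub, A.d_d, sub_zero, hdx])
    (by rw [map_sub, map_add, map_sub, B.d_d, f.comm, hxz, add_zero])
  refine ⟨x' + x₁, z' + z₁, by rw [map_add, hx', sub_add_cancel], ?_⟩
  rw [map_add, map_add, add_sub_add_comm, hz']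
  abel

/-- A map induced on quotients is an equivalence if the kernels are equivalent. -/
lemma KerCone.coneExact_quotient {s : Hom A P} {t : Hom A Q} {π : Hom P Q}
    (h : KerCone (.id A) s t) (w : ∀ k x, π.f k (s.f k x) = t.f k x)
    (hs : ∀ k, Function.Surjective (s.f k)) (ht : ∀ k, Function.Surjective (t.f k)) :
    ConeExact π := by
  intro k y e hy hye
  obtain ⟨x, rfl⟩ := hs _ y
  obtain ⟨z, rfl⟩ := ht _ e
  obtain ⟨k, rfl⟩ : ∃ j, k = j + 1 := ⟨k - 1, by ring⟩
  have hdx : A.d (k + 1) (x - A.d _ z) = A.d (k + 1) x := by rw [map_sub, A.d_d, sub_zero]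
  -- `d x` is a cycle in `Ker s` that bounds `x - d z` in `Ker t`: a cycle of the cone of `Ker s →
  -- Ker t`.
  obtain ⟨x', z', hx', hz', h1, h2⟩ := h k (A.d (k + 1) x) (x - A.d _ z) (by rw [s.comm, hy])
    (by rw [map_sub, t.comm, ← w, hye, sub_self]) (A.d_d _ _) hdx.symm
  refine ⟨s.f _ (z - z'), 0, ?_, ?_⟩
  · rw [← s.comm, map_sub, show A.d (k + 1 + 1) z' = x' - (x - A.d _ z) by rw [← h2]; simp,
      map_sub, map_sub, map_sub, hx']
    abel
  · rw [w, map_sub, hz', map_zero, sub_zero, sub_zero]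

/-- The contractible complex with terms `M × M` and differentials `(x, y) ↦ (y, 0)`. -/
abbrev disc (M : ModuleCat.{u} Rᵐᵒᵖ) : ModComplex R where
  X _ := ModuleCat.of Rᵐᵒᵖ (M × M)
  d _ := (LinearMap.snd _ _ _).prod 0
  d_d _ _ := rfl

lemma disc_exactAt (M : ModuleCat.{u} Rᵐᵒᵖ) (k : ℤ) : (disc M).ExactAt k := by
  rintro ⟨x, y⟩ h
  exact ⟨(0, x), Prod.ext rfl (congrArg Prod.fst h).symm⟩

/-- Each complex embeds into a contractible one. -/
lemma exists_injective_disc (A : ModComplex R) : ∃ (M : ModuleCat.{u} Rᵐᵒᵖ) (i : Hom A (disc M)),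
    ∀ k, Function.Injective (i.f k) := by
  classical
  let l : ∀ k, A.X k →ₗ[Rᵐᵒᵖ] (⨁ j : ℤ, A.X j) := DirectSum.lof Rᵐᵒᵖ ℤ fun j => A.X j
  -- The embedding is `x ↦ (x, d x)`, with the sum of all terms as common target.
  let i : ∀ k, A.X k →ₗ[Rᵐᵒᵖ] (disc (.of Rᵐᵒᵖ (⨁ j : ℤ, A.X j))).X k :=
    ofSucc fun k => (l (k + 1)).prod (l k ∘ₗ A.d k)
  have hi : ∀ k x, i (k + 1) x = (l (k + 1) x, l k (A.d k x)) := fun k x => by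
    rw [show i (k + 1) = _ from ofSucc_succ _ k]
    rfl
  refine ⟨_, ⟨i, fun k x => ?_⟩, fun k => ?_⟩
  · obtain ⟨k, rfl⟩ : ∃ j, k = j + 1 := ⟨k - 1, by ring⟩
    rw [hi, hi, A.d_d, map_zero]
    rfl
  · obtain ⟨k, rfl⟩ : ∃ j, k = j + 1 := ⟨k - 1, by ring⟩
    intro x y hxy
    change i (k + 1) x = i (k + 1) y at hxy
    rw [hi, hi] at hxy
    exact DirectSum.of_injective (β := fun j => A.X j) _ (congrArg Prod.fst hxy)

end Elementwise

variable {A B C D : ChainComplex (ModuleCat.{u} Rᵐᵒᵖ) ℤ}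

lemma toModHom_comp_apply (f : A ⟶ B) (g : B ⟶ C) (k : ℤ) (x : A.X k) :
    (toModHom (f ≫ g)).f k x = (toModHom g).f k ((toModHom f).f k x) := rfl

lemma toModHom_congr {f g : A ⟶ B} (h : f = g) (k : ℤ) (x : A.X k) :
    (toModHom f).f k x = (toModHom g).f k x := by rw [h]

lemma epi_of_surjective {f : A ⟶ B} (hf : ∀ k, Function.Surjective ((toModHom f).f k)) : Epi f :=
  have := fun k => (ModuleCat.epi_iff_surjective (f.f k)).2 (hf k)
  HomologicalComplex.epi_of_epi_f f inferInstance

lemma mono_of_injective {f : A ⟶ B} (hf : ∀ k, Function.Injective ((toModHom f).f k)) : Mono f :=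
  have := fun k => (ModuleCat.mono_iff_injective (f.f k)).2 (hf k)
  HomologicalComplex.mono_of_mono_f f inferInstance

lemma biprod_ext (k : ℤ) {x y : (B ⊞ C).X k}
    (h₁ : (toModHom (biprod.fst : B ⊞ C ⟶ B)).f k x = (toModHom biprod.fst).f k y)
    (h₂ : (toModHom (biprod.snd : B ⊞ C ⟶ C)).f k x = (toModHom biprod.snd).f k y) : x = y := by
  have h : ∀ x, x = (toModHom (biprod.inl : B ⟶ B ⊞ C)).f k ((toModHom biprod.fst).f k x) +
      (toModHom (biprod.inr : C ⟶ B ⊞ C)).f k ((toModHom biprod.snd).f k x) := fun x =>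
    toModHom_congr (biprod.total (X := B) (Y := C)).symm k x
  rw [h x, h y, h₁, h₂]

section Pullback

variable (f : B ⟶ D) (g : C ⟶ D)

lemma pullback_condition_apply (k : ℤ) (x : (pullback f g).X k) :
    (toModHom f).f k ((toModHom (pullback.fst f g)).f k x) =
      (toModHom g).f k ((toModHom (pullback.snd f g)).f k x) :=
  toModHom_congr pullback.condition k x

lemma pullback_ext (k : ℤ) {x y : (pullback f g).X k}
    (h₁ : (toModHom (pullback.fst f g)).f k x = (toModHom (pullback.fst f g)).f k y)
    (h₂ : (toModHom (pullback.snd f g)).f k x = (toModHom (pullback.snd f g)).f k y) : x = y := by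
  have : Mono (biprod.lift (pullback.fst f g) (pullback.snd f g)) := ⟨fun u v h => by
    apply pullback.hom_ext
    · simpa using h =≫ biprod.fst
    · simpa using h =≫ biprod.snd⟩
  refine injective_of_mono (biprod.lift (pullback.fst f g) (pullback.snd f g)) k
    (biprod_ext k ?_ ?_)
  · rw [← toModHom_comp_apply, ← toModHom_comp_apply, biprod.lift_fst, h₁]
  · rw [← toModHom_comp_apply, ← toModHom_comp_apply, biprod.lift_snd, h₂]

lemma exists_pullback_eq (k : ℤ) (b : B.X k) (c : C.X k)
    (h : (toModHom f).f k b = (toModHom g).f k c) : ∃ x : (pullback f g).X k,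
      (toModHom (pullback.fst f g)).f k x = b ∧ (toModHom (pullback.snd f g)).f k x = c := by
  let P : ModComplex R := (prod (toMod B) (toMod C)).sub
    (fun k => LinearMap.eqLocus ((toModHom f).f k ∘ₗ LinearMap.fst _ _ _)
      ((toModHom g).f k ∘ₗ LinearMap.snd _ _ _)) fun k x hx => by
    change (toModHom f).f k ((toMod B).d k x.1) = (toModHom g).f k ((toMod C).d k x.2)
    rw [(toModHom f).comm, (toModHom g).comm]
    exact congrArg _ hx
  let u : ofMod P ⟶ B :=
    fromOfMod ⟨fun k => LinearMap.fst _ _ _ ∘ₗ Submodule.subtype _, fun k x => rfl⟩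
  let v : ofMod P ⟶ C :=
    fromOfMod ⟨fun k => LinearMap.snd _ _ _ ∘ₗ Submodule.subtype _, fun k x => rfl⟩
  have huv : u ≫ f = v ≫ g := by
    ext k x
    exact x.2
  exact ⟨(toModHom (pullback.lift u v huv)).f k ⟨(b, c), h⟩,
    toModHom_congr (pullback.lift_fst u v huv) k ⟨(b, c), h⟩,
    toModHom_congr (pullback.lift_snd u v huv) k ⟨(b, c), h⟩⟩

end Pullback

section Pushout

variable (f : A ⟶ B) (g : A ⟶ C)

/-- In each degree, `A → B ⊞ C → pushout` is exact. -/
lemma exists_of_pushout_inl_eq_zero (k : ℤ) (y : B.X k)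
    (hy : (toModHom (pushout.inl f g)).f k y = 0) :
    ∃ a, (toModHom f).f k a = y ∧ (toModHom g).f k a = 0 := by
  have h := (IsPushout.of_hasPushout f g).exact_shortComplex.map
    (HomologicalComplex.eval (ModuleCat.{u} Rᵐᵒᵖ) (ComplexShape.down ℤ) k)
  rw [ShortComplex.moduleCat_exact_iff] at h
  obtain ⟨a, ha⟩ : ∃ a : A.X k,
      (toModHom (biprod.lift f (-g))).f k a = (toModHom biprod.inl).f k y := by
    refine h ((toModHom (biprod.inl : B ⟶ B ⊞ C)).f k y) (Eq.trans ?_ hy)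
    exact toModHom_congr (biprod.inl_desc (pushout.inl f g) (pushout.inr f g)) k y
  refine ⟨a, ?_, ?_⟩
  · have := congrArg ((toModHom (biprod.fst : B ⊞ C ⟶ B)).f k) ha
    rw [← toModHom_comp_apply, ← toModHom_comp_apply, biprod.lift_fst, biprod.inl_fst] at this
    exact this
  · have := congrArg ((toModHom (biprod.snd : B ⊞ C ⟶ C)).f k) ha
    rw [← toModHom_comp_apply, ← toModHom_comp_apply, biprod.lift_snd, biprod.inl_snd] at this
    exact neg_eq_zero.1 this

end Pushout

section Square

variable {f : A ⟶ B} {g : A ⟶ C} {h : B ⟶ D} {l : C ⟶ D} (w : f ≫ h = g ≫ l)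

/-- Both `Ker h → Ker p` and `Ker g → Ker (pullback.snd)` are equivalences, and the kernel of
`pullback.snd` is that of `p`; cancelling the first leaves `Ker g → Ker h`. -/
theorem kerCone_of_isHomotopyPullback (hg : ∀ k, Function.Surjective ((toModHom g).f k))
    (hh : ∀ k, Function.Surjective ((toModHom h).f k)) (hP : IsHomotopyPullback f g h l w) :
    KerCone (toModHom f) (toModHom g) (toModHom h) := by
  obtain ⟨B', j, p, hj, hjq, hp, hu⟩ := hP
  rw [quasiIso_iff_coneExact] at hjq hu
  have hjp : ∀ k x, (toModHom p).f k ((toModHom j).f k x) = (toModHom h).f k x := fun k x =>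
    toModHom_congr hj k x
  have hK₁ := hjq.kerCone (coneExact_id (toMod D)) hjp hh (surjective_of_epi p)
  have hK₂ := hu.kerCone (coneExact_id (toMod C))
    (fun k x => toModHom_congr (pullback.lift_snd _ _ _) k x) hg
    (surjective_of_epi (pullback.snd p l))
  have hfst : ∀ k x, (toModHom (pullback.fst p l)).f k ((toModHom (pullback.lift (f := p) (g := l)
      (f ≫ j) g (by rw [Category.assoc, hj, w]))).f k x) =
      (toModHom j).f k ((toModHom f).f k x) := fun k x =>
    toModHom_congr (pullback.lift_fst _ _ _) k x
  have hsnd : ∀ k x, (toModHom (pullback.snd p l)).f k ((toModHom (pullback.lift (f := p) (g := l)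
      (f ≫ j) g (by rw [Category.assoc, hj, w]))).f k x) = (toModHom g).f k x := fun k x =>
    toModHom_congr (pullback.lift_snd _ _ _) k x
  intro k x z hx hz hdx hxz
  obtain ⟨y, hy₁, hy₂⟩ := exists_pullback_eq p l _ ((toModHom j).f _ z) 0
    (by rw [hjp, hz, map_zero])
  obtain ⟨x₀, y₀, hx₀, hy₀, h1, h2⟩ := hK₂ k x y hx hy₂ hdx (pullback_ext p l _
    (by rw [hfst, hxz, (toModHom (pullback.fst p l)).comm, hy₁, (toModHom j).comm])
    (by rw [hsnd, hx, (toModHom (pullback.snd p l)).comm, hy₂, map_zero]))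
  have h3 := congrArg ((toModHom (pullback.fst p l)).f _) h2
  rw [map_sub, hfst, hy₁, (toModHom (pullback.fst p l)).comm, sub_eq_iff_eq_add,
    ← sub_eq_iff_eq_add', ← map_sub] at h3
  have hw : ∀ k x, (toModHom h).f k ((toModHom f).f k x) =
      (toModHom l).f k ((toModHom g).f k x) := fun k x => toModHom_congr w k x
  -- The bounding chain found so far lives in `B'`; the equivalence `Ker h → Ker p` brings it back
  -- to `B`.
  obtain ⟨z₁, -, hz₁, -, h4, -⟩ := hK₁ (k + 1) ((toModHom f).f _ x₀ - z)
    ((toModHom (pullback.fst p l)).f _ y₀) (by rw [map_sub, hw, hx₀, map_zero, hz, sub_zero])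
    (by rw [pullback_condition_apply, hy₀, map_zero])
    (by rw [map_sub, ← (toModHom f).comm, h1, hxz, sub_self]) h3
  exact ⟨x₀, z₁, hx₀, hz₁, h1, by rw [h4, sub_sub_cancel]⟩

/-- A surjective `h` needs no replacement. Then `A` and the pullback both surject onto `C`, with
kernels `Ker g` and a copy of `Ker h`. -/
theorem isHomotopyPullback_of_kerCone (hg : ∀ k, Function.Surjective ((toModHom g).f k))
    (hh : ∀ k, Function.Surjective ((toModHom h).f k))
    (hK : KerCone (toModHom f) (toModHom g) (toModHom h)) : IsHomotopyPullback f g h l w := by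
  have : Epi h := epi_of_surjective hh
  refine ⟨B, 𝟙 B, h, Category.id_comp h, inferInstance, this, ?_⟩
  rw [quasiIso_iff_coneExact]
  have hfst : ∀ k x, (toModHom (pullback.fst h l)).f k ((toModHom (pullback.lift (f := h) (g := l)
      (f ≫ 𝟙 B) g (by rw [Category.comp_id, w]))).f k x) =
      (toModHom f).f k x := fun k x =>
    toModHom_congr (pullback.lift_fst _ _ _) k x
  have hsnd : ∀ k x, (toModHom (pullback.snd h l)).f k ((toModHom (pullback.lift (f := h) (g := l)
      (f ≫ 𝟙 B) g (by rw [Category.comp_id, w]))).f k x) = (toModHom g).f k x := fun k x =>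
    toModHom_congr (pullback.lift_snd _ _ _) k x
  refine KerCone.coneExact (q := toModHom (pullback.snd h l)) (fun k x y hx hy hdx hxy => ?_)
    (coneExact_id (toMod C)) hsnd hg (surjective_of_epi (pullback.snd h l))
  obtain ⟨x', z', hx', hz', h1, h2⟩ := hK k x ((toModHom (pullback.fst h l)).f _ y) hx
    (by rw [pullback_condition_apply, hy, map_zero]) hdx
    (by rw [← (toModHom (pullback.fst h l)).comm, ← hxy, hfst])
  obtain ⟨y', hy₁, hy₂⟩ := exists_pullback_eq h l _ z' 0 (by rw [hz', map_zero])
  refine ⟨x', y', hx', hy₂, h1, pullback_ext h l _ ?_ ?_⟩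
  · rw [map_sub, hfst, (toModHom (pullback.fst h l)).comm, hy₁, h2]
  · rw [map_sub, hsnd, (toModHom (pullback.snd h l)).comm, hy₂, hx', map_zero, sub_zero, hy]

/-- Make `f` injective by adding to `B` an acyclic complex containing `A`. As `g` is surjective, the
pushout is the quotient of the enlarged `B` by the image of `Ker g`, while `D` is its quotient by
`Ker h` plus the acyclic summand; these two kernels are equivalent. -/
theorem isHomotopyPushout_of_kerCone (hg : ∀ k, Function.Surjective ((toModHom g).f k))
    (hh : ∀ k, Function.Surjective ((toModHom h).f k))
    (hK : KerCone (toModHom f) (toModHom g) (toModHom h)) : IsHomotopyPushout f g h l w := by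
  have : Epi g := epi_of_surjective hg
  obtain ⟨M, i₀, hi₀⟩ := exists_injective_disc (toMod A)
  let i : A ⟶ ofMod (prod (toMod B) (disc M)) := toOfMod
    ⟨fun k => ((toModHom f).f k).prod (i₀.f k), fun k x =>
      Prod.ext ((toModHom f).comm k x) (i₀.comm k x)⟩
  let q : ofMod (prod (toMod B) (disc M)) ⟶ B :=
    fromOfMod ⟨fun k => LinearMap.fst _ _ _, fun k x => rfl⟩
  have hiinj : ∀ k, Function.Injective ((toModHom i).f k) := fun k x y hxy =>
    hi₀ k (congrArg Prod.snd hxy)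
  have hi : i ≫ q = f := by
    ext k x
    rfl
  have hq : QuasiIso q := by
    rw [quasiIso_iff_coneExact]
    intro k x z hx hz
    rw [toMod_ofMod_d] at hx
    obtain ⟨e, he⟩ := disc_exactAt M k x.2 (congrArg Prod.snd hx)
    refine ⟨(z, e), 0, ?_, ?_⟩
    · rw [toMod_ofMod_d]
      exact Prod.ext hz.symm he
    · rw [map_zero, sub_zero]
      rfl
  refine ⟨_, i, q, hi, mono_of_injective hiinj, hq, ?_⟩
  rw [quasiIso_iff_coneExact]
  have hw : ∀ k x, (toModHom h).f k ((toModHom f).f k x) =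
      (toModHom l).f k ((toModHom g).f k x) := fun k x => toModHom_congr w k x
  have hker : ∀ k a, (toModHom g).f k a = 0 →
      (toModHom (pushout.inl i g)).f k ((toModHom i).f k a) = 0 := fun k a ha => by
    rw [← toModHom_comp_apply, toModHom_congr (pushout.condition (f := i) (g := g)),
      toModHom_comp_apply, ha, map_zero]
  have hdesc : i ≫ q ≫ h = g ≫ l := by rw [← Category.assoc, hi, w]
  have ht : ∀ k x, (toModHom (pushout.desc (f := i) (g := g) (q ≫ h) l hdesc)).f k
      ((toModHom (pushout.inl i g)).f k x) = (toModHom (q ≫ h)).f k x := fun k x =>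
    toModHom_congr (pushout.inl_desc (q ≫ h) l hdesc) k x
  refine KerCone.coneExact_quotient (s := toModHom (pushout.inl i g)) (t := toModHom (q ≫ h)) ?_ ht
    (surjective_of_epi (pushout.inl i g)) fun k y => ?_
  · intro k x z hx hz hdx hxz
    obtain ⟨a, rfl, ha⟩ := exists_of_pushout_inl_eq_zero i g _ x hx
    have hda : (toMod A).d k a = 0 := hiinj _ (by rw [(toModHom i).comm, hdx, map_zero])
    obtain ⟨a', b', ha', hb', h1, h2⟩ := hK k a ((toModHom q).f _ z) ha hz hda (by
      rw [← (toModHom q).comm]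
      exact congrArg ((toModHom q).f _) hxz)
    have h3 : (toMod (ofMod (prod (toMod B) (disc M)))).d _ ((toModHom i).f _ a' - z) = 0 := by
      rw [map_sub, ← (toModHom i).comm, h1, sub_eq_zero]
      exact hxz
    rw [toMod_ofMod_d] at h3
    obtain ⟨e, he⟩ := disc_exactAt M _ ((toModHom i).f _ a' - z).2 (congrArg Prod.snd h3)
    refine ⟨(toModHom i).f _ a', (b', e), hker _ _ ha', hb', ?_, ?_⟩
    · rw [← (toModHom i).comm, h1]
    · rw [toMod_ofMod_d]
      change (toModHom i).f _ a' - ((toMod B).d _ b', (disc M).d _ e) = z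
      rw [sub_eq_iff_eq_add, ← sub_eq_iff_eq_add']
      exact Prod.ext (sub_eq_iff_eq_add.2 (sub_eq_iff_eq_add'.1 h2)) he.symm
  · obtain ⟨b, hb⟩ := hh k y
    exact ⟨(b, 0), hb⟩

end Square

end ModComplex

end Squares

/-! ## The theorem -/

namespace DZeroComplex

open ModComplex

variable {R S : Type u} [Ring R] [AddCommGroup S] [Module R S] [Module Rᵐᵒᵖ S]
  [SMulCommClass R Rᵐᵒᵖ S]

lemma isExactSquare_iff_quasiIso_kerMap {C : DZeroComplex R S} (hred : C.IsReduced) (i : ℕ) :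
    C.IsExactSquare i ↔ QuasiIso (C.kerMap i) := by
  rw [quasiIso_kerMap_iff]
  exact ⟨fun h => kerCone_of_isHomotopyPullback (C.comm i) (hred i) (hred (i + 1)) h.1,
    fun h => ⟨isHomotopyPullback_of_kerCone (C.comm i) (hred i) (hred (i + 1)) h,
      isHomotopyPushout_of_kerCone (C.comm i) (hred i) (hred (i + 1)) h⟩⟩

lemma isLocal_classA_iff (hS : IsLeftFlat R S) {C : DZeroComplex R S} (hred : C.IsReduced)
    (n : ℕ) : IsLocal (ClassA n) C ↔ ∀ i, i + 1 < n → QuasiIso (C.kerMap i) := by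
  simp_rw [quasiIso_kerMap_iff]
  exact ⟨fun h i hi => kerCone_of_isLocal hS hred h i hi, isLocal_of_kerCone hS hred⟩

end DZeroComplex

end

theorem proposition5 (R S : Type u) [Ring R] [AddCommGroup S] [Module R S] [Module Rᵐᵒᵖ S]
    [SMulCommClass R Rᵐᵒᵖ S] (hS : IsLeftFlat R S) (n : ℕ) (C : DZeroComplex R S)
    (hred : C.IsReduced)
    (hC : DZeroComplex.Completion (DZeroComplex.ClassAUnion (R := R) (S := S)) C) :
    (DZeroComplex.IsLocal (DZeroComplex.ClassA n) C ↔
        ∀ i : ℕ, i + 1 < n → QuasiIso (C.kerMap i)) ∧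
      (DZeroComplex.IsLocal (DZeroComplex.ClassA n) C ↔
        ∀ i : ℕ, i + 1 < n → C.IsExactSquare i) := by
  have h := DZeroComplex.isLocal_classA_iff hS hred n
  simp_rw [DZeroComplex.isExactSquare_iff_quasiIso_kerMap hred]
  exact ⟨h, h⟩
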